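/- **Corollary 1.** Let $r_+,r_-\in H^1(\mathbb R)\cap L^{2,1}(\mathbb R)$ (continuous representatives; $L^{2,1}$ means $(1+z^2)^{1/2}f\in L^2$) satisfy $r_-(z)=4z\,r_+(z)$ for $z\in\mathbb R$. Put $r(k)=2k\,r_+(k^2)$ for $k\in\mathbb R\cup i\mathbb R$, and assume that there is $C_0>0$ with $1-|r(k)|^2\ge C_0^2$ for all $k\in i\mathbb R$. For $x\in\mathbb R$ let $$R(x;z)=\begin{pmatrix}\overline{r_+(z)}\,r_-(z)&\overline{r_+(z)}\,e^{-2i(z+1)x}\\ r_-(z)\,e^{2i(z+1)x}&0\end{pmatrix},\quad z\in\mathbb R,\qquad S(x;k)=\begin{pmatrix}\pm|r(k)|^2&\pm\overline{r(k)}\,e^{-2i(k^2+1)x}\\ r(k)\,e^{2i(k^2+1)x}&0\end{pmatrix},$$ with the sign $+$ for $k\in\mathbb R$ and $-$ for $k\in i\mathbb R\setminus\{0\}$, and let $\tau_1(k)=\mathrm{diag}(1,2k)$, $\tau_2(k)=(2k)^{-1}\tau_1(k)$, $F_j=\tau_jS$. For $j\in\{1,2\}$, a solution of the modified Riemann–Hilbert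 problem is a pair of matrix functions $\Xi_{\pm j}(x;k)$, where $\Xi_{+j}$ is analytic in the open first and third quadrants ($\mathrm{Im}\,k^2>0$), $\Xi_{-j}$ is analytic in the open second and fourth quadrants ($\mathrm{Im}\,k^2<0$), both extend continuously to the boundary $(\mathbb R\cup i\mathbb R)\setminus\{0\}$, and $$\Xi_{+j}-\Xi_{-j}=\Xi_{-j}S+F_j\ \text{ on }(\mathbb R\cup i\mathbb R)\setminus\{0\},\qquad \Xi_{\pm j}(x;k)\to0\ \text{ as } k\to\infty ;$$ moreover $\Xi_{\pm j}\tau_j^{-1}$ is to be an even function of $k$ (that is, a function of $z=k^2$), bounded near $k=0$, and to tend to $0$ as $k\to\infty$. Then for every $x\in\mathbb R$ there are matrix functions $M_\pm(x;z)$, analytic in $\mathbb C^\pm=\{\pm\mathrm{Im}\,z>0\}$ and continuous up to $\mathbb R$, with $M_\pm\to I$ as $z\to\infty$, $M_+-M_-=M_-R$ on $\mathbb R$, and $M_\pm(x;\cdot)-I\in L^2(\mathbb R)$, such that for both $j=1,2$ the modified Riemann–Hilbert problem has one and only one solution, namely $$\Xi_{\pm j}(x;k)=M_\pm(x;k^2)\,\tau_j(k)-\tau_j(k).$$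 The solution is given through the Cauchy operator $\mathcal C(f)(z)=\frac1{2\pi i}\int_{\mathbb R}\frac{f(s)}{s-z}\,ds$: one has $M_-R\in L^2(\mathbb R)$, $$M_\pm(x;z)=I+\mathcal C\big(M_-(x;\cdot)R(x;\cdot)\big)(z),\quad z\in\mathbb C^\pm ,$$ and, in terms of $\Xi_{\pm j}$, for $\pm\mathrm{Im}\,k^2>0$, $$\Xi_{\pm j}(x;k)=\mathcal C\big((\Xi_{-j}S+F_j)\,\tau_j^{-1}\big)(k^2)\;\tau_j(k),$$ where $(\Xi_{-j}S+F_j)\tau_j^{-1}$, being even in $k$, is read as a function of $s=k^2\in\mathbb R$. -/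

import Mathlib

open MeasureTheory Filter Topology Set

noncomputable section

namespace NLSGI

/-- Complex `2 × 2` matrices. -/
abbrev Mat2 : Type := Matrix (Fin 2) (Fin 2) ℂ

/-- `f ∈ H¹(ℝ)`, where `f` denotes the continuous representative of its class: `f` is square
integrable and is a primitive of a square integrable function `g = ∂_z f`. -/
def MemH1 (f : ℝ → ℂ) : Prop :=
  MemLp f 2 volume ∧
    ∃ g : ℝ → ℂ, MemLp g 2 volume ∧ ∀ a b : ℝ, f b - f a = ∫ s in a..b, g s

/-- `f ∈ L^{2,1}(ℝ)`: the function `⟨z⟩ f(z)`, with `⟨z⟩ = (1 + z²)^{1/2}`, is in `L²(ℝ)`. -/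
def MemL21 (f : ℝ → ℂ) : Prop :=
  MemLp (fun z : ℝ => ((Real.sqrt (1 + z ^ 2) : ℝ) : ℂ) * f z) 2 volume

/-- The cross `ℝ ∪ iℝ` in the `k`-plane, i.e. the set where `z = k²` is real. -/
def cross : Set ℂ := {k | k.im = 0 ∨ k.re = 0}

/-- The reflection coefficient `r(k) = 2k r₊(k²)`, for `k ∈ ℝ ∪ iℝ`. -/
def refl (rp : ℝ → ℂ) (k : ℂ) : ℂ := 2 * k * rp (k ^ 2).re

/-- The jump matrix `S(x;k)` on `ℝ ∪ iℝ`, in terms of the reflection coefficient `r(k)`. -/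
def jumpS (rp : ℝ → ℂ) (x : ℝ) (k : ℂ) : Mat2 :=
  if k.im = 0 then
    !![(‖refl rp k‖ : ℂ) ^ 2,
        star (refl rp k) * Complex.exp (-(2 * Complex.I * (k ^ 2 + 1) * x));
      refl rp k * Complex.exp (2 * Complex.I * (k ^ 2 + 1) * x), 0]
  else
    !![-(‖refl rp k‖ : ℂ) ^ 2,
        -(star (refl rp k) * Complex.exp (-(2 * Complex.I * (k ^ 2 + 1) * x)));
      refl rp k * Complex.exp (2 * Complex.I * (k ^ 2 + 1) * x), 0]

/-- The jump matrix `R(x;z)`, `z ∈ ℝ`. -/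
def jumpR (rp rm : ℝ → ℂ) (x z : ℝ) : Mat2 :=
  !![star (rp z) * rm z, star (rp z) * Complex.exp (-(2 * Complex.I * (z + 1) * x));
    rm z * Complex.exp (2 * Complex.I * (z + 1) * x), 0]

/-- `τ₁(k) = diag(1, 2k)` (index `0`) and `τ₂(k) = (2k)⁻¹ τ₁(k)` (index `1`). -/
def tau : Fin 2 → ℂ → Mat2
  | 0, k => !![1, 0; 0, 2 * k]
  | 1, k => (2 * k)⁻¹ • !![1, 0; 0, 2 * k]

/-- The inhomogeneous term `F_j(x;k) = τ_j(k) S(x;k)`. -/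
def jumpF (rp : ℝ → ℂ) (x : ℝ) (j : Fin 2) (k : ℂ) : Mat2 := tau j k * jumpS rp x k

/-- The Cauchy operator `(𝒞 f)(z) = (2πi)⁻¹ ∫_ℝ f(s) / (s - z) ds`, entry by entry. -/
def cauchy (f : ℝ → Mat2) (z : ℂ) : Mat2 :=
  fun a b => (2 * Real.pi * Complex.I)⁻¹ * ∫ s : ℝ, f s a b / ((s : ℂ) - z)

/-- The open half plane `{z : Im z > 0}` (`ε = 1`) or `{z : Im z < 0}` (`ε = -1`). -/
def halfPlane (ε : ℝ) : Set ℂ := {z | 0 < ε * z.im}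

/-- The closed half plane `{z : Im z ≥ 0}` (`ε = 1`) or `{z : Im z ≤ 0}` (`ε = -1`). -/
def closedHalfPlane (ε : ℝ) : Set ℂ := {z | 0 ≤ ε * z.im}

/-- `ε = 1`: the open first and third quadrants of the `k`-plane, where `Im k² > 0`;
`ε = -1`: the open second and fourth quadrants, where `Im k² < 0`. -/
def quadrants (ε : ℝ) : Set ℂ := {k | k ^ 2 ∈ halfPlane ε}

/-- The closed quadrants without the origin, which carries the singularity of `τ₂`. -/
def closedQuadrants (ε : ℝ) : Set ℂ := {k | k ≠ 0 ∧ k ^ 2 ∈ closedHalfPlane ε}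

/-- `M` is analytic in the open half plane, continuous up to the real line, and tends to the
identity matrix as `z → ∞`. -/
structure IsSectionalM (ε : ℝ) (M : ℂ → Mat2) : Prop where
  analytic : ∀ a b, DifferentiableOn ℂ (fun z => M z a b) (halfPlane ε)
  continuous : ContinuousOn M (closedHalfPlane ε)
  normalized : Tendsto M (cocompact ℂ ⊓ 𝓟 (closedHalfPlane ε)) (𝓝 1)

/-- The Riemann–Hilbert problem `M₊ - M₋ = M₋ R` on `ℝ`, `M_± → I` as `z → ∞`. -/
structure IsSolutionM (rp rm : ℝ → ℂ) (x : ℝ) (Mp Mm : ℂ → Mat2) : Prop where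
  plus : IsSectionalM 1 Mp
  minus : IsSectionalM (-1) Mm
  jump : ∀ z : ℝ, Mp z - Mm z = Mm z * jumpR rp rm x z

/-- The requirements on one of the two functions `Ξ_{±j}(x;·)`.
It is analytic in its quadrants, continuous up to `(ℝ ∪ iℝ) ∖ {0}`, and tends to `0` as `k → ∞`.
Moreover `Ξ τ_j⁻¹`, which plays the role of `M - I`, is a function of `z = k²` (it is even in `k`),
stays bounded as `k → 0` and tends to `0` as `k → ∞`. -/
structure IsSectionalXi (ε : ℝ) (j : Fin 2) (Xi : ℂ → Mat2) : Prop where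
  analytic : ∀ a b, DifferentiableOn ℂ (fun k => Xi k a b) (quadrants ε)
  continuous : ContinuousOn Xi (closedQuadrants ε)
  vanishing : Tendsto Xi (cocompact ℂ ⊓ 𝓟 (closedQuadrants ε)) (𝓝 0)
  even : ∀ k ∈ closedQuadrants ε, Xi (-k) * (tau j (-k))⁻¹ = Xi k * (tau j k)⁻¹
  bounded : ∃ C ρ : ℝ, 0 < ρ ∧
    ∀ k ∈ closedQuadrants ε, ‖k‖ < ρ → ∀ a b, ‖(Xi k * (tau j k)⁻¹) a b‖ ≤ C
  normalized : Tendsto (fun k => Xi k * (tau j k)⁻¹)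
    (cocompact ℂ ⊓ 𝓟 (closedQuadrants ε)) (𝓝 0)

/-- The modified Riemann–Hilbert problem in the `k`-plane:
`Ξ_{+j} - Ξ_{-j} = Ξ_{-j} S + F_j` on `(ℝ ∪ iℝ) ∖ {0}` and `Ξ_{±j} → 0` as `k → ∞`. -/
structure IsSolutionXi (rp : ℝ → ℂ) (x : ℝ) (j : Fin 2) (Xip Xim : ℂ → Mat2) : Prop where
  plus : IsSectionalXi 1 j Xip
  minus : IsSectionalXi (-1) j Xim
  jump : ∀ k ∈ cross, k ≠ 0 → Xip k - Xim k = Xim k * jumpS rp x k + jumpF rp x j k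

/-- The function `M(x;k²) τ_j(k) - τ_j(k)`. -/
def xiOf (j : Fin 2) (M : ℂ → Mat2) (k : ℂ) : Mat2 := M (k ^ 2) * tau j k - tau j k

end NLSGI

end

/-!
The matrix problem splits into one problem for each row `m = (m₁, m₂)` of `M_±`. With `u = R₁₂` and
`v = R₂₁` the jump relation is `m₁₊ - m₁₋ = v m₂₊`, `m₂₊ - m₂₋ = u m₁₋`, and the relation between
`r₋` and `r₊` says that `v(z) = 4 z conj u(z)`.

*Existence.* The functions `m - e`, where `e` is a row of the identity matrix, are sought as
one-sided Fourier integrals (`halfFourier`). Since `u` and `v` are in `L¹ ∩ H¹`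
(`isL1H1_of_memH1`), their Fourier transforms are square integrable with the weight `1 + |ξ|`, and
the row problem becomes a pair of Marchenko equations on the half line, whose Hankel operators are
Hilbert–Schmidt in the weighted space (`exists_isCompactOperator_hankel`). The weighted space is
contained in `L¹`, so its elements give functions which are continuous up to the real line and
vanish at infinity, and the Fredholm alternative reduces existence (`exists_isRowSolution`) to the
homogeneous problem. That problem has only the trivial solution (`vanishing`): on the real line
`n₁₊ conj n₁₋ + 4 z n₂₊ conj n₂₋` is the real function `|n₁₋|² + 4 z |n₂₊|²`, so by reflection it
extends to an entire function of growth `o(|z|)`, a constant; square integrability makes the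
constant zero, and so `n₂₊` vanishes for `z > 0`, hence everywhere. The sign of this identity is
needed on the positive half line only.

*Properties of the solution.* Fourier inversion turns the one-sided Fourier integrals into Cauchy
integrals (`cauchy_integral_fourierInv`). As `z R₁₂ = conj R₂₁ / 4` is again in `L¹ ∩ H¹`, the
second column of `M - I` is `O(1/z)` (`IsRowSolution.exists_bound_mul`), which compensates the
factor `2k` in `τ₁` and makes `Ξ_{±1}` vanish at infinity.

*Uniqueness.* The jump matrices in the two planes are conjugate by `τ_j` (`tau_mul_jumpS`), so for
any solution `Ξ` the functions `N = Ξ τ_j⁻¹`, read in the variable `z = k²` by means of a square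
root, have the same jump as `M - I` off the origin. Since `det M = 1`, the function
`z ((N + I) M⁻¹ - I)` has no jump; it is continuous at the origin, because `N` is bounded there, and
`o(|z|)` at infinity, so by Liouville's theorem it is a constant, namely zero
(`eq_of_isSectionalN`).
-/

noncomputable section

namespace NLSGI

/-! ### Gluing holomorphic functions along the real line -/

/-- Morera's theorem lets a line be removed: a continuous function that is holomorphic off the real
line is entire. -/
theorem differentiable_of_continuous_of_im_ne_zero {f : ℂ → ℂ} (hc : Continuous f)
    (hd : ∀ z : ℂ, z.im ≠ 0 → DifferentiableAt ℂ f z) : Differentiable ℂ f := by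
  have key : Complex.IsConservativeOn f univ := by
    intro z w _
    have h : ∀ a b : ℝ, IntervalIntegrable (fun y : ℝ => f (w.re + y * Complex.I)) volume a b :=
      fun a b => (hc.comp (by fun_prop)).intervalIntegrable a b
    have h' : ∀ a b : ℝ, IntervalIntegrable (fun y : ℝ => f (z.re + y * Complex.I)) volume a b :=
      fun a b => (hc.comp (by fun_prop)).intervalIntegrable a b
    -- The rectangle is cut along the real line; the interiors of both parts avoid it.
    have h₁ := Complex.integral_boundary_rect_eq_zero_of_continuousOn_of_differentiableOn f
      z (w.re : ℂ) hc.continuousOn (by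
        rintro ζ ⟨-, hζ⟩
        refine (hd ζ ?_).differentiableWithinAt
        simp only [Complex.ofReal_im, mem_preimage, mem_Ioo] at hζ
        grind)
    have h₂ := Complex.integral_boundary_rect_eq_zero_of_continuousOn_of_differentiableOn f
      (z.re : ℂ) w hc.continuousOn (by
        rintro ζ ⟨-, hζ⟩
        refine (hd ζ ?_).differentiableWithinAt
        simp only [Complex.ofReal_im, mem_preimage, mem_Ioo] at hζ
        grind)
    have e₁ := intervalIntegral.integral_add_adjacent_intervals (h z.im 0) (h 0 w.im)
    have e₂ := intervalIntegral.integral_add_adjacent_intervals (h' z.im 0) (h' 0 w.im)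
    rw [← add_eq_zero_iff_eq_neg, Complex.wedgeIntegral_add_wedgeIntegral_eq]
    simp only [Complex.ofReal_re, Complex.ofReal_im, smul_eq_mul] at h₁ h₂ ⊢
    rw [← e₁, ← e₂]
    linear_combination h₁ + h₂
  have := key.isExactOn_univ hc
  exact differentiableOn_univ.1 (this.differentiableOn isOpen_univ)

theorem tendsto_inv_cocompact : Tendsto (fun z : ℂ => z⁻¹) (cocompact ℂ) (𝓝 0) := by
  rw [← Metric.cobounded_eq_cocompact]
  exact tendsto_inv₀_cobounded

/-- Liouville's theorem for entire functions of growth `o(|z|)`. -/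
theorem entire_const_of_div_tendsto_zero {f : ℂ → ℂ} (hf : Differentiable ℂ f)
    (h : Tendsto (fun z => f z / z) (cocompact ℂ) (𝓝 0)) (z : ℂ) : f z = f 0 := by
  have hd : Differentiable ℂ (dslope f 0) := by
    rw [← differentiableOn_univ] at hf ⊢
    exact (Complex.differentiableOn_dslope univ_mem).2 hf
  have hinv : Tendsto (fun z : ℂ => z⁻¹) (cocompact ℂ) (𝓝 0) := tendsto_inv_cocompact
  have ht : Tendsto (dslope f 0) (cocompact ℂ) (𝓝 0) := by
    have h1 : Tendsto (fun z => f z / z - f 0 * z⁻¹) (cocompact ℂ) (𝓝 0) := by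
      simpa using h.sub (hinv.const_mul (f 0))
    refine h1.congr' ?_
    have : ∀ᶠ z : ℂ in cocompact ℂ, z ≠ 0 := by
      have := (isCompact_singleton (x := (0 : ℂ))).compl_mem_cocompact
      filter_upwards [this] with z hz using hz
    filter_upwards [this] with z hz
    rw [dslope_of_ne _ hz, slope_def_field]
    field_simp
    ring
  have h0 : dslope f 0 z = 0 := hd.apply_eq_of_tendsto_cocompact z ht
  rcases eq_or_ne z 0 with rfl | hz
  · rfl
  · rw [dslope_of_ne _ hz, slope_def_field, div_eq_zero_iff] at h0
    rcases h0 with h0 | h0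
    · exact sub_eq_zero.1 h0
    · simp [hz] at h0

theorem halfPlane_subset_closedHalfPlane (ε : ℝ) : halfPlane ε ⊆ closedHalfPlane ε :=
  fun z (hz : 0 < ε * z.im) => show 0 ≤ ε * z.im from hz.le

theorem isOpen_halfPlane (ε : ℝ) : IsOpen (halfPlane ε) :=
  isOpen_lt continuous_const (by fun_prop)

theorem isClosed_closedHalfPlane (ε : ℝ) : IsClosed (closedHalfPlane ε) :=
  isClosed_le continuous_const (by fun_prop)

theorem ofReal_mem_closedHalfPlane (ε s : ℝ) : (s : ℂ) ∈ closedHalfPlane ε := by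
  simp [closedHalfPlane]

/-- The filter of neighbourhoods of infinity in a closed half plane. -/
abbrev atInf (ε : ℝ) : Filter ℂ := cocompact ℂ ⊓ 𝓟 (closedHalfPlane ε)

theorem tendsto_inv_atInf (ε : ℝ) : Tendsto (fun z : ℂ => z⁻¹) (atInf ε) (𝓝 0) :=
  (tendsto_inv_cocompact).mono_left inf_le_left

theorem eventually_ne_zero_atInf (ε : ℝ) : ∀ᶠ z : ℂ in atInf ε, z ≠ 0 :=
  mem_inf_of_left (isCompact_singleton (x := (0 : ℂ))).compl_mem_cocompact

/-- Two functions, holomorphic in the upper and the lower half plane, continuous up to the real line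
and equal there, are the same constant if they grow slower than `|z|`. -/
theorem glue_const {fp fm : ℂ → ℂ} (hdp : DifferentiableOn ℂ fp (halfPlane 1))
    (hcp : ContinuousOn fp (closedHalfPlane 1)) (hdm : DifferentiableOn ℂ fm (halfPlane (-1)))
    (hcm : ContinuousOn fm (closedHalfPlane (-1))) (heq : ∀ s : ℝ, fp s = fm s)
    (hp : Tendsto (fun z => fp z / z) (atInf 1) (𝓝 0))
    (hm : Tendsto (fun z => fm z / z) (atInf (-1)) (𝓝 0)) :
    (∀ z ∈ closedHalfPlane 1, fp z = fp 0) ∧ (∀ z ∈ closedHalfPlane (-1), fm z = fp 0) := by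
  classical
  set f : ℂ → ℂ := (closedHalfPlane 1).piecewise fp fm with hf
  have hcompl : ∀ z, z ∉ closedHalfPlane 1 → z ∈ halfPlane (-1) := by
    intro z hz
    simp only [closedHalfPlane, halfPlane, mem_ofPred_eq] at hz ⊢
    linarith
  have hfm : ∀ z ∈ closedHalfPlane (-1), f z = fm z := by
    intro z hz
    by_cases h : z ∈ closedHalfPlane 1
    · have : z = (z.re : ℂ) := by
        apply Complex.ext
        · simp
        · simp only [closedHalfPlane, mem_ofPred_eq] at h hz
          simp only [Complex.ofReal_im]
          linarith
      rw [hf, Set.piecewise_eq_of_mem _ _ _ h, this, heq]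
    · exact Set.piecewise_eq_of_notMem _ _ _ h
  have hfp : ∀ z ∈ closedHalfPlane 1, f z = fp z := fun z hz => Set.piecewise_eq_of_mem _ _ _ hz
  have huniv : closedHalfPlane 1 ∪ closedHalfPlane (-1) = univ := by
    ext z
    simp only [closedHalfPlane, mem_union, mem_ofPred_eq, mem_univ, iff_true]
    rcases le_total 0 z.im with h | h
    · left; linarith
    · right; linarith
  have hcont : Continuous f := by
    rw [← continuousOn_univ, ← huniv]
    exact (hcp.congr hfp).union_of_isClosed (hcm.congr hfm) (isClosed_closedHalfPlane _)
      (isClosed_closedHalfPlane _)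
  have hdiff : Differentiable ℂ f := by
    refine differentiable_of_continuous_of_im_ne_zero hcont fun z hz => ?_
    rcases lt_or_gt_of_ne hz with h | h
    · have hz' : z ∈ halfPlane (-1) := by simp only [halfPlane, mem_ofPred_eq]; linarith
      have hn := (isOpen_halfPlane (-1)).mem_nhds hz'
      refine (hdm.differentiableAt hn).congr_of_eventuallyEq ?_
      filter_upwards [hn] with y hy using hfm y (halfPlane_subset_closedHalfPlane _ hy)
    · have hz' : z ∈ halfPlane 1 := by simp only [halfPlane, mem_ofPred_eq]; linarith
      have hn := (isOpen_halfPlane 1).mem_nhds hz'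
      refine (hdp.differentiableAt hn).congr_of_eventuallyEq ?_
      filter_upwards [hn] with y hy using hfp y (halfPlane_subset_closedHalfPlane _ hy)
  have hlim : Tendsto (fun z => f z / z) (cocompact ℂ) (𝓝 0) := by
    have : cocompact ℂ = atInf 1 ⊔ atInf (-1) := by
      rw [← inf_sup_left, sup_principal, huniv, principal_univ, inf_top_eq]
    rw [this]
    refine Tendsto.sup (hp.congr' ?_) (hm.congr' ?_)
    · filter_upwards [mem_inf_of_right (mem_principal_self _)] with z hz
      rw [hfp z hz]
    · filter_upwards [mem_inf_of_right (mem_principal_self _)] with z hz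
      rw [hfm z hz]
  have hall := entire_const_of_div_tendsto_zero hdiff hlim
  have h0 : f 0 = fp 0 := hfp 0 (by simpa using ofReal_mem_closedHalfPlane 1 0)
  exact ⟨fun z hz => by rw [← hfp z hz, hall, h0], fun z hz => by rw [← hfm z hz, hall, h0]⟩

/-- Conjugation exchanges the half planes. -/
theorem conj_mem_halfPlane {ε : ℝ} {z : ℂ} :
    (starRingEnd ℂ) z ∈ halfPlane (-ε) ↔ z ∈ halfPlane ε := by
  simp [halfPlane]

theorem conj_mem_closedHalfPlane {ε : ℝ} {z : ℂ} :
    (starRingEnd ℂ) z ∈ closedHalfPlane (-ε) ↔ z ∈ closedHalfPlane ε := by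
  simp [closedHalfPlane]

/-- A function holomorphic in the lower half plane, reflected to the upper one (and conversely). -/
theorem differentiableOn_conj_conj {ε : ℝ} {f : ℂ → ℂ}
    (hf : DifferentiableOn ℂ f (halfPlane (-ε))) :
    DifferentiableOn ℂ (fun z => (starRingEnd ℂ) (f ((starRingEnd ℂ) z)))
      (halfPlane ε) := by
  intro z hz
  have h := hf.differentiableAt ((isOpen_halfPlane (-ε)).mem_nhds (conj_mem_halfPlane.2 hz))
  have h' := h.conj_conj
  rw [Complex.conj_conj] at h'
  exact h'.differentiableWithinAt

/-! ### One-sided Fourier integrals -/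

/-- The one-sided Fourier integral `∫_{t > 0} c(εt) e^{2πiεtz} dt`. For `ε = ±1` it represents a
function of the Hardy class of the half plane `halfPlane ε`. -/
def halfFourier (ε : ℝ) (c : ℝ → ℂ) (z : ℂ) : ℂ :=
  ∫ t in Ioi (0 : ℝ), c (ε * t) * Complex.exp (2 * Real.pi * Complex.I * (ε * t) * z)

theorem norm_exp_halfFourier (ε t : ℝ) (z : ℂ) :
    ‖Complex.exp (2 * Real.pi * Complex.I * (ε * t) * z)‖ =
      Real.exp (-(2 * Real.pi * t * (ε * z.im))) := by
  rw [Complex.norm_exp]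
  congr 1
  simp
  ring

theorem norm_exp_halfFourier_le {ε t : ℝ} (ht : 0 ≤ t) {z : ℂ} (hz : z ∈ closedHalfPlane ε) :
    ‖Complex.exp (2 * Real.pi * Complex.I * (ε * t) * z)‖ ≤ 1 := by
  rw [norm_exp_halfFourier, Real.exp_le_one_iff]
  have : 0 ≤ ε * z.im := hz
  have := Real.pi_pos
  simp only [Left.neg_nonpos_iff]
  positivity

theorem integrable_halfFourier {ε : ℝ} {c : ℝ → ℂ}
    (hc : IntegrableOn (fun t => c (ε * t)) (Ioi 0)) {z : ℂ} (hz : z ∈ closedHalfPlane ε) :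
    IntegrableOn (fun t : ℝ => c (ε * t) * Complex.exp (2 * Real.pi * Complex.I * (ε * t) * z))
      (Ioi 0) := by
  refine Integrable.mono hc (hc.aestronglyMeasurable.mul (by fun_prop)) ?_
  filter_upwards [ae_restrict_mem measurableSet_Ioi] with t ht
  rw [norm_mul]
  exact mul_le_of_le_one_right (norm_nonneg _) (norm_exp_halfFourier_le (le_of_lt ht) hz)

theorem norm_halfFourier_le {ε : ℝ} {c : ℝ → ℂ}
    (hc : IntegrableOn (fun t => c (ε * t)) (Ioi 0)) {z : ℂ} (hz : z ∈ closedHalfPlane ε) :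
    ‖halfFourier ε c z‖ ≤ ∫ t in Ioi (0 : ℝ), ‖c (ε * t)‖ := by
  refine norm_integral_le_of_norm_le hc.norm ?_
  filter_upwards [ae_restrict_mem measurableSet_Ioi] with t ht
  rw [norm_mul]
  exact mul_le_of_le_one_right (norm_nonneg _) (norm_exp_halfFourier_le (le_of_lt ht) hz)

theorem continuousOn_halfFourier {ε : ℝ} {c : ℝ → ℂ}
    (hc : IntegrableOn (fun t => c (ε * t)) (Ioi 0)) :
    ContinuousOn (halfFourier ε c) (closedHalfPlane ε) := by
  refine continuousOn_of_dominated (bound := fun t => ‖c (ε * t)‖) ?_ ?_ hc.norm ?_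
  · intro z _
    exact hc.aestronglyMeasurable.mul (by fun_prop)
  · intro z hz
    filter_upwards [ae_restrict_mem measurableSet_Ioi] with t ht
    rw [norm_mul]
    exact mul_le_of_le_one_right (norm_nonneg _) (norm_exp_halfFourier_le (le_of_lt ht) hz)
  · exact ae_of_all _ fun t => by fun_prop

theorem differentiableOn_halfFourier {ε : ℝ} {c : ℝ → ℂ}
    (hc : IntegrableOn (fun t => c (ε * t)) (Ioi 0)) :
    DifferentiableOn ℂ (halfFourier ε c) (halfPlane ε) := by
  intro z hz
  have hz' : 0 < ε * z.im := hz
  set δ : ℝ := ε * z.im / 2 with hδ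
  have hδ0 : 0 < δ := by positivity
  have hs : {w : ℂ | δ < ε * w.im} ∈ 𝓝 z :=
    (isOpen_lt continuous_const (by fun_prop)).mem_nhds (show δ < ε * z.im by rw [hδ]; linarith)
  refine ((hasDerivAt_integral_of_dominated_loc_of_deriv_le (μ := volume.restrict (Ioi 0))
    (F := fun w t => c (ε * t) * Complex.exp (2 * Real.pi * Complex.I * (ε * t) * w))
    (F' := fun w t => c (ε * t) * (Complex.exp (2 * Real.pi * Complex.I * (ε * t) * w) *
      (2 * Real.pi * Complex.I * (ε * t)))) (bound := fun t => ‖c (ε * t)‖ * (|ε| * δ⁻¹))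
    hs ?_ ?_ ?_ ?_ ?_ ?_).2).differentiableAt.differentiableWithinAt
  · exact Eventually.of_forall fun w => hc.aestronglyMeasurable.mul (by fun_prop)
  · exact integrable_halfFourier hc (halfPlane_subset_closedHalfPlane _ hz)
  · exact hc.aestronglyMeasurable.mul (by fun_prop)
  · filter_upwards [ae_restrict_mem measurableSet_Ioi] with t ht w hw
    have ht' : 0 < t := ht
    have hw' : δ < ε * w.im := hw
    rw [norm_mul, norm_mul, norm_exp_halfFourier]
    refine mul_le_mul_of_nonneg_left ?_ (norm_nonneg _)
    have hn : ‖(2 * Real.pi * Complex.I * (ε * t) : ℂ)‖ = 2 * Real.pi * t * |ε| := by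
      simp [abs_of_pos Real.pi_pos, abs_of_pos ht']
      ring
    rw [hn]
    have h1 : 2 * Real.pi * t * δ ≤ Real.exp (2 * Real.pi * t * (ε * w.im)) := by
      have h2 : 2 * Real.pi * t * δ ≤ 2 * Real.pi * t * (ε * w.im) := by
        have := Real.pi_pos
        gcongr
      linarith [Real.add_one_le_exp (2 * Real.pi * t * (ε * w.im))]
    rw [Real.exp_neg]
    have hE := Real.exp_pos (2 * Real.pi * t * (ε * w.im))
    rw [inv_mul_le_iff₀ hE]
    calc 2 * Real.pi * t * |ε| = (2 * Real.pi * t * δ) * (|ε| * δ⁻¹) := by field_simp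
      _ ≤ _ := by gcongr
  · exact hc.norm.mul_const _
  · refine ae_of_all _ fun t w _ => ?_
    have h1 : HasDerivAt (fun w : ℂ => 2 * Real.pi * Complex.I * (ε * t) * w)
        (2 * Real.pi * Complex.I * (ε * t)) w := by
      simpa using (hasDerivAt_id w).const_mul (2 * Real.pi * Complex.I * (ε * t) : ℂ)
    exact h1.cexp.const_mul _

theorem closedHalfPlane_one_of {ε : ℝ} {z : ℂ} (hz : z ∈ closedHalfPlane ε) :
    (ε : ℂ) * z ∈ closedHalfPlane 1 := by
  simpa [closedHalfPlane] using hz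

theorem halfFourier_eq_one (ε : ℝ) (c : ℝ → ℂ) (z : ℂ) :
    halfFourier ε c z = halfFourier 1 (fun t => c (ε * t)) (ε * z) := by
  simp only [halfFourier, one_mul]
  congr 1
  ext t
  congr 2
  push_cast
  ring

/-- The Riemann–Lebesgue lemma in the closed upper half plane. -/
theorem tendsto_halfFourier_one {c : ℝ → ℂ} (hc : Integrable c) :
    Tendsto (halfFourier 1 c) (atInf 1) (𝓝 0) := by
  rw [Metric.tendsto_nhds]
  intro η hη
  obtain ⟨ψ, hψs, hψd, hψ⟩ := MemLp.exist_eLpNorm_sub_le (p := 1) (by simp) le_rfl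
    (memLp_one_iff_integrable.2 hc) (half_pos hη)
  have hψc : Continuous ψ := hψd.continuous
  have hψi : Integrable ψ := hψc.integrable_of_hasCompactSupport hψs
  have hψ'c : Continuous (deriv ψ) := hψd.continuous_deriv (by simp)
  have hψ'i : Integrable (deriv ψ) := hψ'c.integrable_of_hasCompactSupport hψs.deriv
  have hdiff : ∀ z ∈ closedHalfPlane 1,
      ‖halfFourier 1 c z - halfFourier 1 ψ z‖ ≤ η / 2 := by
    intro z hz
    have e : halfFourier 1 c z - halfFourier 1 ψ z = halfFourier 1 (c - ψ) z := by
      simp only [halfFourier]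
      rw [← integral_sub (integrable_halfFourier (by simpa using hc.integrableOn) hz)
        (integrable_halfFourier (by simpa using hψi.integrableOn) hz)]
      congr 1
      ext t
      simp only [Pi.sub_apply]
      ring
    rw [e]
    refine (norm_halfFourier_le (by simpa only [one_mul] using (hc.sub hψi).integrableOn)
      hz).trans ?_
    have h1 : (∫ t in Ioi (0 : ℝ), ‖(c - ψ) (1 * t)‖) ≤ ∫ t, ‖(c - ψ) t‖ := by
      simp only [one_mul]
      exact setIntegral_le_integral (hc.sub hψi).norm (ae_of_all _ fun t => norm_nonneg _)
    refine h1.trans ?_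
    rw [integral_norm_eq_lintegral_enorm (hc.sub hψi).aestronglyMeasurable,
      ← eLpNorm_one_eq_lintegral_enorm]
    exact ENNReal.toReal_le_of_le_ofReal (by positivity) hψ
  set K : ℝ := ‖ψ 0‖ + ∫ t in Ioi (0 : ℝ), ‖deriv ψ t‖
  -- Integration by parts: a smooth compactly supported `ψ` gives decay like `1/|z|`.
  have hdecay : ∀ z ∈ closedHalfPlane 1, ‖2 * Real.pi * Complex.I * z * halfFourier 1 ψ z‖ ≤ K := by
    intro z hz
    have hd : ∀ t : ℝ, HasDerivAt
        (fun t : ℝ => ψ t * Complex.exp (2 * Real.pi * Complex.I * (1 * t) * z))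
        (deriv ψ t * Complex.exp (2 * Real.pi * Complex.I * (1 * t) * z) +
          ψ t * (Complex.exp (2 * Real.pi * Complex.I * (1 * t) * z) *
            (2 * Real.pi * Complex.I * z))) t := by
      intro t
      refine ((hψd.differentiable (by simp)) t).hasDerivAt.mul ?_
      have h1 : HasDerivAt (fun t : ℝ => 2 * Real.pi * Complex.I * (1 * t) * z)
          (2 * Real.pi * Complex.I * z) t := by
        have := ((Complex.ofRealCLM.hasDerivAt (x := t)).const_mul
          (2 * Real.pi * Complex.I : ℂ)).mul_const z
        simpa using this
      exact h1.cexp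
    have hI1 : Integrable (fun t : ℝ => deriv ψ t *
        Complex.exp (2 * Real.pi * Complex.I * (1 * t) * z)) (volume.restrict (Ioi 0)) := by
      have := integrable_halfFourier (ε := 1) (c := deriv ψ)
        (by simpa using hψ'i.integrableOn) hz
      simpa only [one_mul, Complex.ofReal_one, IntegrableOn] using this
    have hI2 : Integrable (fun t : ℝ => ψ t *
        (Complex.exp (2 * Real.pi * Complex.I * (1 * t) * z) * (2 * Real.pi * Complex.I * z)))
        (volume.restrict (Ioi 0)) := by
      have := (integrable_halfFourier (ε := 1) (c := ψ)
        (by simpa using hψi.integrableOn) hz).mul_const (2 * Real.pi * Complex.I * z)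
      simpa only [one_mul, Complex.ofReal_one, IntegrableOn, mul_assoc] using this
    have hsupp : HasCompactSupport
        (fun t : ℝ => ψ t * Complex.exp (2 * Real.pi * Complex.I * (1 * t) * z)) :=
      hψs.mul_right
    have hi := integral_Ioi_of_hasDerivAt_of_tendsto' (a := 0) (m := 0) (fun t _ => hd t)
      (hI1.add hI2) (hsupp.is_zero_at_infty.mono_left atTop_le_cocompact)
    rw [integral_add hI1 hI2] at hi
    have e1 : (∫ t in Ioi (0 : ℝ), deriv ψ t *
        Complex.exp (2 * Real.pi * Complex.I * (1 * t) * z)) = halfFourier 1 (deriv ψ) z := by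
      simp [halfFourier]
    have e2 : (∫ t in Ioi (0 : ℝ), ψ t * (Complex.exp (2 * Real.pi * Complex.I * (1 * t) * z) *
        (2 * Real.pi * Complex.I * z))) = 2 * Real.pi * Complex.I * z * halfFourier 1 ψ z := by
      rw [mul_comm _ (halfFourier 1 ψ z), halfFourier, ← integral_mul_const]
      simp only [mul_assoc, one_mul, Complex.ofReal_one]
    rw [e1, e2] at hi
    have e3 : 2 * Real.pi * Complex.I * z * halfFourier 1 ψ z =
        -(ψ 0 + halfFourier 1 (deriv ψ) z) := by
      have : Complex.exp (2 * Real.pi * Complex.I * (1 * ((0 : ℝ) : ℂ)) * z) = 1 := by simp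
      rw [this] at hi
      linear_combination hi
    rw [e3, norm_neg]
    refine (norm_add_le _ _).trans ?_
    have := norm_halfFourier_le (ε := 1) (c := deriv ψ) (by simpa using hψ'i.integrableOn) hz
    simp only [one_mul] at this
    simp only [K]
    gcongr
  have hlim : Tendsto (fun z : ℂ => K * ‖z⁻¹‖) (atInf 1) (𝓝 0) := by
    simpa using ((tendsto_inv_atInf 1).norm).const_mul K
  filter_upwards [hlim.eventually (gt_mem_nhds (half_pos hη)), eventually_ne_zero_atInf 1,
    mem_inf_of_right (mem_principal_self _)] with z hz1 hz0 hz2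
  rw [dist_zero_right]
  have h3 : ‖halfFourier 1 ψ z‖ < η / 2 := by
    refine lt_of_le_of_lt ?_ hz1
    have := hdecay z hz2
    rw [norm_inv, ← div_eq_mul_inv, le_div_iff₀ (norm_pos_iff.2 hz0)]
    refine le_trans ?_ this
    rw [norm_mul, norm_mul]
    have h4 : (1 : ℝ) ≤ ‖(2 * Real.pi * Complex.I : ℂ)‖ := by
      simp [abs_of_pos Real.pi_pos]
      linarith [Real.pi_gt_three]
    nlinarith [mul_nonneg (norm_nonneg z) (norm_nonneg (halfFourier 1 ψ z))]
  have := hdiff z hz2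
  calc ‖halfFourier 1 c z‖ = ‖(halfFourier 1 c z - halfFourier 1 ψ z) + halfFourier 1 ψ z‖ := by
        ring_nf
    _ ≤ _ := norm_add_le _ _
    _ < η := by linarith

/-- Smallness at infinity of a one-sided Fourier integral, in its closed half plane. -/
theorem tendsto_halfFourier {ε : ℝ} (hε : ε = 1 ∨ ε = -1) {c : ℝ → ℂ} (hc : Integrable c) :
    Tendsto (halfFourier ε c) (atInf ε) (𝓝 0) := by
  have hε0 : ε ≠ 0 := by rcases hε with rfl | rfl <;> norm_num
  have h1 := tendsto_halfFourier_one (hc.comp_mul_left' hε0)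
  have h2 : Tendsto (fun z : ℂ => (ε : ℂ) * z) (atInf ε) (atInf 1) := by
    refine tendsto_inf.2 ⟨?_, tendsto_principal.2 ?_⟩
    · refine Tendsto.mono_left ?_ inf_le_left
      have hε' : (ε : ℂ) ≠ 0 := by exact_mod_cast hε0
      exact (Homeomorph.mulLeft₀ (ε : ℂ) hε').isClosedEmbedding.tendsto_cocompact
    · filter_upwards [mem_inf_of_right (mem_principal_self _)] with z hz
        using closedHalfPlane_one_of hz
  refine (h1.comp h2).congr fun z => ?_
  rw [Function.comp_apply, ← halfFourier_eq_one]

theorem integrableOn_comp_mul {ε : ℝ} (hε : ε = 1 ∨ ε = -1) {c : ℝ → ℂ} (hc : Integrable c) :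
    IntegrableOn (fun t => c (ε * t)) (Ioi 0) := by
  have hε0 : ε ≠ 0 := by rcases hε with rfl | rfl <;> norm_num
  exact (hc.comp_mul_left' hε0).integrableOn

/-! ### Fourier transforms of integrable and square integrable functions -/

open scoped FourierTransform SchwartzMap

theorem integral_fourier_mul_flip {f g : ℝ → ℂ} (hf : Integrable f) (hg : Integrable g) :
    ∫ ξ, 𝓕 f ξ * g ξ = ∫ s, f s * 𝓕 g s := by
  have := VectorFourier.integral_fourierIntegral_smul_eq_flip (μ := volume) (ν := volume)
    (e := Real.fourierChar) (L := innerₗ ℝ) Real.continuous_fourierChar continuous_inner hf hg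
  rw [flip_innerₗ] at this
  exact this

theorem integral_fourierInv_mul_flip {f g : ℝ → ℂ} (hf : Integrable f) (hg : Integrable g) :
    ∫ ξ, 𝓕⁻ f ξ * g ξ = ∫ s, f s * 𝓕⁻ g s := by
  rw [Real.fourierInv_eq_fourier_comp_neg, integral_fourier_mul_flip hf.comp_neg hg,
    ← integral_neg_eq_self]
  simp [Real.fourierInv_eq_fourier_neg]

/-- If both `c` and its inverse Fourier transform are integrable then `c = 𝓕 (𝓕⁻ c)` almost
everywhere; no continuity of `c` is assumed. -/
theorem fourier_fourierInv_ae {c : ℝ → ℂ} (hc : Integrable c) (hf : Integrable (𝓕⁻ c)) :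
    𝓕 (𝓕⁻ c) =ᵐ[volume] c := by
  have hcont : Continuous (𝓕 (𝓕⁻ c)) :=
    VectorFourier.fourierIntegral_continuous Real.continuous_fourierChar continuous_inner hf
  refine ae_eq_of_integral_contDiff_smul_eq hcont.locallyIntegrable hc.locallyIntegrable ?_
  intro g hg hgs
  have hgd : ContDiff ℝ (⊤ : ℕ∞) (fun x => (g x : ℂ)) := Complex.ofRealCLM.contDiff.comp hg
  have hgs' : HasCompactSupport (fun x => (g x : ℂ)) := hgs.comp_left Complex.ofReal_zero
  set G : 𝓢(ℝ, ℂ) := hgs'.toSchwartzMap hgd with hG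
  have hGv : ∀ x, G x = g x := fun x => rfl
  calc ∫ x, g x • 𝓕 (𝓕⁻ c) x = ∫ x, 𝓕 (𝓕⁻ c) x * G x := by
        congr 1; ext x; rw [hGv, Complex.real_smul, mul_comm]
    _ = ∫ x, 𝓕⁻ c x * 𝓕 (G : ℝ → ℂ) x := integral_fourier_mul_flip hf G.integrable
    _ = ∫ x, c x * 𝓕⁻ (𝓕 (G : ℝ → ℂ)) x := by
        rw [← SchwartzMap.fourier_coe]
        exact integral_fourierInv_mul_flip hc (𝓕 G).integrable
    _ = ∫ x, g x • c x := by
        rw [← SchwartzMap.fourier_coe, ← SchwartzMap.fourierInv_coe,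
          FourierTransform.fourierInv_fourier_eq]
        congr 1; ext x; rw [hGv, Complex.real_smul, mul_comm]

theorem ae_eq_zero_of_fourierInv_eq_zero {c : ℝ → ℂ} (hc : Integrable c)
    (h : ∀ s, 𝓕⁻ c s = 0) : c =ᵐ[volume] 0 := by
  have h0 : 𝓕⁻ c = 0 := funext h
  have := fourier_fourierInv_ae hc (by rw [h0]; exact integrable_zero _ _ _)
  refine this.symm.trans (Eventually.of_forall fun x => ?_)
  rw [h0, Real.fourier_eq]
  simp

/-- On `L¹ ∩ L²` the Fourier integral is a representative of the Fourier transform on `L²`. -/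
theorem fourier_toLp_ae {f : ℝ → ℂ} (h1 : Integrable f) (h2 : MemLp f 2) :
    ((𝓕 (h2.toLp f) : Lp ℂ 2 (volume : Measure ℝ)) : ℝ → ℂ) =ᵐ[volume] 𝓕 f := by
  have hcont : Continuous (𝓕 f) :=
    VectorFourier.fourierIntegral_continuous Real.continuous_fourierChar continuous_inner h1
  refine ae_eq_of_integral_contDiff_smul_eq
    ((Lp.memLp (𝓕 (h2.toLp f))).locallyIntegrable (by norm_num)) hcont.locallyIntegrable ?_
  intro g hg hgs
  have hgd : ContDiff ℝ (⊤ : ℕ∞) (fun x => (g x : ℂ)) := Complex.ofRealCLM.contDiff.comp hg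
  have hgs' : HasCompactSupport (fun x => (g x : ℂ)) := hgs.comp_left Complex.ofReal_zero
  set G : 𝓢(ℝ, ℂ) := hgs'.toSchwartzMap hgd with hG
  have hGv : ∀ x, G x = g x := fun x => rfl
  have key := congrArg (fun T => T G) (Lp.fourier_toTemperedDistribution_eq (h2.toLp f))
  simp only [TemperedDistribution.fourier_apply, Lp.toTemperedDistribution_apply] at key
  calc ∫ x, g x • (𝓕 (h2.toLp f) : Lp ℂ 2 (volume : Measure ℝ)) x
      = ∫ x, (𝓕 G) x • (h2.toLp f) x := by rw [key]; rfl
    _ = ∫ x, f x * 𝓕 (G : ℝ → ℂ) x := by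
        refine integral_congr_ae ?_
        filter_upwards [h2.coeFn_toLp] with x hx
        rw [hx, smul_eq_mul, mul_comm, SchwartzMap.fourier_coe]
    _ = ∫ x, 𝓕 f x * G x := (integral_fourier_mul_flip h1 G.integrable).symm
    _ = ∫ x, g x • 𝓕 f x := by
        congr 1; ext x; rw [hGv, Complex.real_smul, mul_comm]

/-- Plancherel's theorem on `L¹ ∩ L²`. -/
theorem eLpNorm_fourier_eq {f : ℝ → ℂ} (h1 : Integrable f) (h2 : MemLp f 2) :
    eLpNorm (𝓕 f) 2 volume = eLpNorm f 2 volume := by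
  rw [← eLpNorm_congr_ae (fourier_toLp_ae h1 h2), ← eLpNorm_congr_ae h2.coeFn_toLp]
  have := Lp.norm_fourier_eq (h2.toLp f)
  rw [Lp.norm_def, Lp.norm_def, ENNReal.toReal_eq_toReal_iff' (Lp.eLpNorm_ne_top _)
    (Lp.eLpNorm_ne_top _)] at this
  exact this

theorem memLp_fourier {f : ℝ → ℂ} (h1 : Integrable f) (h2 : MemLp f 2) : MemLp (𝓕 f) 2 := by
  have hcont : Continuous (𝓕 f) :=
    VectorFourier.fourierIntegral_continuous Real.continuous_fourierChar continuous_inner h1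
  exact ⟨hcont.aestronglyMeasurable, by rw [eLpNorm_fourier_eq h1 h2]; exact h2.2⟩

theorem memLp_fourierInv {f : ℝ → ℂ} (h1 : Integrable f) (h2 : MemLp f 2) : MemLp (𝓕⁻ f) 2 := by
  rw [Real.fourierInv_eq_fourier_comp_neg]
  exact memLp_fourier h1.comp_neg (h2.comp_measurePreserving (Measure.measurePreserving_neg volume))

theorem fourierInv_real_eq (c : ℝ → ℂ) (s : ℝ) :
    𝓕⁻ c s = ∫ t : ℝ, c t * Complex.exp (2 * Real.pi * Complex.I * t * s) := by
  rw [Real.fourierInv_eq']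
  congr 1
  ext t
  rw [smul_eq_mul, mul_comm]
  congr 2
  simp
  ring

/-- On the real line the two one-sided Fourier integrals add up to the Fourier integral. -/
theorem halfFourier_add_halfFourier {c : ℝ → ℂ} (hc : Integrable c) (s : ℝ) :
    halfFourier 1 c s + halfFourier (-1) c s = 𝓕⁻ c s := by
  have hi : Integrable (fun t : ℝ => c t * Complex.exp (2 * Real.pi * Complex.I * t * s)) := by
    refine hc.mono (hc.aestronglyMeasurable.mul (by fun_prop)) (ae_of_all _ fun t => ?_)
    rw [norm_mul]
    refine mul_le_of_le_one_right (norm_nonneg _) ?_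
    rw [Complex.norm_exp]
    simp
  have h := integral_comp_neg_Ioi (0 : ℝ)
    (fun t : ℝ => c t * Complex.exp (2 * Real.pi * Complex.I * t * s))
  rw [neg_zero] at h
  rw [fourierInv_real_eq, ← integral_add_compl (s := Ioi (0 : ℝ)) measurableSet_Ioi hi, compl_Ioi,
    ← h]
  simp [halfFourier]

theorem halfFourier_congr {ε : ℝ} {c d : ℝ → ℂ}
    (h : ∀ᵐ t : ℝ, 0 < t → c (ε * t) = d (ε * t)) (z : ℂ) :
    halfFourier ε c z = halfFourier ε d z := by
  refine setIntegral_congr_ae measurableSet_Ioi ?_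
  filter_upwards [h] with t ht ht'
  rw [ht ht']

/-! ### Functions with an `H¹` modulus of continuity and their Fourier transforms -/

open scoped ENNReal

/-- `u` is continuous, belongs to `L¹ ∩ L²`, and is Lipschitz under translations in the norm of
`L²`. For `u ∈ L¹ ∩ L²` the last condition says that `u ∈ H¹`; in this form it passes to products
with bounded Lipschitz functions. -/
structure IsL1H1 (u : ℝ → ℂ) : Prop where
  continuous : Continuous u
  integrable : Integrable u
  memLp : MemLp u 2
  translation : ∃ C : ℝ, 0 ≤ C ∧
    ∀ h : ℝ, eLpNorm (fun z => u (z + h) - u z) 2 volume ≤ ENNReal.ofReal (C * |h|)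

theorem norm_one_add_abs (t : ℝ) : ‖((1 + |t| : ℝ) : ℂ)‖ = 1 + |t| := by
  rw [Complex.norm_real, Real.norm_of_nonneg (by positivity)]

theorem one_add_abs_ne_zero (t : ℝ) : ((1 + |t| : ℝ) : ℂ) ≠ 0 := by
  exact_mod_cast (by positivity : (1 + |t| : ℝ) ≠ 0)

theorem memLp_inv_one_add_abs : MemLp (fun t : ℝ => ((1 + |t| : ℝ) : ℂ)⁻¹) 2 volume := by
  have hc : Continuous (fun t : ℝ => ((1 + |t| : ℝ) : ℂ)⁻¹) := by
    exact Continuous.inv₀ (by fun_prop) one_add_abs_ne_zero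
  rw [memLp_two_iff_integrable_sq_norm hc.aestronglyMeasurable]
  refine integrable_inv_one_add_sq.mono (by fun_prop) (ae_of_all _ fun t => ?_)
  rw [norm_inv, norm_one_add_abs, Real.norm_of_nonneg (by positivity),
    Real.norm_of_nonneg (by positivity), inv_pow]
  refine inv_anti₀ (by positivity) ?_
  nlinarith [abs_nonneg t, sq_abs t]

theorem integrable_of_memLp_weighted {c : ℝ → ℂ}
    (h : MemLp (fun t : ℝ => ((1 + |t| : ℝ) : ℂ) * c t) 2) : Integrable c := by
  have := memLp_inv_one_add_abs.integrable_mul h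
  refine this.congr (ae_of_all _ fun t => ?_)
  have h0 := one_add_abs_ne_zero t
  simp only [Pi.mul_apply]
  field_simp

theorem fourier_translate (u : ℝ → ℂ) (h ξ : ℝ) :
    𝓕 (fun z => u (z + h)) ξ = Complex.exp (2 * Real.pi * Complex.I * (h * ξ)) * 𝓕 u ξ := by
  have := congrFun (VectorFourier.fourierIntegral_comp_add_right Real.fourierChar volume
    (innerₗ ℝ) u h) ξ
  change 𝓕 (u ∘ fun v => v + h) ξ = _ • 𝓕 u ξ at this
  change 𝓕 (u ∘ fun v => v + h) ξ = _
  rw [this, Circle.smul_def, Real.fourierChar_apply, smul_eq_mul]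
  congr 2
  simp
  ring

theorem fourier_sub' {f g : ℝ → ℂ} (hf : Integrable f) (hg : Integrable g) (ξ : ℝ) :
    𝓕 (fun z => f z - g z) ξ = 𝓕 f ξ - 𝓕 g ξ := by
  simp only [Real.fourier_real_eq_integral_exp_smul, smul_sub]
  rw [integral_sub]
  · refine hf.mono (by fun_prop) (ae_of_all _ fun t => ?_)
    rw [norm_smul, Complex.norm_exp]
    simp
  · refine hg.mono (by fun_prop) (ae_of_all _ fun t => ?_)
    rw [norm_smul, Complex.norm_exp]
    simp

/-- The Fourier transform of an `H¹` function is square integrable with the weight `1 + |ξ|`: apply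
Plancherel's theorem to the difference quotients and use Fatou's lemma. -/
theorem IsL1H1.memLp_weighted {u : ℝ → ℂ} (hu : IsL1H1 u) :
    MemLp (fun ξ : ℝ => ((1 + |ξ| : ℝ) : ℂ) * 𝓕 u ξ) 2 := by
  obtain ⟨C, hC0, hC⟩ := hu.translation
  have hcont : Continuous (𝓕 u) :=
    VectorFourier.fourierIntegral_continuous Real.continuous_fourierChar continuous_inner
      hu.integrable
  have hmul : MemLp (fun ξ : ℝ => 2 * Real.pi * Complex.I * ξ * 𝓕 u ξ) 2 := by
    refine ⟨by fun_prop, ?_⟩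
    set d : ℕ → ℝ := fun n => 1 / ((n : ℝ) + 1) with hd
    have hdpos : ∀ n, 0 < d n := fun n => by positivity
    set f : ℕ → ℝ → ℂ := fun n ξ =>
      ((d n : ℝ) : ℂ)⁻¹ * (Complex.exp (2 * Real.pi * Complex.I * (d n * ξ)) - 1) * 𝓕 u ξ with hf
    have hlim : ∀ ξ, Tendsto (fun n => f n ξ) atTop
        (𝓝 (2 * Real.pi * Complex.I * ξ * 𝓕 u ξ)) := by
      intro ξ
      refine Tendsto.mul_const _ ?_
      have h1 : HasDerivAt (fun t : ℝ => Complex.exp (2 * Real.pi * Complex.I * (t * ξ)))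
          (2 * Real.pi * Complex.I * ξ) 0 := by
        have h2 : HasDerivAt (fun t : ℝ => 2 * Real.pi * Complex.I * ((t : ℂ) * ξ))
            (2 * Real.pi * Complex.I * ξ) 0 := by
          have := ((Complex.ofRealCLM.hasDerivAt (x := (0 : ℝ))).mul_const (ξ : ℂ)).const_mul
            (2 * Real.pi * Complex.I : ℂ)
          simpa using this
        simpa using h2.cexp
      have h3 := h1.tendsto_slope_zero
      have h4 : Tendsto d atTop (𝓝[≠] 0) :=
        tendsto_nhdsWithin_iff.2 ⟨tendsto_one_div_add_atTop_nhds_zero_nat,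
          Eventually.of_forall fun n => (hdpos n).ne'⟩
      refine (h3.comp h4).congr fun n => ?_
      simp [Complex.real_smul]
    have hbound : ∀ n, eLpNorm (f n) 2 volume ≤ ENNReal.ofReal C := by
      intro n
      have e : f n = ((d n : ℝ) : ℂ)⁻¹ • 𝓕 (fun z => u (z + d n) - u z) := by
        ext ξ
        rw [Pi.smul_apply, fourier_sub' (hu.integrable.comp_add_right _) hu.integrable,
          fourier_translate]
        simp only [hf, smul_eq_mul]
        ring
      have hm : MemLp (fun z => u (z + d n) - u z) 2 :=
        (hu.memLp.comp_measurePreserving (measurePreserving_add_right volume _)).sub hu.memLp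
      have hmi : Integrable (fun z => u (z + d n) - u z) :=
        (hu.integrable.comp_add_right _).sub hu.integrable
      rw [e, eLpNorm_const_smul, eLpNorm_fourier_eq hmi hm]
      refine (mul_le_mul_right (hC (d n)) _).trans ?_
      rw [← ofReal_norm, ← ENNReal.ofReal_mul (norm_nonneg _), norm_inv,
        Complex.norm_real, Real.norm_eq_abs]
      refine ENNReal.ofReal_le_ofReal (le_of_eq ?_)
      have := abs_pos.2 (hdpos n).ne'
      field_simp
    have := Lp.eLpNorm_lim_le_liminf_eLpNorm (p := 2) (μ := volume)
      (fun n => (by fun_prop : Continuous (f n)).aestronglyMeasurable) _ (ae_of_all _ hlim)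
    refine lt_of_le_of_lt this (lt_of_le_of_lt ?_ (ENNReal.ofReal_lt_top (r := C)))
    exact (liminf_le_liminf (Eventually.of_forall hbound)).trans (by simp)
  have hsum := (memLp_fourier hu.integrable hu.memLp).norm.add hmul.norm
  refine hsum.mono (by fun_prop) (ae_of_all _ fun ξ => ?_)
  have hn : ‖2 * Real.pi * Complex.I * ξ * 𝓕 u ξ‖ = 2 * Real.pi * |ξ| * ‖𝓕 u ξ‖ := by
    simp [abs_of_pos Real.pi_pos]
  rw [norm_mul, norm_one_add_abs, Pi.add_apply, hn, Real.norm_of_nonneg (by positivity)]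
  have := mul_nonneg (abs_nonneg ξ) (norm_nonneg (𝓕 u ξ))
  nlinarith [Real.pi_gt_three]

theorem IsL1H1.integrable_fourier {u : ℝ → ℂ} (hu : IsL1H1 u) : Integrable (𝓕 u) :=
  integrable_of_memLp_weighted hu.memLp_weighted

theorem IsL1H1.fourierInv_fourier {u : ℝ → ℂ} (hu : IsL1H1 u) (s : ℝ) : 𝓕⁻ (𝓕 u) s = u s :=
  congrFun (hu.continuous.fourierInv_fourier_eq hu.integrable hu.integrable_fourier) s

theorem IsL1H1.conj {u : ℝ → ℂ} (hu : IsL1H1 u) : IsL1H1 (fun z => star (u z)) := by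
  obtain ⟨C, hC0, hC⟩ := hu.translation
  refine ⟨hu.continuous.star, ?_, hu.memLp.star, C, hC0, fun h => le_trans (le_of_eq ?_) (hC h)⟩
  · exact hu.integrable.mono hu.continuous.star.aestronglyMeasurable (by simp)
  · refine eLpNorm_congr_norm_ae (ae_of_all _ fun z => ?_)
    rw [← star_sub, norm_star]

theorem IsL1H1.const_mul {u : ℝ → ℂ} (hu : IsL1H1 u) (a : ℂ) : IsL1H1 (fun s => a * u s) := by
  obtain ⟨C, hC0, hC⟩ := hu.translation
  refine ⟨continuous_const.mul hu.continuous, hu.integrable.const_mul a, hu.memLp.const_mul a,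
    ‖a‖ * C, by positivity, fun h => ?_⟩
  have e : (fun z => a * u (z + h) - a * u z) = a • fun z => u (z + h) - u z := by
    ext z
    simp [mul_sub]
  rw [e, eLpNorm_const_smul, mul_assoc, ENNReal.ofReal_mul (norm_nonneg a), ofReal_norm]
  exact mul_le_mul_right (hC h) _

theorem IsL1H1.mul_unimodular {u e : ℝ → ℂ} (hu : IsL1H1 u) (he : ∀ z, ‖e z‖ = 1) {A : ℝ}
    (hA : 0 ≤ A) (hLip : ∀ z w, ‖e z - e w‖ ≤ A * |z - w|) (hec : Continuous e) :
    IsL1H1 (fun z => u z * e z) := by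
  obtain ⟨C, hC0, hC⟩ := hu.translation
  have hcont : Continuous (fun z => u z * e z) := hu.continuous.mul hec
  set N := (eLpNorm u 2 volume).toReal
  have hN : eLpNorm u 2 volume = ENNReal.ofReal N := (ENNReal.ofReal_toReal hu.memLp.2.ne).symm
  have hN0 : 0 ≤ N := ENNReal.toReal_nonneg
  refine ⟨hcont, hu.integrable.mono hcont.aestronglyMeasurable (by simp [he]),
    hu.memLp.mono hcont.aestronglyMeasurable (by simp [he]), C + A * N, by positivity, fun h => ?_⟩
  have huc := hu.continuous
  have e1 : (fun z => u (z + h) * e (z + h) - u z * e z) =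
      (fun z => (u (z + h) - u z) * e (z + h)) + fun z => u z * (e (z + h) - e z) := by
    ext z
    simp only [Pi.add_apply]
    ring
  rw [e1]
  refine (eLpNorm_add_le (by fun_prop) (by fun_prop) (by norm_num)).trans ?_
  have h1 : eLpNorm (fun z => (u (z + h) - u z) * e (z + h)) 2 volume ≤
      ENNReal.ofReal (C * |h|) :=
    le_trans (eLpNorm_mono fun z => by simp [he]) (hC h)
  have h2 : eLpNorm (fun z => u z * (e (z + h) - e z)) 2 volume ≤
      ENNReal.ofReal (A * |h|) * eLpNorm u 2 volume := by
    refine eLpNorm_le_mul_eLpNorm_of_ae_le_mul (ae_of_all _ fun z => ?_) 2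
    rw [norm_mul, mul_comm]
    gcongr
    simpa using hLip (z + h) z
  refine (add_le_add h1 h2).trans (le_of_eq ?_)
  rw [hN, ← ENNReal.ofReal_mul (by positivity), ← ENNReal.ofReal_add (by positivity)
    (by positivity)]
  congr 1
  ring

/-- Minkowski's inequality for the primitive of a square integrable function. -/
theorem eLpNorm_interval_translate_le {g : ℝ → ℂ} (hg : MemLp g 2) (h : ℝ) :
    eLpNorm (fun z => ∫ s in z..z + h, g s) 2 volume ≤
      ENNReal.ofReal |h| * eLpNorm g 2 volume := by
  obtain ⟨g', hg'm, hgg'⟩ := hg.1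
  have e : (fun z => ∫ s in z..z + h, g s) = fun z => ∫ s in (0 : ℝ)..h, g' (z + s) := by
    ext z
    rw [intervalIntegral.integral_comp_add_left (fun s => g' s) z, add_zero]
    exact intervalIntegral.integral_congr_ae (hgg'.mono fun s hs _ => hs)
  rw [e, eLpNorm_congr_ae hgg']
  set μ : Measure ℝ := volume.restrict (uIoc 0 h) with hμ
  have hμu : μ univ = ENNReal.ofReal |h| := by
    simp [hμ, uIoc, max_sub_min_eq_abs]
  have hpt : ∀ z, ‖∫ s in (0 : ℝ)..h, g' (z + s)‖ₑ ^ (2 : ℝ) ≤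
      ENNReal.ofReal |h| * ∫⁻ s, ‖g' (z + s)‖ₑ ^ (2 : ℝ) ∂μ := by
    intro z
    have hm : AEStronglyMeasurable (fun s => g' (z + s)) μ :=
      (hg'm.comp_measurable (measurable_const_add z)).aestronglyMeasurable
    have h1 : ‖∫ s in (0 : ℝ)..h, g' (z + s)‖ₑ ≤ eLpNorm (fun s => g' (z + s)) 1 μ := by
      rw [eLpNorm_one_eq_lintegral_enorm, ← ofReal_norm,
        intervalIntegral.norm_intervalIntegral_eq, ofReal_norm]
      exact enorm_integral_le_lintegral_enorm _
    have h2 := eLpNorm_le_eLpNorm_mul_rpow_measure_univ (p := 1) (q := 2) (by norm_num) hm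
    calc ‖∫ s in (0 : ℝ)..h, g' (z + s)‖ₑ ^ (2 : ℝ)
        ≤ (eLpNorm (fun s => g' (z + s)) 2 μ * μ univ ^ (1 / (1 : ℝ) - 1 / 2)) ^ (2 : ℝ) := by
          gcongr
          simpa using h1.trans h2
      _ = _ := by
          rw [ENNReal.mul_rpow_of_nonneg _ _ (by norm_num), ← ENNReal.rpow_mul, hμu,
            eLpNorm_eq_lintegral_rpow_enorm_toReal (by norm_num) (by norm_num), ← ENNReal.rpow_mul]
          norm_num
          rw [mul_comm]
  rw [eLpNorm_eq_lintegral_rpow_enorm_toReal (by norm_num) (by norm_num),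
    eLpNorm_eq_lintegral_rpow_enorm_toReal (by norm_num) (by norm_num)]
  simp only [ENNReal.toReal_ofNat]
  have hmeas : Measurable (fun p : ℝ × ℝ => ‖g' (p.1 + p.2)‖ₑ ^ (2 : ℝ)) :=
    ((hg'm.comp_measurable (measurable_fst.add measurable_snd)).enorm).pow_const _
  have hint : ∫⁻ z, ‖∫ s in (0 : ℝ)..h, g' (z + s)‖ₑ ^ (2 : ℝ) ≤
      ENNReal.ofReal |h| ^ (2 : ℝ) * ∫⁻ z, ‖g' z‖ₑ ^ (2 : ℝ) := by
    calc _ ≤ ∫⁻ z, ENNReal.ofReal |h| * ∫⁻ s, ‖g' (z + s)‖ₑ ^ (2 : ℝ) ∂μ := lintegral_mono hpt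
      _ = ENNReal.ofReal |h| * ∫⁻ z, ∫⁻ s, ‖g' (z + s)‖ₑ ^ (2 : ℝ) ∂μ :=
          lintegral_const_mul _ hmeas.lintegral_prod_right'
      _ = ENNReal.ofReal |h| * ∫⁻ s, (∫⁻ z, ‖g' (z + s)‖ₑ ^ (2 : ℝ)) ∂μ := by
          rw [lintegral_lintegral_swap hmeas.aemeasurable]
      _ = ENNReal.ofReal |h| * ∫⁻ _, (∫⁻ z, ‖g' z‖ₑ ^ (2 : ℝ)) ∂μ := by
          congr 2
          ext s
          exact lintegral_add_right_eq_self (fun z => ‖g' z‖ₑ ^ (2 : ℝ)) s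
      _ = _ := by
          rw [lintegral_const, hμu, show (2 : ℝ) = 1 + 1 by norm_num,
            ENNReal.rpow_add_of_nonneg _ _ (by norm_num) (by norm_num), ENNReal.rpow_one]
          ring
  refine (ENNReal.rpow_le_rpow hint (by norm_num)).trans (le_of_eq ?_)
  rw [ENNReal.mul_rpow_of_nonneg _ _ (by norm_num), ← ENNReal.rpow_mul]
  norm_num

theorem integrable_of_memL21 {u : ℝ → ℂ} (hm : AEStronglyMeasurable u volume) (hu : MemL21 u) :
    Integrable u := by
  refine integrable_of_memLp_weighted ((hu.const_mul (2 : ℂ)).mono ?_ (ae_of_all _ fun z => ?_))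
  · exact (by fun_prop : Continuous fun t : ℝ => ((1 + |t| : ℝ) : ℂ)).aestronglyMeasurable.mul hm
  · rw [norm_mul, norm_mul, norm_mul, norm_one_add_abs, Complex.norm_ofNat, ← mul_assoc,
      Complex.norm_real, Real.norm_of_nonneg (Real.sqrt_nonneg _)]
    gcongr
    have h1 : |z| ≤ Real.sqrt (1 + z ^ 2) := Real.abs_le_sqrt (by linarith)
    have h2 : (1 : ℝ) ≤ Real.sqrt (1 + z ^ 2) := Real.one_le_sqrt.2 (by nlinarith)
    linarith

theorem isL1H1_of_memH1 {u : ℝ → ℂ} (hu : MemH1 u) (hi : Integrable u) : IsL1H1 u := by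
  obtain ⟨h2, g, hg, hprim⟩ := hu
  have hloc : ∀ a b : ℝ, IntervalIntegrable g volume a b := fun a b =>
    intervalIntegrable_iff.2 (((hg.locallyIntegrable (by norm_num)).integrableOn_isCompact
      isCompact_uIcc).mono_set uIoc_subset_uIcc)
  refine ⟨?_, hi, h2, (eLpNorm g 2 volume).toReal, ENNReal.toReal_nonneg, fun h => ?_⟩
  · have : u = fun z => u 0 + ∫ s in (0 : ℝ)..z, g s := by
      ext z
      rw [← hprim]
      ring
    rw [this]
    exact continuous_const.add (intervalIntegral.continuous_primitive hloc 0)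
  · simp only [hprim]
    refine (eLpNorm_interval_translate_le hg h).trans (le_of_eq ?_)
    rw [ENNReal.ofReal_mul ENNReal.toReal_nonneg, ENNReal.ofReal_toReal hg.2.ne, mul_comm]

/-! ### Hilbert–Schmidt operators and Hankel operators on the half line -/

open scoped InnerProductSpace

section HilbertSchmidt

variable {H E ι : Type*} [NormedAddCommGroup H] [InnerProductSpace ℂ H]
  [NormedAddCommGroup E] [NormedSpace ℂ E]

/-- The truncation `∑_{i ∈ F} ⟨b i, ·⟩ T (b i)` of an operator to finitely many basis vectors. -/
def truncation (b : ι → H) (T : H →L[ℂ] E) (F : Finset ι) : H →L[ℂ] E :=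
  ∑ i ∈ F, (ContinuousLinearMap.toSpanSingleton ℂ (T (b i))).comp (innerSL ℂ (b i))

theorem isCompactOperator_truncation (b : ι → H) (T : H →L[ℂ] E) (F : Finset ι) :
    IsCompactOperator (truncation b T F) := by
  classical
  induction F using Finset.induction_on with
  | empty =>
    simpa [truncation] using (isCompactOperator_zero : IsCompactOperator (0 : H → E))
  | insert i F hi ih =>
    have h1 : IsCompactOperator
        ((ContinuousLinearMap.toSpanSingleton ℂ (T (b i))).comp (innerSL ℂ (b i))) :=
      IsCompactOperator.comp_clm (isCompactOperator_of_locallyCompactSpace_rng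
        (ContinuousLinearMap.toSpanSingleton ℂ (T (b i)))) (innerSL ℂ (b i))
    have := h1.add ih
    rw [truncation, Finset.sum_insert hi]
    exact this

/-- Hilbert–Schmidt operators are compact: they are norm limits of their truncations. -/
theorem isCompactOperator_of_summable_sq [CompleteSpace E] (b : HilbertBasis ι ℂ H)
    (T : H →L[ℂ] E) (hT : Summable fun i => ‖T (b i)‖ ^ 2) : IsCompactOperator T := by
  classical
  refine isCompactOperator_of_tendsto (l := (atTop : Filter (Finset ι)))
    (F := fun F => truncation b T F) ?_
    (Eventually.of_forall fun F => isCompactOperator_truncation b T F)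
  rw [Metric.tendsto_nhds]
  intro η hη
  obtain ⟨F₀, hF₀⟩ := summable_iff_vanishing_norm.1 hT ((η / 2) ^ 2) (by positivity)
  filter_upwards [eventually_ge_atTop F₀] with F hF
  rw [dist_comm, dist_eq_norm]
  refine lt_of_le_of_lt ?_ (half_lt_self hη)
  refine ContinuousLinearMap.opNorm_le_bound _ (by positivity) fun x => ?_
  have hsum : HasSum (fun i => ⟪b i, x⟫_ℂ • T (b i)) (T x) := by
    have := (b.hasSum_repr x).mapL T
    simpa [b.repr_apply_apply] using this
  have htr : truncation b T F x = ∑ i ∈ F, ⟪b i, x⟫_ℂ • T (b i) := by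
    simp [truncation]
  have hlim : Tendsto (fun G : Finset ι => ‖∑ i ∈ G, ⟪b i, x⟫_ℂ • T (b i) - truncation b T F x‖)
      atTop (𝓝 ‖T x - truncation b T F x‖) := (hsum.sub_const _).norm
  rw [sub_apply]
  refine le_of_tendsto hlim ?_
  filter_upwards [eventually_ge_atTop F] with G hG
  rw [htr, ← Finset.sum_sdiff hG, add_sub_cancel_right]
  have h1 : ‖∑ i ∈ G \ F, ⟪b i, x⟫_ℂ • T (b i)‖ ≤
      ∑ i ∈ G \ F, ‖⟪b i, x⟫_ℂ‖ * ‖T (b i)‖ :=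
    (norm_sum_le _ _).trans (le_of_eq (Finset.sum_congr rfl fun i _ => norm_smul _ _))
  have h2 : (∑ i ∈ G \ F, ‖⟪b i, x⟫_ℂ‖ * ‖T (b i)‖) ^ 2 ≤ ‖x‖ ^ 2 * (η / 2) ^ 2 := by
    refine (Finset.sum_mul_sq_le_sq_mul_sq _ _ _).trans ?_
    have h3 := b.orthonormal.sum_inner_products_le x (s := G \ F)
    have h4 := hF₀ (G \ F) (Finset.disjoint_of_subset_right hF Finset.sdiff_disjoint)
    rw [Real.norm_of_nonneg (by positivity)] at h4
    gcongr
  refine h1.trans (abs_le_of_sq_le_sq' ?_ (by positivity)).2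
  rw [mul_pow]
  linarith

end HilbertSchmidt

/-- An integral operator with square integrable kernel exists on `L²` and is compact. -/
theorem exists_isCompactOperator_of_kernel {α : Type*} [MeasurableSpace α] {μ : Measure α}
    [SFinite μ] {k : α → α → ℂ} (hk : MemLp (Function.uncurry k) 2 (μ.prod μ)) :
    ∃ T : Lp ℂ 2 μ →L[ℂ] Lp ℂ 2 μ, IsCompactOperator T ∧
      ∀ f : Lp ℂ 2 μ, T f =ᵐ[μ] fun s => ∫ t, k s t * f t ∂μ := by
  have hk2 : Integrable (fun p => ‖Function.uncurry k p‖ ^ 2) (μ.prod μ) :=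
    (memLp_two_iff_integrable_sq_norm hk.1).1 hk
  have hrow : ∀ᵐ s ∂μ, MemLp (k s) 2 μ := by
    filter_upwards [hk2.prod_right_ae, hk.1.prodMk_left] with s h1 h2
    exact (memLp_two_iff_integrable_sq_norm h2).2 h1
  set N : α → ℝ := fun s => ∫ t, ‖k s t‖ ^ 2 ∂μ with hN
  have hNint : Integrable N μ := hk2.integral_prod_left
  have hN0 : ∀ s, 0 ≤ N s := fun s => integral_nonneg fun t => by positivity
  have hmeas : ∀ f : Lp ℂ 2 μ, AEStronglyMeasurable (fun s => ∫ t, k s t * f t ∂μ) μ := by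
    intro f
    exact (hk.1.mul (Lp.aestronglyMeasurable f).comp_snd).integral_prod_right'
  -- The action on `f` is, for almost every row, an inner product in `L²`.
  have hinner : ∀ᵐ s ∂μ, ∃ K : Lp ℂ 2 μ, ‖K‖ ^ 2 = N s ∧
      ∀ f : Lp ℂ 2 μ, ∫ t, k s t * f t ∂μ = ⟪K, f⟫_ℂ := by
    filter_upwards [hrow] with s hs
    refine ⟨hs.star.toLp _, ?_, fun f => ?_⟩
    · rw [← inner_self_eq_norm_sq (𝕜 := ℂ), L2.inner_def, ← integral_re (L2.integrable_inner _ _)]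
      refine integral_congr_ae ?_
      filter_upwards [hs.star.coeFn_toLp] with t ht
      rw [inner_self_eq_norm_sq, ht]
      simp
    · rw [L2.inner_def]
      refine integral_congr_ae ?_
      filter_upwards [hs.star.coeFn_toLp] with t ht
      rw [ht]
      simp [mul_comm]
  have hsq : ∀ f : Lp ℂ 2 μ, ∀ᵐ s ∂μ, ‖∫ t, k s t * f t ∂μ‖ ^ 2 ≤ N s * ‖f‖ ^ 2 := by
    intro f
    filter_upwards [hinner] with s hs
    obtain ⟨K, hK, hKf⟩ := hs
    rw [hKf, ← hK, ← mul_pow]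
    exact pow_le_pow_left₀ (norm_nonneg _) (norm_inner_le_norm _ _) 2
  have hL2 : ∀ f : Lp ℂ 2 μ, MemLp (fun s => ∫ t, k s t * f t ∂μ) 2 μ := by
    intro f
    rw [memLp_two_iff_integrable_sq_norm (hmeas f)]
    refine (hNint.mul_const (‖f‖ ^ 2)).mono ((hmeas f).norm.pow 2) ?_
    filter_upwards [hsq f] with s hs
    rw [Real.norm_of_nonneg (by positivity),
      Real.norm_of_nonneg (mul_nonneg (hN0 s) (by positivity))]
    exact hs
  have hnormsq : ∀ f : Lp ℂ 2 μ, ‖(hL2 f).toLp _‖ ^ 2 =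
      ∫ s, ‖∫ t, k s t * f t ∂μ‖ ^ 2 ∂μ := by
    intro f
    rw [← inner_self_eq_norm_sq (𝕜 := ℂ), L2.inner_def, ← integral_re (L2.integrable_inner _ _)]
    refine integral_congr_ae ?_
    filter_upwards [(hL2 f).coeFn_toLp] with t ht
    rw [inner_self_eq_norm_sq, ht]
  let T₀ : Lp ℂ 2 μ →ₗ[ℂ] Lp ℂ 2 μ :=
    { toFun := fun f => (hL2 f).toLp _
      map_add' := by
        intro f g
        rw [← MemLp.toLp_add]
        refine MemLp.toLp_congr _ _ ?_
        filter_upwards [hinner] with s hs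
        obtain ⟨K, -, hK⟩ := hs
        rw [Pi.add_apply, hK, hK, hK, inner_add_right]
      map_smul' := by
        intro c f
        rw [RingHom.id_apply, ← MemLp.toLp_const_smul]
        refine MemLp.toLp_congr _ _ ?_
        filter_upwards [hinner] with s hs
        obtain ⟨K, -, hK⟩ := hs
        rw [Pi.smul_apply, hK, hK, inner_smul_right, smul_eq_mul] }
  have hbound : ∀ f, ‖T₀ f‖ ≤ Real.sqrt (∫ s, N s ∂μ) * ‖f‖ := by
    intro f
    refine le_of_sq_le_sq ?_ (by positivity)
    rw [mul_pow, Real.sq_sqrt (integral_nonneg hN0), ← integral_mul_const]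
    change ‖(hL2 f).toLp _‖ ^ 2 ≤ _
    rw [hnormsq]
    exact integral_mono_ae ((memLp_two_iff_integrable_sq_norm (hmeas f)).1 (hL2 f))
      (hNint.mul_const _) (hsq f)
  refine ⟨T₀.mkContinuous _ hbound, ?_, fun f => (hL2 f).coeFn_toLp⟩
  obtain ⟨w, b, -⟩ := exists_hilbertBasis ℂ (Lp ℂ 2 μ)
  refine isCompactOperator_of_summable_sq b _ ?_
  -- Bessel's inequality in each row bounds the Hilbert–Schmidt norm by the norm of the kernel.
  refine summable_of_sum_le (c := ∫ s, N s ∂μ) (fun i => by positivity) fun F => ?_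
  have h1 : ∀ i, ‖(T₀.mkContinuous _ hbound) (b i)‖ ^ 2 =
      ∫ s, ‖∫ t, k s t * b i t ∂μ‖ ^ 2 ∂μ := fun i => hnormsq (b i)
  simp only [h1]
  rw [← integral_finsetSum _ fun i _ =>
    (memLp_two_iff_integrable_sq_norm (hmeas (b i))).1 (hL2 (b i))]
  refine integral_mono_ae (integrable_finsetSum _ fun i _ =>
    (memLp_two_iff_integrable_sq_norm (hmeas (b i))).1 (hL2 (b i))) hNint ?_
  filter_upwards [hinner] with s hs
  obtain ⟨K, hK, hKf⟩ := hs
  simp only [hKf]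
  rw [← hK]
  have := b.orthonormal.sum_inner_products_le K (s := F)
  simpa only [norm_inner_symm] using this

/-- Lebesgue measure on the half line `(0, ∞)`. -/
abbrev halfLine : Measure ℝ := volume.restrict (Ioi 0)

theorem measurePreserving_sign_mul {ε : ℝ} (hε : ε = 1 ∨ ε = -1) :
    MeasurePreserving (fun x : ℝ => ε * x) volume volume := by
  rcases hε with rfl | rfl
  · simp only [one_mul]
    exact MeasurePreserving.id _
  · simp only [neg_mul, one_mul]
    exact Measure.measurePreserving_neg _

/-- The kernel `(1 + s) α(ε(s + t)) / (1 + t)` of a Hankel operator, conjugated with a weight. It is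
square integrable on `(0, ∞)²`, because `1 + s ≤ 1 + (s + t)` there and `(1 + t)⁻¹ ∈ L²`. -/
theorem memLp_hankel_kernel {ε : ℝ} (hε : ε = 1 ∨ ε = -1) {α : ℝ → ℂ} (hα : Continuous α)
    (hw : MemLp (fun t : ℝ => ((1 + |t| : ℝ) : ℂ) * α t) 2) :
    MemLp (Function.uncurry fun s t : ℝ =>
      ((1 + |s| : ℝ) : ℂ) * α (ε * (s + t)) * ((1 + |t| : ℝ) : ℂ)⁻¹) 2
      (halfLine.prod halfLine) := by
  have hε1 : |ε| = 1 := by rcases hε with rfl | rfl <;> simp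
  have hε0 : ε ≠ 0 := by rcases hε with rfl | rfl <;> norm_num
  set w : ℝ → ℂ := fun t => ((1 + |t| : ℝ) : ℂ) * α t with hwdef
  have hwc : Continuous w := by fun_prop
  have hm0 : Continuous (fun t : ℝ => ((1 + |t| : ℝ) : ℂ)⁻¹) :=
    Continuous.inv₀ (by fun_prop) one_add_abs_ne_zero
  have hm := memLp_inv_one_add_abs
  have hkc : Continuous (Function.uncurry fun s t : ℝ =>
      ((1 + |s| : ℝ) : ℂ) * α (ε * (s + t)) * ((1 + |t| : ℝ) : ℂ)⁻¹) := by
    have h1 : Continuous (fun p : ℝ × ℝ => ((1 + |p.2| : ℝ) : ℂ)⁻¹) := hm0.comp continuous_snd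
    change Continuous (fun p : ℝ × ℝ =>
      ((1 + |p.1| : ℝ) : ℂ) * α (ε * (p.1 + p.2)) * ((1 + |p.2| : ℝ) : ℂ)⁻¹)
    fun_prop
  have hprod : Integrable (fun p : ℝ × ℝ => ‖w p.1‖ ^ 2 * ‖((1 + |p.2| : ℝ) : ℂ)⁻¹‖ ^ 2)
      (volume.prod volume) :=
    Integrable.mul_prod ((memLp_two_iff_integrable_sq_norm hw.1).1 hw)
      ((memLp_two_iff_integrable_sq_norm hm.1).1 hm)
  -- `(s, t) ↦ (ε(s + t), t)` preserves Lebesgue measure of the plane.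
  have hshear : MeasurePreserving (fun p : ℝ × ℝ => (ε * (p.1 + p.2), p.2))
      ((volume : Measure ℝ).prod volume) (volume.prod volume) := by
    have h1 : MeasurePreserving (fun p : ℝ × ℝ => (p.1 + p.2, p.2))
        ((volume : Measure ℝ).prod volume) (volume.prod volume) := by
      have := (measurePreserving_add_prod (volume : Measure ℝ) volume)
      exact this
    exact ((measurePreserving_sign_mul hε).prod (MeasurePreserving.id _)).comp h1
  have hdom := hshear.integrable_comp_of_integrable hprod
  have hdom' : Integrable (fun p : ℝ × ℝ =>
      ‖w (ε * (p.1 + p.2))‖ ^ 2 * ‖((1 + |p.2| : ℝ) : ℂ)⁻¹‖ ^ 2) (halfLine.prod halfLine) := by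
    rw [Measure.prod_restrict]
    exact hdom.integrableOn
  rw [memLp_two_iff_integrable_sq_norm hkc.aestronglyMeasurable]
  refine hdom'.mono (hkc.norm.pow 2).aestronglyMeasurable ?_
  rw [Measure.prod_restrict]
  filter_upwards [ae_restrict_mem (measurableSet_Ioi.prod measurableSet_Ioi)] with p hp
  have hs : 0 < p.1 := hp.1
  have ht : 0 < p.2 := hp.2
  rw [Real.norm_of_nonneg (by positivity), Real.norm_of_nonneg (by positivity), ← mul_pow]
  refine pow_le_pow_left₀ (norm_nonneg _) ?_ 2
  change ‖((1 + |p.1| : ℝ) : ℂ) * α (ε * (p.1 + p.2)) * ((1 + |p.2| : ℝ) : ℂ)⁻¹‖ ≤ _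
  rw [norm_mul, norm_mul, hwdef, norm_mul, norm_one_add_abs, norm_one_add_abs, abs_mul, hε1,
    one_mul, abs_of_pos hs, abs_of_pos (by linarith : 0 < p.1 + p.2)]
  gcongr
  linarith

/-- Hankel operators with kernel in the weighted space, conjugated with the weight, are compact on
`L²(0, ∞)`. -/
theorem exists_isCompactOperator_hankel {ε : ℝ} (hε : ε = 1 ∨ ε = -1) {α : ℝ → ℂ}
    (hα : Continuous α) (hw : MemLp (fun t : ℝ => ((1 + |t| : ℝ) : ℂ) * α t) 2) :
    ∃ T : Lp ℂ 2 halfLine →L[ℂ] Lp ℂ 2 halfLine, IsCompactOperator T ∧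
      ∀ P : Lp ℂ 2 halfLine, T P =ᵐ[halfLine] fun s => ((1 + |s| : ℝ) : ℂ) *
        ∫ t in Ioi (0 : ℝ), α (ε * (s + t)) * (((1 + |t| : ℝ) : ℂ)⁻¹ * P t) := by
  obtain ⟨T, hT, hTf⟩ := exists_isCompactOperator_of_kernel (memLp_hankel_kernel hε hα hw)
  refine ⟨T, hT, fun P => (hTf P).trans (ae_of_all _ fun s => ?_)⟩
  simp only [← integral_const_mul]
  refine integral_congr_ae (ae_of_all _ fun t => ?_)
  ring

/-- The extension by zero of `t ↦ P(t) / (1 + t)`, reflected if `ε = -1`, so that it lives on the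
half line where `0 < ε t`. -/
def unweight (ε : ℝ) (P : Lp ℂ 2 halfLine) (t : ℝ) : ℂ :=
  (Ioi 0).indicator (fun τ => ((1 + |τ| : ℝ) : ℂ)⁻¹ * P τ) (ε * t)

theorem unweight_of_pos {ε : ℝ} (hε : ε = 1 ∨ ε = -1) (P : Lp ℂ 2 halfLine) {t : ℝ} (ht : 0 < t) :
    unweight ε P (ε * t) = ((1 + |t| : ℝ) : ℂ)⁻¹ * P t := by
  have h : ε * (ε * t) = t := by rcases hε with rfl | rfl <;> ring
  rw [unweight, h, indicator_of_mem (show t ∈ Ioi 0 from ht)]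

theorem unweight_of_neg {ε : ℝ} (P : Lp ℂ 2 halfLine) {t : ℝ} (ht : ε * t ≤ 0) :
    unweight ε P t = 0 :=
  indicator_of_notMem (by simpa using ht) _

theorem integrable_unweight {ε : ℝ} (hε : ε = 1 ∨ ε = -1) (P : Lp ℂ 2 halfLine) :
    Integrable (unweight ε P) := by
  have hε0 : ε ≠ 0 := by rcases hε with rfl | rfl <;> norm_num
  have h1 : IntegrableOn (fun τ : ℝ => ((1 + |τ| : ℝ) : ℂ)⁻¹ * P τ) (Ioi 0) :=
    (memLp_inv_one_add_abs.restrict (Ioi 0)).integrable_mul (Lp.memLp P)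
  exact ((integrable_indicator_iff measurableSet_Ioi).2 h1).comp_mul_left' hε0

theorem memLp_unweight {ε : ℝ} (hε : ε = 1 ∨ ε = -1) (P : Lp ℂ 2 halfLine) :
    MemLp (unweight ε P) 2 := by
  have hm0 : Continuous (fun t : ℝ => ((1 + |t| : ℝ) : ℂ)⁻¹) :=
    Continuous.inv₀ (by fun_prop) one_add_abs_ne_zero
  have h1 : MemLp (fun τ : ℝ => ((1 + |τ| : ℝ) : ℂ)⁻¹ * P τ) 2 halfLine := by
    refine (Lp.memLp P).mono (hm0.aestronglyMeasurable.mul (Lp.aestronglyMeasurable P))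
      (ae_of_all _ fun t => ?_)
    rw [norm_mul, norm_inv, norm_one_add_abs]
    exact mul_le_of_le_one_left (norm_nonneg _) (inv_le_one_of_one_le₀ (by linarith [abs_nonneg t]))
  have h2 := (memLp_indicator_iff_restrict (μ := volume) measurableSet_Ioi).2 h1
  exact h2.comp_measurePreserving (measurePreserving_sign_mul hε)

/-! ### The vanishing lemma -/

/-- `f` is holomorphic in an open half plane, continuous up to the real line, and tends to `0` at
infinity. -/
structure IsSectionalZero (ε : ℝ) (f : ℂ → ℂ) : Prop where
  analytic : DifferentiableOn ℂ f (halfPlane ε)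
  continuous : ContinuousOn f (closedHalfPlane ε)
  vanishing : Tendsto f (atInf ε) (𝓝 0)

theorem isSectionalZero_halfFourier {ε : ℝ} (hε : ε = 1 ∨ ε = -1) {c : ℝ → ℂ}
    (hc : Integrable c) : IsSectionalZero ε (halfFourier ε c) :=
  ⟨differentiableOn_halfFourier (integrableOn_comp_mul hε hc),
    continuousOn_halfFourier (integrableOn_comp_mul hε hc), tendsto_halfFourier hε hc⟩

theorem IsSectionalZero.neg {ε : ℝ} {f : ℂ → ℂ} (hf : IsSectionalZero ε f) :
    IsSectionalZero ε (fun z => -f z) :=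
  ⟨hf.analytic.neg, hf.continuous.neg, by simpa using hf.vanishing.neg⟩

theorem IsSectionalZero.mul {ε : ℝ} {f g : ℂ → ℂ} (hf : IsSectionalZero ε f)
    (hg : IsSectionalZero ε g) : IsSectionalZero ε (fun z => f z * g z) :=
  ⟨hf.analytic.mul hg.analytic, hf.continuous.mul hg.continuous, by
    simpa using hf.vanishing.mul hg.vanishing⟩

theorem tendsto_conj_cocompact :
    Tendsto (starRingEnd ℂ) (cocompact ℂ) (cocompact ℂ) := by
  have := Complex.conjCLE.toHomeomorph.isClosedEmbedding.tendsto_cocompact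
  exact this

theorem tendsto_conj_atInf {ε : ℝ} : Tendsto (starRingEnd ℂ) (atInf ε) (atInf (-ε)) := by
  refine tendsto_inf.2 ⟨tendsto_conj_cocompact.mono_left inf_le_left, tendsto_principal.2 ?_⟩
  filter_upwards [mem_inf_of_right (mem_principal_self _)] with z hz
    using conj_mem_closedHalfPlane.2 hz

theorem IsSectionalZero.conj {ε : ℝ} {f : ℂ → ℂ} (hf : IsSectionalZero (-ε) f) :
    IsSectionalZero ε (fun z => (starRingEnd ℂ) (f ((starRingEnd ℂ) z))) := by
  refine ⟨differentiableOn_conj_conj hf.analytic, ?_, ?_⟩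
  · refine Complex.continuous_conj.comp_continuousOn ?_
    exact hf.continuous.comp Complex.continuous_conj.continuousOn
      fun z hz => conj_mem_closedHalfPlane.2 hz
  · have := (Complex.continuous_conj.tendsto 0).comp (hf.vanishing.comp tendsto_conj_atInf)
    simpa [Function.comp_def] using this

theorem neg_mem_closedHalfPlane {ε : ℝ} {z : ℂ} :
    -z ∈ closedHalfPlane (-ε) ↔ z ∈ closedHalfPlane ε := by
  simp [closedHalfPlane]

theorem neg_mem_halfPlane {ε : ℝ} {z : ℂ} : -z ∈ halfPlane (-ε) ↔ z ∈ halfPlane ε := by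
  simp [halfPlane]

theorem IsSectionalZero.comp_neg {ε : ℝ} {f : ℂ → ℂ} (hf : IsSectionalZero (-ε) f) :
    IsSectionalZero ε (fun z => f (-z)) := by
  refine ⟨hf.analytic.comp (by fun_prop) fun z hz => neg_mem_halfPlane.2 hz,
    hf.continuous.comp (by fun_prop) fun z hz => neg_mem_closedHalfPlane.2 hz, ?_⟩
  refine hf.vanishing.comp (tendsto_inf.2 ⟨?_, tendsto_principal.2 ?_⟩)
  · exact ((Homeomorph.neg ℂ).isClosedEmbedding.tendsto_cocompact).mono_left inf_le_left
  · filter_upwards [mem_inf_of_right (mem_principal_self _)] with z hz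
      using neg_mem_closedHalfPlane.2 hz

theorem IsSectionalZero.div_tendsto {ε : ℝ} {f : ℂ → ℂ} (hf : IsSectionalZero ε f) :
    Tendsto (fun z => f z / z) (atInf ε) (𝓝 0) := by
  simpa [div_eq_mul_inv] using hf.vanishing.mul (tendsto_inv_atInf ε)

theorem tendsto_ofReal_atInf (ε : ℝ) : Tendsto (fun s : ℝ => (s : ℂ)) atTop (atInf ε) := by
  refine tendsto_inf.2 ⟨?_, tendsto_principal.2
    (Eventually.of_forall fun s => ofReal_mem_closedHalfPlane ε s)⟩
  exact (Complex.isometry_ofReal.isClosedEmbedding.tendsto_cocompact).mono_left atTop_le_cocompact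

theorem isPreconnected_halfPlane (ε : ℝ) : IsPreconnected (halfPlane ε) := by
  refine Convex.isPreconnected ?_
  have : halfPlane ε = (fun z : ℂ => ε * z.im) ⁻¹' Ioi 0 := rfl
  rw [this]
  refine (convex_Ioi (0 : ℝ)).is_linear_preimage ?_
  exact ⟨fun x y => by simp [mul_add], fun c x => by simp; ring⟩

theorem ofReal_mem_closure_halfPlane_one (s : ℝ) : (s : ℂ) ∈ closure (halfPlane 1) := by
  refine mem_closure_of_tendsto (f := fun t : ℝ => (s : ℂ) + t * Complex.I) (b := 𝓝[>] 0) ?_ ?_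
  · have : Continuous fun t : ℝ => (s : ℂ) + t * Complex.I := by fun_prop
    simpa using (this.tendsto 0).mono_left nhdsWithin_le_nhds
  · filter_upwards [self_mem_nhdsWithin] with t ht
    simpa [halfPlane] using ht

/-- A function of the upper half plane which vanishes on the positive half line vanishes. The
product `f(z) · conj f(-conj z)` vanishes on the whole real line, hence identically. -/
theorem eq_zero_of_eq_zero_on_pos {f : ℂ → ℂ} (hf : IsSectionalZero 1 f)
    (h0 : ∀ s : ℝ, 0 < s → f s = 0) (s : ℝ) : f s = 0 := by
  set g : ℂ → ℂ := fun z => (starRingEnd ℂ) (f (-(starRingEnd ℂ) z)) with hg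
  have hgs : IsSectionalZero 1 g := by
    have h1 : IsSectionalZero (-1) (fun z => f (-z)) :=
      IsSectionalZero.comp_neg (by simpa using hf)
    exact IsSectionalZero.conj h1
  have hfg := hf.mul hgs
  have hpos : ∀ s : ℝ, s ≠ 0 → f s * g s = 0 := by
    intro s hs
    rcases lt_or_gt_of_ne hs with h | h
    · have := h0 (-s) (by linarith)
      simp [hg, ← Complex.ofReal_neg, this]
    · simp [h0 s h]
  have hreal : ∀ s : ℝ, f s * g s = 0 := by
    have hc : Continuous (fun s : ℝ => f s * g s) :=
      hfg.continuous.comp_continuous Complex.continuous_ofReal (ofReal_mem_closedHalfPlane 1)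
    have : EqOn (fun s : ℝ => f s * g s) 0 (closure {0}ᶜ) := by
      refine Set.EqOn.closure (fun s hs => hpos s hs) hc continuous_const
    rw [(dense_compl_singleton (0 : ℝ)).closure_eq] at this
    exact fun s => this (mem_univ s)
  have hall := (glue_const hfg.analytic hfg.continuous
    (fm := fun _ => 0) (differentiableOn_const _) continuousOn_const hreal hfg.div_tendsto
    (by simpa using tendsto_const_nhds)).1
  have hzero : ∀ z ∈ halfPlane 1, f z * g z = 0 := fun z hz => by
    rw [hall z (halfPlane_subset_closedHalfPlane _ hz)]
    simpa using hreal 0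
  have hfz : ∀ z ∈ halfPlane 1, f z = 0 := by
    by_contra! hne
    obtain ⟨z₀, hz₀, hfz₀⟩ := hne
    have hnhds := (isOpen_halfPlane 1).mem_nhds hz₀
    have hev : ∀ᶠ z in 𝓝 z₀, g z = 0 := by
      have h1 := (hf.analytic.differentiableAt hnhds).continuousAt.eventually_ne hfz₀
      filter_upwards [h1, hnhds] with z hz hz'
      exact (mul_eq_zero.1 (hzero z hz')).resolve_left hz
    have hg0 : EqOn g 0 (halfPlane 1) :=
      AnalyticOnNhd.eqOn_zero_of_preconnected_of_eventuallyEq_zero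
        (hgs.analytic.analyticOnNhd (isOpen_halfPlane 1)) (isPreconnected_halfPlane 1) hz₀ hev
    have hz1 : -(starRingEnd ℂ) z₀ ∈ halfPlane 1 := by
      simpa [halfPlane] using hz₀
    have := hg0 hz1
    simp only [hg, map_neg, Complex.conj_conj, neg_neg, Pi.zero_apply, map_eq_zero] at this
    exact hfz₀ this
  have hcl : closure (halfPlane 1) ⊆ closedHalfPlane 1 :=
    (isClosed_closedHalfPlane 1).closure_subset_iff.2 (halfPlane_subset_closedHalfPlane 1)
  have : EqOn f 0 (closure (halfPlane 1)) :=
    Set.EqOn.of_subset_closure (fun z hz => hfz z hz) (hf.continuous.mono hcl) continuousOn_const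
      subset_closure le_rfl
  exact this (ofReal_mem_closure_halfPlane_one s)

/-- The homogeneous Riemann–Hilbert problem, written for one row `(n₁, n₂)`. If `v = 4 z ū` then
`n₁₊(z) conj n₁₋(z̄) + 4 z n₂₊(z) conj n₂₋(z̄)` equals `|n₁₋|² + 4 z |n₂₊|²` on the real line, so it
reflects to an entire function of growth `o(|z|)`, a constant. Square integrability makes the
constant zero, and then `n₂₊` vanishes on the positive half line. -/
theorem vanishing {u v : ℝ → ℂ} (huv : ∀ s : ℝ, v s = 4 * s * star (u s)) {a₁ a₂ b₁ b₂ : ℂ → ℂ}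
    (ha₁ : IsSectionalZero 1 a₁) (ha₂ : IsSectionalZero 1 a₂) (hb₁ : IsSectionalZero (-1) b₁)
    (hb₂ : IsSectionalZero (-1) b₂) (h₁ : ∀ s : ℝ, a₁ s - b₁ s = v s * a₂ s)
    (h₂ : ∀ s : ℝ, a₂ s - b₂ s = u s * b₁ s) (hL2 : MemLp (fun s : ℝ => a₂ s) 2) (s : ℝ) :
    a₂ s = 0 := by
  set F : ℂ → ℂ := fun z => a₁ z * (starRingEnd ℂ) (b₁ ((starRingEnd ℂ) z)) with hF
  set E : ℂ → ℂ := fun z => a₂ z * (starRingEnd ℂ) (b₂ ((starRingEnd ℂ) z)) with hE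
  have hFs : IsSectionalZero 1 F := ha₁.mul hb₁.conj
  have hEs : IsSectionalZero 1 E := ha₂.mul hb₂.conj
  set G : ℂ → ℂ := fun z => F z + 4 * z * E z with hG
  have hGr : ∀ s : ℝ, G s = ((‖b₁ s‖ ^ 2 + 4 * s * ‖a₂ s‖ ^ 2 : ℝ) : ℂ) := by
    intro s
    have e1 : a₁ s = b₁ s + v s * a₂ s := by rw [← h₁]; ring
    have e2 : b₂ s = a₂ s - u s * b₁ s := by rw [← h₂]; ring
    have e3 : b₁ s * (starRingEnd ℂ) (b₁ s) = ((‖b₁ s‖ ^ 2 : ℝ) : ℂ) := by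
      rw [Complex.mul_conj, Complex.normSq_eq_norm_sq]
    have e4 : a₂ s * (starRingEnd ℂ) (a₂ s) = ((‖a₂ s‖ ^ 2 : ℝ) : ℂ) := by
      rw [Complex.mul_conj, Complex.normSq_eq_norm_sq]
    have e5 : v s = 4 * s * (starRingEnd ℂ) (u s) := huv s
    rw [Complex.ofReal_add, Complex.ofReal_mul, ← e3, ← e4]
    simp only [hG, hF, hE, Complex.conj_ofReal]
    rw [e1, e2, e5, map_sub, map_mul]
    push_cast
    ring
  have hGd : DifferentiableOn ℂ G (halfPlane 1) :=
    hFs.analytic.add ((by fun_prop : Differentiable ℂ fun z : ℂ => 4 * z).differentiableOn.mul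
      hEs.analytic)
  have hGc : ContinuousOn G (closedHalfPlane 1) :=
    hFs.continuous.add ((by fun_prop : Continuous fun z : ℂ => 4 * z).continuousOn.mul
      hEs.continuous)
  have hGt : Tendsto (fun z => G z / z) (atInf 1) (𝓝 0) := by
    have h := hFs.div_tendsto.add (hEs.vanishing.const_mul 4)
    rw [mul_zero, add_zero] at h
    refine h.congr' ?_
    filter_upwards [eventually_ne_zero_atInf 1] with z hz
    simp only [hG]
    field_simp
  have hconst := (glue_const (fm := fun z => (starRingEnd ℂ) (G ((starRingEnd ℂ) z))) hGd hGc
    (differentiableOn_conj_conj (by simpa using hGd))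
    (Complex.continuous_conj.comp_continuousOn (hGc.comp Complex.continuous_conj.continuousOn
      fun z hz => by simpa using conj_mem_closedHalfPlane.2 hz))
    (fun s => by simp only [Complex.conj_ofReal, hGr]) hGt (by
      have h1 : Tendsto (starRingEnd ℂ) (atInf (-1)) (atInf 1) := by
        simpa using tendsto_conj_atInf (ε := -1)
      have := (Complex.continuous_conj.tendsto 0).comp (hGt.comp h1)
      simpa [Function.comp_def] using this)).1
  set d : ℝ := ‖b₁ 0‖ ^ 2 with hd
  have hd0 : 0 ≤ d := by positivity
  have hident : ∀ s : ℝ, ‖b₁ s‖ ^ 2 + 4 * s * ‖a₂ s‖ ^ 2 = d := by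
    intro s
    have h1 := hconst s (ofReal_mem_closedHalfPlane 1 s)
    have h2 := hGr 0
    rw [Complex.ofReal_zero] at h2
    rw [hGr, h2] at h1
    have h3 := Complex.ofReal_injective h1
    simpa using h3
  -- A positive constant would force `|a₂(s)|² ~ d / (4 s)` at infinity.
  have hdz : d = 0 := by
    by_contra hne
    have hdpos : 0 < d := lt_of_le_of_ne hd0 (Ne.symm hne)
    have hb0 : Tendsto (fun s : ℝ => ‖b₁ s‖ ^ 2) atTop (𝓝 0) := by
      simpa using ((hb₁.vanishing.comp (tendsto_ofReal_atInf (-1))).norm).pow 2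
    obtain ⟨S, hS⟩ := eventually_atTop.1 (hb0.eventually (gt_mem_nhds (half_pos hdpos)))
    have hint : IntegrableOn (fun s : ℝ => (8 / d) * ‖a₂ s‖ ^ 2) (Ioi (max S 1)) :=
      (((memLp_two_iff_integrable_sq_norm hL2.1).1 hL2).const_mul _).integrableOn
    refine not_integrableOn_Ioi_inv (a := max S 1)
      (Integrable.mono hint (by fun_prop) ?_)
    filter_upwards [ae_restrict_mem measurableSet_Ioi] with s hs
    have hs1 : 1 < s := lt_of_le_of_lt (le_max_right _ _) hs
    have hs2 : S ≤ s := (le_max_left _ _).trans (le_of_lt hs)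
    have h1 := hS s hs2
    have h2 := hident s
    rw [Real.norm_of_nonneg (by positivity), Real.norm_of_nonneg (by positivity),
      inv_le_iff_one_le_mul₀ (by linarith), div_mul_eq_mul_div, div_mul_eq_mul_div,
      one_le_div hdpos]
    nlinarith
  refine eq_zero_of_eq_zero_on_pos ha₂ (fun s hs => ?_) s
  have h1 := hident s
  rw [hdz] at h1
  have h2 : 0 ≤ ‖b₁ s‖ ^ 2 := by positivity
  have h3 : 0 ≤ 4 * s * ‖a₂ s‖ ^ 2 := by positivity
  have h4 : 4 * s * ‖a₂ s‖ ^ 2 = 0 := by linarith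
  have h5 : ‖a₂ s‖ ^ 2 = 0 := (mul_eq_zero.1 h4).resolve_left (by positivity)
  simpa using h5

/-! ### Solution of the Riemann–Hilbert problem for one row -/

open scoped Convolution

theorem integrable_conv {p α : ℝ → ℂ} (hp : Integrable p) (hα : Integrable α) :
    Integrable (p ⋆[ContinuousLinearMap.mul ℂ ℂ] α) :=
  hp.integrable_convolution _ hα

theorem fourierInv_conv {p α : ℝ → ℂ} (hp : Integrable p) (hα : Integrable α) (s : ℝ) :
    𝓕⁻ (p ⋆[ContinuousLinearMap.mul ℂ ℂ] α) s = 𝓕⁻ p s * 𝓕⁻ α s := by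
  simp only [Real.fourierInv_eq_fourier_neg]
  exact Real.fourier_mul_convolution_eq hp hα (-s)

theorem fourierInv_add_smul {c d : ℝ → ℂ} (hc : Integrable c) (hd : Integrable d) (e : ℂ) (s : ℝ) :
    𝓕⁻ (fun t => c t + e * d t) s = 𝓕⁻ c s + e * 𝓕⁻ d s := by
  have hi : ∀ {c : ℝ → ℂ}, Integrable c →
      Integrable (fun t : ℝ => c t * Complex.exp (2 * Real.pi * Complex.I * t * s)) := by
    intro c hc
    refine hc.mono (hc.aestronglyMeasurable.mul (by fun_prop)) (ae_of_all _ fun t => ?_)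
    rw [norm_mul]
    refine mul_le_of_le_one_right (norm_nonneg _) ?_
    rw [Complex.norm_exp]
    simp
  simp only [fourierInv_real_eq]
  rw [← integral_const_mul, ← integral_add (hi hc) ((hi hd).const_mul e)]
  congr 1
  ext t
  ring

/-- Convolution with a function on a half line, evaluated on the opposite half line, is a Hankel
operator. -/
theorem conv_unweight {ε : ℝ} (hε : ε = 1 ∨ ε = -1) (P : Lp ℂ 2 halfLine) (α : ℝ → ℂ) (s : ℝ) :
    (unweight (-ε) P ⋆[ContinuousLinearMap.mul ℂ ℂ] α) (ε * s) =
      ∫ t in Ioi (0 : ℝ), α (ε * (s + t)) * (((1 + |t| : ℝ) : ℂ)⁻¹ * P t) := by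
  have hε' : -ε = 1 ∨ -ε = -1 := by rcases hε with rfl | rfl <;> simp
  have hemb : MeasurableEmbedding fun t : ℝ => -ε * t :=
    (Homeomorph.mulLeft₀ (-ε)
      (by rcases hε' with h | h <;> rw [h] <;> norm_num)).measurableEmbedding
  rw [convolution_mul, ← (measurePreserving_sign_mul hε').integral_comp hemb,
    ← integral_indicator measurableSet_Ioi]
  congr 1
  ext t
  by_cases ht : 0 < t
  · rw [unweight_of_pos hε' P ht, indicator_of_mem (show t ∈ Ioi 0 from ht), mul_comm]
    congr 2
    ring
  · have h1 : -ε * (-ε * t) ≤ 0 := by rcases hε with rfl | rfl <;> linarith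
    rw [unweight_of_neg P h1, zero_mul, indicator_of_notMem (by simpa using ht)]

theorem halfFourier_unweight {ε : ℝ} (hε : ε = 1 ∨ ε = -1) (P : Lp ℂ 2 halfLine) (s : ℝ) :
    halfFourier ε (unweight ε P) s = 𝓕⁻ (unweight ε P) s := by
  have h0 : halfFourier (-ε) (unweight ε P) s = 0 := by
    rw [halfFourier]
    refine setIntegral_eq_zero_of_forall_eq_zero fun t ht => ?_
    have ht' : 0 < t := ht
    rw [unweight_of_neg P (by rcases hε with rfl | rfl <;> linarith), zero_mul]
  rw [← halfFourier_add_halfFourier (integrable_unweight hε P)]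
  rcases hε with rfl | rfl
  · rw [h0, add_zero]
  · rw [neg_neg] at h0
    rw [h0, zero_add]

/-- The data of a solution of the Riemann–Hilbert problem for the row vector `m = (m₁, m₂)` which
tends to `e = (e₁, e₂)`, in terms of the Fourier transforms `c₁, c₂` of the jumps:
`m₁± = e₁ ± halfFourier (±1) c₁` and `m₂± = e₂ ± halfFourier (±1) c₂` satisfy `m₁₊ - m₁₋ = v m₂₊`
and `m₂₊ - m₂₋ = u m₁₋`. -/
structure IsRowSolution (u v : ℝ → ℂ) (e₁ e₂ : ℂ) (c₁ c₂ : ℝ → ℂ) : Prop where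
  integrable₁ : Integrable c₁
  integrable₂ : Integrable c₂
  jump₁ : ∀ s : ℝ, 𝓕⁻ c₁ s = v s * (e₂ + halfFourier 1 c₂ s)
  jump₂ : ∀ s : ℝ, 𝓕⁻ c₂ s = u s * (e₁ - halfFourier (-1) c₁ s)
  memLp₁ : MemLp (fun s : ℝ => halfFourier (-1) c₁ s) 2
  memLp₂ : MemLp (fun s : ℝ => halfFourier 1 c₂ s) 2

/-- A solution of the pair of integral equations on the half line for the Fourier transforms of
`n₂₊` and `n₁₋` yields a solution of the Riemann–Hilbert problem. -/
theorem isRowSolution_of_marchenko {u v : ℝ → ℂ} (hu : IsL1H1 u) (hv : IsL1H1 v) {e₁ e₂ : ℂ}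
    {P Q : Lp ℂ 2 halfLine}
    (hP : ∀ᵐ s ∂halfLine, P s = ((1 + |s| : ℝ) : ℂ) *
      ((∫ t in Ioi (0 : ℝ), 𝓕 u (1 * (s + t)) * (((1 + |t| : ℝ) : ℂ)⁻¹ * Q t)) +
        e₁ * 𝓕 u (1 * s)))
    (hQ : ∀ᵐ s ∂halfLine, Q s = -(((1 + |s| : ℝ) : ℂ) *
      ((∫ t in Ioi (0 : ℝ), 𝓕 v (-1 * (s + t)) * (((1 + |t| : ℝ) : ℂ)⁻¹ * P t)) +
        e₂ * 𝓕 v (-1 * s)))) :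
    ∃ c₁ c₂ : ℝ → ℂ, IsRowSolution u v e₁ e₂ c₁ c₂ ∧
      ∀ s : ℝ, halfFourier 1 c₂ s = 𝓕⁻ (unweight 1 P) s := by
  have h1 : (1 : ℝ) = 1 ∨ (1 : ℝ) = -1 := Or.inl rfl
  have hm1 : (-1 : ℝ) = 1 ∨ (-1 : ℝ) = -1 := Or.inr rfl
  set p := unweight 1 P with hp
  set q := unweight (-1) Q with hq
  have hpi : Integrable p := integrable_unweight h1 P
  have hqi : Integrable q := integrable_unweight hm1 Q
  have hαi := hu.integrable_fourier
  have hβi := hv.integrable_fourier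
  set c₁ : ℝ → ℂ := fun t => (p ⋆[ContinuousLinearMap.mul ℂ ℂ] 𝓕 v) t + e₂ * 𝓕 v t with hc₁
  set c₂ : ℝ → ℂ := fun t => (q ⋆[ContinuousLinearMap.mul ℂ ℂ] 𝓕 u) t + e₁ * 𝓕 u t with hc₂
  have hc₂p : ∀ s : ℝ, halfFourier 1 c₂ s = 𝓕⁻ p s := by
    intro s
    rw [← halfFourier_unweight h1 P]
    refine halfFourier_congr ?_ s
    filter_upwards [(ae_restrict_iff' measurableSet_Ioi).1 hP] with t ht ht0
    rw [unweight_of_pos h1 P ht0, ht ht0, ← conv_unweight h1 Q (𝓕 u) t,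
      inv_mul_cancel_left₀ (one_add_abs_ne_zero t)]
  have hc₁q : ∀ s : ℝ, halfFourier (-1) c₁ s = -𝓕⁻ q s := by
    intro s
    rw [← halfFourier_unweight hm1 Q]
    have hneg : -halfFourier (-1) (unweight (-1) Q) s =
        halfFourier (-1) (fun t => -unweight (-1) Q t) s := by
      simp only [halfFourier, neg_mul, integral_neg]
    rw [hneg]
    refine halfFourier_congr ?_ s
    filter_upwards [(ae_restrict_iff' measurableSet_Ioi).1 hQ] with t ht ht0
    have hconv := conv_unweight hm1 P (𝓕 v) t
    rw [neg_neg] at hconv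
    rw [unweight_of_pos hm1 Q ht0, ht ht0, ← hconv, mul_neg, neg_neg,
      inv_mul_cancel_left₀ (one_add_abs_ne_zero t)]
  refine ⟨c₁, c₂, ⟨(integrable_conv hpi hβi).add (hβi.const_mul _),
    (integrable_conv hqi hαi).add (hαi.const_mul _), fun s => ?_, fun s => ?_, ?_, ?_⟩, hc₂p⟩
  · rw [hc₁, fourierInv_add_smul (integrable_conv hpi hβi) hβi, fourierInv_conv hpi hβi,
      hv.fourierInv_fourier, hc₂p]
    ring
  · rw [hc₂, fourierInv_add_smul (integrable_conv hqi hαi) hαi, fourierInv_conv hqi hαi,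
      hu.fourierInv_fourier, hc₁q]
    ring
  · simp only [hc₁q]
    exact (memLp_fourierInv hqi (memLp_unweight hm1 Q)).neg
  · simp only [hc₂p]
    exact memLp_fourierInv hpi (memLp_unweight h1 P)

theorem unweight_eq_zero {P : Lp ℂ 2 halfLine} (h : unweight 1 P =ᵐ[volume] 0) : P = 0 := by
  rw [Lp.eq_zero_iff_ae_eq_zero, Filter.EventuallyEq, ae_restrict_iff' measurableSet_Ioi]
  filter_upwards [h] with t ht ht0
  have h1 := unweight_of_pos (Or.inl rfl) P ht0
  rw [one_mul, ht, Pi.zero_apply] at h1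
  exact (mul_eq_zero.1 h1.symm).resolve_left (inv_ne_zero (one_add_abs_ne_zero t))

theorem IsRowSolution.vanishing {u v : ℝ → ℂ} (huv : ∀ s : ℝ, v s = 4 * s * star (u s))
    {c₁ c₂ : ℝ → ℂ} (h : IsRowSolution u v 0 0 c₁ c₂) (s : ℝ) : halfFourier 1 c₂ s = 0 := by
  have h1 : (1 : ℝ) = 1 ∨ (1 : ℝ) = -1 := Or.inl rfl
  have hm1 : (-1 : ℝ) = 1 ∨ (-1 : ℝ) = -1 := Or.inr rfl
  refine NLSGI.vanishing huv (isSectionalZero_halfFourier h1 h.integrable₁)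
    (isSectionalZero_halfFourier h1 h.integrable₂)
    (isSectionalZero_halfFourier hm1 h.integrable₁).neg
    (isSectionalZero_halfFourier hm1 h.integrable₂).neg (fun s => ?_) (fun s => ?_) h.memLp₂ s
  · rw [sub_neg_eq_add, halfFourier_add_halfFourier h.integrable₁, h.jump₁, zero_add]
  · rw [sub_neg_eq_add, halfFourier_add_halfFourier h.integrable₂, h.jump₂, zero_sub]

/-- The Riemann–Hilbert problem for one row is solvable, with an arbitrary limit at infinity: by the
vanishing lemma the Fredholm alternative applies to the compact product of two Hankel operators. -/
theorem exists_isRowSolution {u v : ℝ → ℂ} (hu : IsL1H1 u) (hv : IsL1H1 v)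
    (huv : ∀ s : ℝ, v s = 4 * s * star (u s)) (e₁ e₂ : ℂ) :
    ∃ c₁ c₂ : ℝ → ℂ, IsRowSolution u v e₁ e₂ c₁ c₂ := by
  have h1 : (1 : ℝ) = 1 ∨ (1 : ℝ) = -1 := Or.inl rfl
  have hm1 : (-1 : ℝ) = 1 ∨ (-1 : ℝ) = -1 := Or.inr rfl
  have hcont : ∀ {w : ℝ → ℂ}, IsL1H1 w → Continuous (𝓕 w) := fun hw =>
    VectorFourier.fourierIntegral_continuous Real.continuous_fourierChar continuous_inner
      hw.integrable
  obtain ⟨A, hA, hAf⟩ := exists_isCompactOperator_hankel h1 (hcont hu) hu.memLp_weighted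
  obtain ⟨B, -, hBf⟩ := exists_isCompactOperator_hankel hm1 (hcont hv) hv.memLp_weighted
  have hdata : ∀ {ε : ℝ} (_ : ε = 1 ∨ ε = -1) {w : ℝ → ℂ}, IsL1H1 w →
      MemLp (fun s : ℝ => ((1 + |s| : ℝ) : ℂ) * 𝓕 w (ε * s)) 2 halfLine := by
    intro ε hε w hw
    have := (hw.memLp_weighted.comp_measurePreserving (measurePreserving_sign_mul hε)).restrict
      (Ioi 0)
    have hε1 : |ε| = 1 := by rcases hε with rfl | rfl <;> simp
    simpa [Function.comp_def, abs_mul, hε1] using this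
  set a₀ : Lp ℂ 2 halfLine := (hdata h1 hu).toLp _ with ha₀
  set b₀ : Lp ℂ 2 halfLine := (hdata hm1 hv).toLp _ with hb₀
  -- Both equations of the Marchenko pair follow from the corresponding identities in `L²(0, ∞)`.
  have hsolve : ∀ (f₁ f₂ : ℂ) (P Q : Lp ℂ 2 halfLine), P = A Q + f₁ • a₀ → Q = -(B P + f₂ • b₀) →
      ∃ c₁ c₂ : ℝ → ℂ, IsRowSolution u v f₁ f₂ c₁ c₂ ∧
        ∀ s : ℝ, halfFourier 1 c₂ s = 𝓕⁻ (unweight 1 P) s := by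
    intro f₁ f₂ P Q hP hQ
    refine isRowSolution_of_marchenko (Q := Q) hu hv ?_ ?_
    · have e1 := Lp.coeFn_add (A Q) (f₁ • a₀)
      rw [← hP] at e1
      filter_upwards [e1, hAf Q, Lp.coeFn_smul f₁ a₀, (hdata h1 hu).coeFn_toLp] with s e1 e2 e3 e4
      rw [e1, Pi.add_apply, e2, e3, Pi.smul_apply, ha₀, e4, smul_eq_mul]
      ring
    · have e1 := Lp.coeFn_neg (B P + f₂ • b₀)
      rw [← hQ] at e1
      filter_upwards [e1, Lp.coeFn_add (B P) (f₂ • b₀), hBf P, Lp.coeFn_smul f₂ b₀,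
        (hdata hm1 hv).coeFn_toLp] with s e1 e1' e2 e3 e4
      rw [e1, Pi.neg_apply, e1', Pi.add_apply, e2, e3, Pi.smul_apply, hb₀, e4, smul_eq_mul]
      ring
  set T : Lp ℂ 2 halfLine →L[ℂ] Lp ℂ 2 halfLine := -(A.comp B) with hT
  have hTc : IsCompactOperator T := (hA.comp_clm B).neg
  have hnot : ¬ Module.End.HasEigenvalue (T : Module.End ℂ (Lp ℂ 2 halfLine)) 1 := by
    intro hev
    obtain ⟨P, hP⟩ := hev.exists_hasEigenvector
    have hPe : -(A (B P)) = P := by simpa [hT] using hP.apply_eq_smul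
    obtain ⟨c₁, c₂, hc, hcP⟩ := hsolve 0 0 P (-(B P)) (by simp [hPe]) (by simp)
    refine hP.2 (unweight_eq_zero (ae_eq_zero_of_fourierInv_eq_zero (integrable_unweight h1 P)
      fun s => ?_))
    rw [← hcP, hc.vanishing huv]
  have hres := (hTc.hasEigenvalue_or_mem_resolventSet one_ne_zero).resolve_left hnot
  rw [spectrum.mem_resolventSet_iff, ContinuousLinearMap.isUnit_iff_bijective] at hres
  obtain ⟨P, hP⟩ := hres.2 (e₁ • a₀ - e₂ • A b₀)
  have hP' : P + A (B P) = e₁ • a₀ - e₂ • A b₀ := by simpa [hT] using hP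
  obtain ⟨c₁, c₂, hc, -⟩ := hsolve e₁ e₂ P (-(B P + e₂ • b₀)) (by
    rw [map_neg, map_add, map_smul]
    refine (eq_sub_of_add_eq hP').trans ?_
    abel) rfl
  exact ⟨c₁, c₂, hc⟩

/-! ### Square integrability, decay and Cauchy integrals -/

theorem continuous_halfFourier_ofReal {ε : ℝ} (hε : ε = 1 ∨ ε = -1) {c : ℝ → ℂ}
    (hc : Integrable c) : Continuous (fun s : ℝ => halfFourier ε c s) :=
  (continuousOn_halfFourier (integrableOn_comp_mul hε hc)).comp_continuous
    Complex.continuous_ofReal (ofReal_mem_closedHalfPlane ε)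

theorem exists_bound_halfFourier {ε : ℝ} (hε : ε = 1 ∨ ε = -1) {c : ℝ → ℂ} (hc : Integrable c) :
    ∃ K : ℝ, 0 ≤ K ∧ ∀ z ∈ closedHalfPlane ε, ‖halfFourier ε c z‖ ≤ K :=
  ⟨_, integral_nonneg fun _ => norm_nonneg _,
    fun _ hz => norm_halfFourier_le (integrableOn_comp_mul hε hc) hz⟩

theorem integrable_mul_of_bounded {u m : ℝ → ℂ} (hu : Integrable u) (hm : Continuous m) {K : ℝ}
    (hK : ∀ s, ‖m s‖ ≤ K) : Integrable (fun s => u s * m s) :=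
  hu.mul_bdd (c := K) hm.aestronglyMeasurable (ae_of_all _ hK)

theorem memLp_mul_of_bounded {u m : ℝ → ℂ} (hu : MemLp u 2) (hm : Continuous m) {K : ℝ}
    (hK : ∀ s, ‖m s‖ ≤ K) : MemLp (fun s => u s * m s) 2 := by
  refine MemLp.of_le_mul (c := K) hu (hu.1.mul hm.aestronglyMeasurable) (ae_of_all _ fun s => ?_)
  rw [norm_mul, mul_comm]
  gcongr
  exact hK s

section Row

variable {u v : ℝ → ℂ} {e₁ e₂ : ℂ} {c₁ c₂ : ℝ → ℂ}

theorem IsRowSolution.exists_bound (h : IsRowSolution u v e₁ e₂ c₁ c₂) :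
    ∃ K : ℝ, (∀ s : ℝ, ‖e₂ + halfFourier 1 c₂ s‖ ≤ K) ∧
      ∀ s : ℝ, ‖e₁ - halfFourier (-1) c₁ s‖ ≤ K := by
  obtain ⟨K₁, hK₁, h₁⟩ := exists_bound_halfFourier (Or.inr rfl) h.integrable₁
  obtain ⟨K₂, hK₂, h₂⟩ := exists_bound_halfFourier (Or.inl rfl) h.integrable₂
  refine ⟨‖e₁‖ + ‖e₂‖ + K₁ + K₂, fun s => ?_, fun s => ?_⟩
  · have h3 := h₂ s (ofReal_mem_closedHalfPlane _ s)
    have := norm_add_le e₂ (halfFourier 1 c₂ s)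
    linarith [norm_nonneg e₁]
  · have h3 := h₁ s (ofReal_mem_closedHalfPlane _ s)
    have := norm_sub_le e₁ (halfFourier (-1) c₁ s)
    linarith [norm_nonneg e₂]

theorem IsRowSolution.integrable_fourierInv (h : IsRowSolution u v e₁ e₂ c₁ c₂) (hu : Integrable u)
    (hv : Integrable v) : Integrable (𝓕⁻ c₁) ∧ Integrable (𝓕⁻ c₂) := by
  obtain ⟨K, hK₂, hK₁⟩ := h.exists_bound
  rw [funext h.jump₁, funext h.jump₂]
  exact ⟨integrable_mul_of_bounded hv
      (continuous_const.add (continuous_halfFourier_ofReal (Or.inl rfl) h.integrable₂)) hK₂,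
    integrable_mul_of_bounded hu
      (continuous_const.sub (continuous_halfFourier_ofReal (Or.inr rfl) h.integrable₁)) hK₁⟩

theorem IsRowSolution.memLp_fourierInv (h : IsRowSolution u v e₁ e₂ c₁ c₂) (hu : MemLp u 2)
    (hv : MemLp v 2) : MemLp (𝓕⁻ c₁) 2 ∧ MemLp (𝓕⁻ c₂) 2 := by
  obtain ⟨K, hK₂, hK₁⟩ := h.exists_bound
  rw [funext h.jump₁, funext h.jump₂]
  exact ⟨memLp_mul_of_bounded hv
      (continuous_const.add (continuous_halfFourier_ofReal (Or.inl rfl) h.integrable₂)) hK₂,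
    memLp_mul_of_bounded hu
      (continuous_const.sub (continuous_halfFourier_ofReal (Or.inr rfl) h.integrable₁)) hK₁⟩

theorem IsRowSolution.memLp_halfFourier (h : IsRowSolution u v e₁ e₂ c₁ c₂) (hu : MemLp u 2)
    (hv : MemLp v 2) {ε : ℝ} (hε : ε = 1 ∨ ε = -1) :
    MemLp (fun s : ℝ => halfFourier ε c₁ s) 2 ∧ MemLp (fun s : ℝ => halfFourier ε c₂ s) 2 := by
  obtain ⟨h₁, h₂⟩ := h.memLp_fourierInv hu hv
  rcases hε with rfl | rfl
  · refine ⟨(h₁.sub h.memLp₁).ae_eq (ae_of_all _ fun s => ?_), h.memLp₂⟩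
    rw [Pi.sub_apply, ← halfFourier_add_halfFourier h.integrable₁]
    ring
  · refine ⟨h.memLp₁, (h₂.sub h.memLp₂).ae_eq (ae_of_all _ fun s => ?_)⟩
    rw [Pi.sub_apply, ← halfFourier_add_halfFourier h.integrable₂]
    ring

theorem halfFourier_neg_one_eq_fourierInv {c : ℝ → ℂ} (hc : Integrable c) (s : ℝ) :
    halfFourier (-1) c s = 𝓕⁻ ((Iio 0).indicator c) s := by
  rw [← halfFourier_add_halfFourier (hc.indicator measurableSet_Iio)]
  have h1 : halfFourier 1 ((Iio 0).indicator c) s = 0 := by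
    rw [halfFourier]
    refine setIntegral_eq_zero_of_forall_eq_zero fun t ht => ?_
    have ht' : 0 < t := ht
    rw [indicator_of_notMem (by simpa using ht'.le), zero_mul]
  rw [h1, zero_add]
  refine halfFourier_congr (ae_of_all _ fun t ht => ?_) s
  rw [indicator_of_mem (by simpa using ht)]

/-- If `z u(z)` has an integrable Fourier transform, then the second entry of a row solution decays
like `1/|z|`: `z n₂±` and the one-sided Fourier integrals of the jump `z u m₁₋` differ by a
constant. -/
theorem IsRowSolution.exists_bound_mul (h : IsRowSolution u v e₁ e₂ c₁ c₂) {w : ℝ → ℂ}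
    (hw : IsL1H1 w) (hwu : ∀ s : ℝ, w s = s * u s) :
    ∃ K : ℝ, (∀ z ∈ closedHalfPlane 1, ‖z * halfFourier 1 c₂ z‖ ≤ K) ∧
      ∀ z ∈ closedHalfPlane (-1), ‖z * halfFourier (-1) c₂ z‖ ≤ K := by
  have h1 : (1 : ℝ) = 1 ∨ (1 : ℝ) = -1 := Or.inl rfl
  have hm1 : (-1 : ℝ) = 1 ∨ (-1 : ℝ) = -1 := Or.inr rfl
  set q : ℝ → ℂ := fun t => (-1 : ℂ) * (Iio 0).indicator c₁ t with hq
  have hqi : Integrable q := (h.integrable₁.indicator measurableSet_Iio).const_mul _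
  have hwi := hw.integrable_fourier
  set d : ℝ → ℂ := fun t => (q ⋆[ContinuousLinearMap.mul ℂ ℂ] 𝓕 w) t + e₁ * 𝓕 w t with hd
  have hdi : Integrable d := (integrable_conv hqi hwi).add (hwi.const_mul _)
  have hqF : ∀ s : ℝ, 𝓕⁻ q s = -halfFourier (-1) c₁ s := by
    intro s
    rw [halfFourier_neg_one_eq_fourierInv h.integrable₁, fourierInv_real_eq, fourierInv_real_eq,
      ← integral_neg]
    congr 1
    ext t
    simp only [hq]
    ring
  have hdF : ∀ s : ℝ, 𝓕⁻ d s = s * 𝓕⁻ c₂ s := by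
    intro s
    rw [hd, fourierInv_add_smul (integrable_conv hqi hwi) hwi, fourierInv_conv hqi hwi,
      hw.fourierInv_fourier, hqF, h.jump₂, hwu]
    ring
  have hp₂ := isSectionalZero_halfFourier h1 h.integrable₂
  have hm₂ := isSectionalZero_halfFourier hm1 h.integrable₂
  have hpd := isSectionalZero_halfFourier h1 hdi
  have hmd := isSectionalZero_halfFourier hm1 hdi
  have hlim : ∀ {ε : ℝ} {f g : ℂ → ℂ}, IsSectionalZero ε f → IsSectionalZero ε g →
      Tendsto (fun z => (z * f z - g z) / z) (atInf ε) (𝓝 0) := by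
    intro ε f g hf hg
    have := hf.vanishing.sub hg.div_tendsto
    rw [sub_zero] at this
    refine this.congr' ?_
    filter_upwards [eventually_ne_zero_atInf ε] with z hz
    field_simp
  obtain ⟨hcp, hcm⟩ := glue_const
    (fp := fun z => z * halfFourier 1 c₂ z - halfFourier 1 d z)
    (fm := fun z => z * (-halfFourier (-1) c₂ z) - (-halfFourier (-1) d z))
    ((differentiableOn_id.mul hp₂.analytic).sub hpd.analytic)
    ((continuousOn_id.mul hp₂.continuous).sub hpd.continuous)
    ((differentiableOn_id.mul hm₂.neg.analytic).sub hmd.neg.analytic)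
    ((continuousOn_id.mul hm₂.neg.continuous).sub hmd.neg.continuous)
    (fun s => by
      have e1 := halfFourier_add_halfFourier h.integrable₂ s
      have e2 := halfFourier_add_halfFourier hdi s
      rw [hdF, ← e1] at e2
      linear_combination -e2)
    (hlim hp₂ hpd) (hlim hm₂.neg hmd.neg)
  obtain ⟨Kp, hKp, hbp⟩ := exists_bound_halfFourier h1 hdi
  obtain ⟨Km, hKm, hbm⟩ := exists_bound_halfFourier hm1 hdi
  simp only [zero_mul, zero_sub] at hcp hcm
  set a : ℂ := -halfFourier 1 d 0
  refine ⟨‖a‖ + Kp + Km, fun z hz => ?_, fun z hz => ?_⟩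
  · have e : z * halfFourier 1 c₂ z = a + halfFourier 1 d z := by
      linear_combination hcp z hz
    rw [e]
    have := norm_add_le a (halfFourier 1 d z)
    linarith [hbp z hz]
  · have e : z * halfFourier (-1) c₂ z = -a + halfFourier (-1) d z := by
      linear_combination -hcm z hz
    rw [e]
    have := norm_add_le (-a) (halfFourier (-1) d z)
    rw [norm_neg] at this
    linarith [hbm z hz]

end Row

/-- The Cauchy kernel is the Fourier transform of a one-sided exponential. -/
theorem fourier_indicator_exp {ε : ℝ} (hε : ε = 1 ∨ ε = -1) {z : ℂ} (hz : z ∈ halfPlane ε)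
    (s : ℝ) :
    𝓕 (fun t : ℝ => (Ioi (0 : ℝ)).indicator
      (fun τ : ℝ => Complex.exp (2 * Real.pi * Complex.I * (ε * τ) * z)) (ε * t)) s =
      ε * ((2 * Real.pi * Complex.I)⁻¹ * ((s : ℂ) - z)⁻¹) := by
  have hε2 : ε * ε = 1 := by rcases hε with rfl | rfl <;> norm_num
  have hε2' : (ε : ℂ) * ε = 1 := by exact_mod_cast hε2
  have hz' : 0 < ε * z.im := hz
  have hemb : MeasurableEmbedding fun t : ℝ => ε * t :=
    (Homeomorph.mulLeft₀ ε (by rcases hε with h | h <;> rw [h] <;> norm_num)).measurableEmbedding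
  set a : ℂ := 2 * Real.pi * Complex.I * ε * (z - s) with ha
  have har : a.re < 0 := by
    have : a.re = -(2 * Real.pi * (ε * z.im)) := by
      simp [ha]
      ring
    rw [this]
    have := Real.pi_pos
    have : 0 < 2 * Real.pi * (ε * z.im) := by positivity
    linarith
  have hint := integral_exp_mul_complex_Ioi har 0
  rw [Real.fourier_real_eq_integral_exp_smul]
  have e1 : ∀ t : ℝ, Complex.exp (((-2 * Real.pi * t * s : ℝ) : ℂ) * Complex.I) •
      (Ioi (0 : ℝ)).indicator
        (fun τ : ℝ => Complex.exp (2 * Real.pi * Complex.I * (ε * τ) * z)) (ε * t) =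
      (Ioi (0 : ℝ)).indicator (fun τ : ℝ => Complex.exp (a * τ)) (ε * t) := by
    intro t
    by_cases ht : 0 < ε * t
    · rw [indicator_of_mem (show ε * t ∈ Ioi 0 from ht),
        indicator_of_mem (show ε * t ∈ Ioi 0 from ht), smul_eq_mul, ← Complex.exp_add]
      congr 1
      rw [ha]
      push_cast
      linear_combination (2 * Real.pi * Complex.I * t * s : ℂ) * hε2'
    · rw [indicator_of_notMem (by simpa using ht), indicator_of_notMem (by simpa using ht),
        smul_zero]
  simp only [e1]
  rw [(measurePreserving_sign_mul hε).integral_comp hemb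
    (fun τ => (Ioi (0 : ℝ)).indicator (fun τ : ℝ => Complex.exp (a * τ)) τ),
    integral_indicator measurableSet_Ioi, hint]
  have hne : (z - s : ℂ) ≠ 0 := by
    intro h0
    have : z.im = 0 := by simpa using congrArg Complex.im h0
    simp [this] at hz'
  have hne' : (s - z : ℂ) ≠ 0 := by
    rw [← neg_sub]
    exact neg_ne_zero.2 hne
  have hε0 : (ε : ℂ) ≠ 0 := left_ne_zero_of_mul_eq_one hε2'
  have hpi : (Real.pi : ℂ) ≠ 0 := by exact_mod_cast Real.pi_ne_zero
  have hI := Complex.I_ne_zero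
  simp only [Complex.ofReal_zero, mul_zero, Complex.exp_zero]
  rw [ha]
  field_simp
  linear_combination (s - z) * hε2'

/-- The Cauchy integral of an integrable function with integrable Fourier transform. -/
theorem cauchy_integral_fourierInv {ε : ℝ} (hε : ε = 1 ∨ ε = -1) {c : ℝ → ℂ} (hc : Integrable c)
    (hf : Integrable (𝓕⁻ c)) {z : ℂ} (hz : z ∈ halfPlane ε) :
    (2 * Real.pi * Complex.I)⁻¹ * ∫ s : ℝ, 𝓕⁻ c s / ((s : ℂ) - z) = ε * halfFourier ε c z := by
  have hε2 : ε * ε = 1 := by rcases hε with rfl | rfl <;> norm_num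
  have hε2' : (ε : ℂ) * ε = 1 := by exact_mod_cast hε2
  have hε0 : ε ≠ 0 := left_ne_zero_of_mul_eq_one hε2
  have hz' : 0 < ε * z.im := hz
  have hemb : MeasurableEmbedding fun t : ℝ => ε * t :=
    (Homeomorph.mulLeft₀ ε hε0).measurableEmbedding
  set ψ₀ : ℝ → ℂ := (Ioi (0 : ℝ)).indicator
      (fun τ : ℝ => Complex.exp (2 * Real.pi * Complex.I * (ε * τ) * z)) with hψ₀
  have hψ₀i : Integrable ψ₀ := by
    rw [hψ₀, integrable_indicator_iff measurableSet_Ioi]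
    have har : (2 * Real.pi * Complex.I * ε * z).re < 0 := by
      have : (2 * Real.pi * Complex.I * ε * z).re = -(2 * Real.pi * (ε * z.im)) := by
        simp
        ring
      rw [this]
      have := Real.pi_pos
      have : 0 < 2 * Real.pi * (ε * z.im) := by positivity
      linarith
    refine (integrableOn_exp_mul_complex_Ioi har 0).congr_fun (fun t _ => ?_) measurableSet_Ioi
    ring_nf
  have hψi : Integrable (fun t : ℝ => ψ₀ (ε * t)) := hψ₀i.comp_mul_left' hε0
  have hflip := integral_fourier_mul_flip hf hψi
  have hF : ∀ s : ℝ, 𝓕 (fun t : ℝ => ψ₀ (ε * t)) s =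
      ε * ((2 * Real.pi * Complex.I)⁻¹ * ((s : ℂ) - z)⁻¹) := fourier_indicator_exp hε hz
  have hleft : ∫ ξ, 𝓕 (𝓕⁻ c) ξ * ψ₀ (ε * ξ) = halfFourier ε c z := by
    have h1 : ∫ ξ, 𝓕 (𝓕⁻ c) ξ * ψ₀ (ε * ξ) = ∫ ξ, c ξ * ψ₀ (ε * ξ) := by
      refine integral_congr_ae ?_
      filter_upwards [fourier_fourierInv_ae hc hf] with t ht
      rw [ht]
    have h2 : ∀ ξ : ℝ, c ξ * ψ₀ (ε * ξ) = (Ioi (0 : ℝ)).indicator (fun τ : ℝ => c (ε * τ) *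
        Complex.exp (2 * Real.pi * Complex.I * (ε * τ) * z)) (ε * ξ) := by
      intro ξ
      have h3 : ε * (ε * ξ) = ξ := by rw [← mul_assoc, hε2, one_mul]
      by_cases ht : 0 < ε * ξ
      · rw [hψ₀, indicator_of_mem (show ε * ξ ∈ Ioi 0 from ht),
          indicator_of_mem (show ε * ξ ∈ Ioi 0 from ht), h3]
      · rw [hψ₀, indicator_of_notMem (by simpa using ht), indicator_of_notMem (by simpa using ht),
          mul_zero]
    rw [h1]
    simp only [h2]
    rw [(measurePreserving_sign_mul hε).integral_comp hemb (fun x => (Ioi (0 : ℝ)).indicator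
      (fun τ : ℝ => c (ε * τ) * Complex.exp (2 * Real.pi * Complex.I * (ε * τ) * z)) x),
      integral_indicator measurableSet_Ioi]
    rfl
  rw [hleft] at hflip
  rw [hflip, ← integral_const_mul, ← integral_const_mul]
  congr 1
  ext s
  rw [hF, div_eq_mul_inv]
  linear_combination (-(2 * Real.pi * Complex.I)⁻¹ * 𝓕⁻ c s * ((s : ℂ) - z)⁻¹) * hε2'

/-! ### The Riemann–Hilbert problem for matrices -/

/-- The entry `R₁₂`, which enters the second jump relation of a row. -/
def upperEntry (rp : ℝ → ℂ) (x s : ℝ) : ℂ :=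
  star (rp s) * Complex.exp (-(2 * Complex.I * (s + 1) * x))

/-- The entry `R₂₁`, which enters the first jump relation of a row. -/
def lowerEntry (rm : ℝ → ℂ) (x s : ℝ) : ℂ :=
  rm s * Complex.exp (2 * Complex.I * (s + 1) * x)

theorem star_exp_phase (x s : ℝ) : star (Complex.exp (2 * Complex.I * (s + 1) * x)) =
    Complex.exp (-(2 * Complex.I * (s + 1) * x)) := by
  change (starRingEnd ℂ) _ = _
  rw [← Complex.exp_conj]
  simp only [map_mul, map_add, Complex.conj_I, Complex.conj_ofReal, map_one, map_ofNat]
  congr 1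
  ring

theorem isL1H1_mul_phase {u : ℝ → ℂ} (hu : IsL1H1 u) (x : ℝ) :
    IsL1H1 (fun s => u s * Complex.exp (2 * Complex.I * (s + 1) * x)) := by
  have hform : ∀ s : ℝ, Complex.exp (2 * Complex.I * (s + 1) * x) =
      Complex.exp (Complex.I * ((2 * (s + 1) * x : ℝ) : ℂ)) := by
    intro s
    congr 1
    push_cast
    ring
  have hnorm : ∀ s : ℝ, ‖Complex.exp (2 * Complex.I * (s + 1) * x)‖ = 1 := by
    intro s
    rw [hform, mul_comm, Complex.norm_exp_ofReal_mul_I]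
  refine hu.mul_unimodular hnorm (A := 2 * |x|) (by positivity) (fun s t => ?_) (by fun_prop)
  have e : Complex.exp (2 * Complex.I * (s + 1) * x) - Complex.exp (2 * Complex.I * (t + 1) * x) =
      Complex.exp (2 * Complex.I * (t + 1) * x) *
        (Complex.exp (Complex.I * ((2 * (s - t) * x : ℝ) : ℂ)) - 1) := by
    rw [mul_sub, ← Complex.exp_add, mul_one]
    congr 2
    push_cast
    ring
  rw [e, norm_mul, hnorm, one_mul]
  refine Real.norm_exp_I_mul_ofReal_sub_one_le.trans (le_of_eq ?_)
  rw [Real.norm_eq_abs, abs_mul, abs_mul, abs_two]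
  ring

theorem isL1H1_upperEntry {rp : ℝ → ℂ} (h : IsL1H1 rp) (x : ℝ) : IsL1H1 (upperEntry rp x) := by
  convert (isL1H1_mul_phase h x).conj using 2 with s
  rw [star_mul', star_exp_phase, upperEntry]

theorem lowerEntry_eq {rp rm : ℝ → ℂ} (hrel : ∀ z : ℝ, rm z = 4 * z * rp z) (x s : ℝ) :
    lowerEntry rm x s = 4 * s * star (upperEntry rp x s) := by
  rw [upperEntry, star_mul', star_star, ← star_exp_phase, star_star, lowerEntry, hrel]
  ring

theorem jumpR_eq (rp rm : ℝ → ℂ) (x s : ℝ) :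
    jumpR rp rm x s = !![upperEntry rp x s * lowerEntry rm x s, upperEntry rp x s;
      lowerEntry rm x s, 0] := by
  have h : Complex.exp (-(2 * Complex.I * (s + 1) * x)) *
      Complex.exp (2 * Complex.I * (s + 1) * x) = 1 := by
    rw [← Complex.exp_add, neg_add_cancel, Complex.exp_zero]
  have e : star (rp s) * rm s = upperEntry rp x s * lowerEntry rm x s := by
    simp only [upperEntry, lowerEntry]
    linear_combination (-(star (rp s) * rm s)) * h
  rw [jumpR, e]
  rfl

/-- The two sections (`ε = ±1`) of the solution with jump transforms `c`, row by row. -/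
def matM (c : Fin 2 → Fin 2 → ℝ → ℂ) (ε : ℝ) (z : ℂ) : Mat2 :=
  Matrix.of fun a b => (1 : Mat2) a b + ε * halfFourier ε (c a b) z

/-- Each row of `c` solves the Riemann–Hilbert problem with the corresponding row of the identity
matrix as its limit at infinity. -/
def IsMatrixData (u v : ℝ → ℂ) (c : Fin 2 → Fin 2 → ℝ → ℂ) : Prop :=
  ∀ a : Fin 2, IsRowSolution u v ((1 : Mat2) a 0) ((1 : Mat2) a 1) (c a 0) (c a 1)

theorem exists_isMatrixData {u v : ℝ → ℂ} (hu : IsL1H1 u) (hv : IsL1H1 v)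
    (huv : ∀ s : ℝ, v s = 4 * s * star (u s)) :
    ∃ c : Fin 2 → Fin 2 → ℝ → ℂ, IsMatrixData u v c := by
  choose c₁ c₂ h using fun a : Fin 2 =>
    exists_isRowSolution hu hv huv ((1 : Mat2) a 0) ((1 : Mat2) a 1)
  exact ⟨fun a => ![c₁ a, c₂ a], fun a => h a⟩

section MatrixData

variable {u v : ℝ → ℂ} {c : Fin 2 → Fin 2 → ℝ → ℂ}

theorem IsMatrixData.integrable (h : IsMatrixData u v c) (a b : Fin 2) : Integrable (c a b) := by
  fin_cases b
  · exact (h a).integrable₁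
  · exact (h a).integrable₂

theorem IsMatrixData.isSectionalM (h : IsMatrixData u v c) {ε : ℝ} (hε : ε = 1 ∨ ε = -1) :
    IsSectionalM ε (matM c ε) := by
  have hs := fun a b => isSectionalZero_halfFourier hε (h.integrable a b)
  refine ⟨fun a b => ?_, ?_, ?_⟩
  · exact ((hs a b).analytic.const_mul _).const_add _
  · refine continuousOn_pi.2 fun a => continuousOn_pi.2 fun b => ?_
    exact continuousOn_const.add (continuousOn_const.mul (hs a b).continuous)
  · refine tendsto_pi_nhds.2 fun a => tendsto_pi_nhds.2 fun b => ?_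
    have := ((hs a b).vanishing.const_mul (ε : ℂ)).const_add ((1 : Mat2) a b)
    rw [mul_zero, add_zero] at this
    exact this

theorem matM_sub_matM (h : IsMatrixData u v c) (s : ℝ) (a b : Fin 2) :
    matM c 1 s a b - matM c (-1) s a b = 𝓕⁻ (c a b) s := by
  rw [← halfFourier_add_halfFourier (h.integrable a b)]
  simp [matM]

theorem IsMatrixData.jump (h : IsMatrixData u v c) (s : ℝ) :
    matM c 1 s - matM c (-1) s = matM c (-1) s * !![u s * v s, u s; v s, 0] := by
  ext a b
  have e₁ := matM_sub_matM h s a 0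
  have e₂ := matM_sub_matM h s a 1
  rw [(h a).jump₁] at e₁
  rw [(h a).jump₂] at e₂
  have m₂ : matM c 1 s a 1 = (1 : Mat2) a 1 + halfFourier 1 (c a 1) s := by simp [matM]
  have m₁ : matM c (-1) s a 0 = (1 : Mat2) a 0 - halfFourier (-1) (c a 0) s := by
    simp [matM, sub_eq_add_neg]
  rw [← m₂] at e₁
  rw [← m₁] at e₂
  rw [Matrix.sub_apply, Matrix.mul_apply, Fin.sum_univ_two]
  fin_cases b
  · simp only [Fin.zero_eta, Matrix.of_apply, Matrix.cons_val', Matrix.cons_val_zero,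
      Matrix.cons_val_one, Matrix.cons_val_fin_one]
    linear_combination e₁ + v s * e₂
  · simp only [Fin.mk_one, Matrix.of_apply, Matrix.cons_val', Matrix.cons_val_zero,
      Matrix.cons_val_one, Matrix.cons_val_fin_one]
    linear_combination e₂

theorem IsMatrixData.memLp (h : IsMatrixData u v c) (hu : MemLp u 2) (hv : MemLp v 2) {ε : ℝ}
    (hε : ε = 1 ∨ ε = -1) (a b : Fin 2) : MemLp (fun s : ℝ => (matM c ε s - 1) a b) 2 := by
  have h1 : MemLp (fun s : ℝ => halfFourier ε (c a b) s) 2 := by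
    fin_cases b
    · exact ((h a).memLp_halfFourier hu hv hε).1
    · exact ((h a).memLp_halfFourier hu hv hε).2
  refine (h1.const_mul (ε : ℂ)).ae_eq (ae_of_all _ fun s => ?_)
  simp [matM]

/-- The second column of `M - 1` decays like `1/|z|`. -/
theorem IsMatrixData.exists_bound_mul (h : IsMatrixData u v c) {w : ℝ → ℂ} (hw : IsL1H1 w)
    (hwu : ∀ s : ℝ, w s = s * u s) {ε : ℝ} (hε : ε = 1 ∨ ε = -1) :
    ∃ K : ℝ, ∀ a, ∀ z ∈ closedHalfPlane ε, ‖z * (matM c ε z - 1) a 1‖ ≤ K := by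
  choose K hKp hKm using fun a => (h a).exists_bound_mul hw hwu
  have hK : ∀ a, ∀ z ∈ closedHalfPlane ε, ‖z * (matM c ε z - 1) a 1‖ ≤ K a := by
    intro a z hz
    have e : ‖z * (matM c ε z - 1) a 1‖ = ‖z * halfFourier ε (c a 1) z‖ := by
      rcases hε with rfl | rfl <;> simp [matM]
    rw [e]
    rcases hε with rfl | rfl
    · exact hKp a z hz
    · exact hKm a z hz
  refine ⟨max (K 0) (K 1), fun a z hz => (hK a z hz).trans ?_⟩
  fin_cases a
  · exact le_max_left _ _
  · exact le_max_right _ _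

theorem IsMatrixData.cauchy (h : IsMatrixData u v c) (hu : Integrable u) (hv : Integrable v)
    {ε : ℝ} (hε : ε = 1 ∨ ε = -1) {z : ℂ} (hz : z ∈ halfPlane ε) :
    matM c ε z =
      1 + cauchy (fun s : ℝ => matM c (-1) s * !![u s * v s, u s; v s, 0]) z := by
  ext a b
  have hint : Integrable (𝓕⁻ (c a b)) := by
    fin_cases b
    · exact ((h a).integrable_fourierInv hu hv).1
    · exact ((h a).integrable_fourierInv hu hv).2
  have hC : NLSGI.cauchy (fun s : ℝ => matM c (-1) s * !![u s * v s, u s; v s, 0]) z a b =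
      (2 * Real.pi * Complex.I)⁻¹ * ∫ s : ℝ, 𝓕⁻ (c a b) s / ((s : ℂ) - z) := by
    simp only [NLSGI.cauchy, ← h.jump, Matrix.sub_apply, matM_sub_matM h]
  rw [Matrix.add_apply, hC, cauchy_integral_fourierInv hε (h.integrable a b) hint hz]
  rfl

end MatrixData

theorem det_one_add_jump (p q : ℂ) : (1 + !![p * q, p; q, 0] : Mat2).det = 1 := by
  rw [Matrix.det_fin_two]
  simp

/-- The jump has determinant one, so `det M_±` is one entire function, which tends to `1`. -/
theorem det_eq_one {Mp Mm : ℂ → Mat2} (hp : IsSectionalM 1 Mp) (hm : IsSectionalM (-1) Mm)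
    {J : ℝ → Mat2} (hJ : ∀ s, (1 + J s).det = 1) (hj : ∀ s : ℝ, Mp s - Mm s = Mm s * J s) :
    (∀ z ∈ closedHalfPlane 1, (Mp z).det = 1) ∧ (∀ z ∈ closedHalfPlane (-1), (Mm z).det = 1) := by
  have hsec : ∀ {ε : ℝ} {M : ℂ → Mat2}, IsSectionalM ε M →
      IsSectionalZero ε (fun z => (M z).det - 1) := by
    intro ε M hM
    refine ⟨?_, ?_, ?_⟩
    · simp only [Matrix.det_fin_two]
      exact (((hM.analytic 0 0).mul (hM.analytic 1 1)).sub
        ((hM.analytic 0 1).mul (hM.analytic 1 0))).sub_const _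
    · exact (Continuous.matrix_det continuous_id).comp_continuousOn hM.continuous |>.sub
        continuousOn_const
    · have := ((Continuous.matrix_det continuous_id).tendsto (1 : Mat2)).comp hM.normalized
      have h2 := this.sub_const 1
      simpa [Function.comp_def] using h2
  have hp' := hsec hp
  have hm' := hsec hm
  obtain ⟨h1, h2⟩ := glue_const hp'.analytic hp'.continuous hm'.analytic hm'.continuous
    (fun s => by
      have : Mp s = Mm s * (1 + J s) := by rw [mul_add, mul_one, ← hj]; abel
      rw [this, Matrix.det_mul, hJ, mul_one]) hp'.div_tendsto hm'.div_tendsto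
  have h0 : (Mp 0).det - 1 = 0 := by
    have hl := hp'.vanishing.comp (tendsto_ofReal_atInf 1)
    refine tendsto_nhds_unique (tendsto_const_nhds.congr fun s : ℝ => ?_) hl
    exact (h1 s (ofReal_mem_closedHalfPlane 1 s)).symm
  rw [h0] at h1 h2
  exact ⟨fun z hz => sub_eq_zero.1 (h1 z hz), fun z hz => sub_eq_zero.1 (h2 z hz)⟩

/-! ### Uniqueness in the `z`-plane -/

/-- The requirements on `N = M - 1`, with continuity at the origin weakened to boundedness. -/
structure IsSectionalN (ε : ℝ) (N : ℂ → Mat2) : Prop where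
  analytic : ∀ a b, DifferentiableOn ℂ (fun z => N z a b) (halfPlane ε)
  continuous : ContinuousOn N (closedHalfPlane ε \ {0})
  bounded : ∃ C ρ : ℝ, 0 < ρ ∧ ∀ z ∈ closedHalfPlane ε, z ≠ 0 → ‖z‖ < ρ → ∀ a b, ‖N z a b‖ ≤ C
  vanishing : Tendsto N (atInf ε) (𝓝 0)

theorem IsSectionalN.continuousOn_smul {ε : ℝ} {N : ℂ → Mat2} (hN : IsSectionalN ε N) :
    ContinuousOn (fun z => z • N z) (closedHalfPlane ε) := by
  intro z hz
  rcases eq_or_ne z 0 with rfl | hz0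
  · obtain ⟨C, ρ, hρ, hC⟩ := hN.bounded
    refine tendsto_pi_nhds.2 fun a => tendsto_pi_nhds.2 fun b => ?_
    have h0 : ((0 : ℂ) • N 0) a b = 0 := by simp
    change Tendsto (fun z : ℂ => (z • N z) a b) _ (𝓝 (((0 : ℂ) • N 0) a b))
    rw [h0]
    refine squeeze_zero_norm' (a := fun z : ℂ => ‖z‖ * |C|) ?_ ?_
    · filter_upwards [self_mem_nhdsWithin,
        mem_nhdsWithin_of_mem_nhds (Metric.ball_mem_nhds (0 : ℂ) hρ)] with z hz hzρ
      rw [Matrix.smul_apply, norm_smul]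
      rcases eq_or_ne z 0 with rfl | hz0
      · simp
      · gcongr
        exact (hC z hz hz0 (by simpa using hzρ) a b).trans (le_abs_self C)
    · have : Continuous fun z : ℂ => ‖z‖ * |C| := by fun_prop
      simpa using (this.tendsto 0).mono_left nhdsWithin_le_nhds
  · have h1 : ContinuousWithinAt N (closedHalfPlane ε) z := by
      refine (hN.continuous z ⟨hz, hz0⟩).mono_of_mem_nhdsWithin ?_
      exact inter_mem self_mem_nhdsWithin
        (mem_nhdsWithin_of_mem_nhds (isOpen_compl_singleton.mem_nhds hz0))
    exact continuousWithinAt_id.smul h1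

theorem IsSectionalM.differentiableOn_adjugate {ε : ℝ} {M : ℂ → Mat2} (hM : IsSectionalM ε M)
    (a b : Fin 2) : DifferentiableOn ℂ (fun z => (M z).adjugate a b) (halfPlane ε) := by
  simp only [Matrix.adjugate_fin_two]
  fin_cases a <;> fin_cases b
  · simpa using hM.analytic 1 1
  · simpa using (hM.analytic 0 1).neg
  · simpa using (hM.analytic 1 0).neg
  · simpa using hM.analytic 0 0

/-- A solution `M` with determinant one is the only one, even among those which are only bounded
near the origin: `(N + 1) M⁻¹ - 1` has no jump, so `z ((N + 1) M⁻¹ - 1)` is entire and `o(|z|)`,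
hence constant, and it vanishes at the origin. -/
theorem eq_of_isSectionalN {Mp Mm Np Nm : ℂ → Mat2} {J : ℝ → Mat2} (hMp : IsSectionalM 1 Mp)
    (hMm : IsSectionalM (-1) Mm) (hNp : IsSectionalN 1 Np) (hNm : IsSectionalN (-1) Nm)
    (hJ : ∀ s, (1 + J s).det = 1) (hM : ∀ s : ℝ, Mp s - Mm s = Mm s * J s)
    (hN : ∀ s : ℝ, s ≠ 0 → Np s - Nm s = (Nm s + 1) * J s) :
    (∀ z ∈ closedHalfPlane 1, z ≠ 0 → Np z = Mp z - 1) ∧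
      ∀ z ∈ closedHalfPlane (-1), z ≠ 0 → Nm z = Mm z - 1 := by
  obtain ⟨hdp, hdm⟩ := det_eq_one hMp hMm hJ hM
  set Φ : (ℂ → Mat2) → (ℂ → Mat2) → ℂ → Mat2 := fun N M z =>
    (z • N z) * (M z).adjugate + z • ((M z).adjugate - 1) with hΦ
  have hΦeq : ∀ N M z, Φ N M z = z • ((N z + 1) * (M z).adjugate - 1) := by
    intro N M z
    simp only [hΦ]
    rw [Matrix.smul_mul, ← smul_add, add_mul, one_mul, add_sub_assoc]
  have hd : ∀ {ε : ℝ} {N M : ℂ → Mat2}, IsSectionalN ε N → IsSectionalM ε M → ∀ a b,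
      DifferentiableOn ℂ (fun z => Φ N M z a b) (halfPlane ε) := by
    intro ε N M hN hM a b
    have h1 : ∀ z, Φ N M z a b = (z * N z a 0 * (M z).adjugate 0 b +
        z * N z a 1 * (M z).adjugate 1 b) + z * ((M z).adjugate a b - (1 : Mat2) a b) := by
      intro z
      simp [hΦ, Matrix.mul_apply, Fin.sum_univ_two]
      ring
    simp only [h1]
    have hid : DifferentiableOn ℂ (fun z : ℂ => z) (halfPlane ε) := differentiableOn_id
    exact (((hid.mul (hN.analytic a 0)).mul (hM.differentiableOn_adjugate 0 b)).add
      ((hid.mul (hN.analytic a 1)).mul (hM.differentiableOn_adjugate 1 b))).add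
      (hid.mul ((hM.differentiableOn_adjugate a b).sub_const _))
  have hadj : ∀ {ε : ℝ} {M : ℂ → Mat2}, IsSectionalM ε M →
      ContinuousOn (fun z => (M z).adjugate) (closedHalfPlane ε) := fun hM =>
    (Continuous.matrix_adjugate continuous_id).comp_continuousOn hM.continuous
  have hc : ∀ {ε : ℝ} {N M : ℂ → Mat2}, IsSectionalN ε N → IsSectionalM ε M → ∀ a b,
      ContinuousOn (fun z => Φ N M z a b) (closedHalfPlane ε) := by
    intro ε N M hN hM a b
    have h1 : ContinuousOn (Φ N M) (closedHalfPlane ε) :=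
      (hN.continuousOn_smul.mul (hadj hM)).add
        (continuousOn_id.smul ((hadj hM).sub continuousOn_const))
    exact continuousOn_pi.1 (continuousOn_pi.1 h1 a) b
  have ht : ∀ {ε : ℝ} {N M : ℂ → Mat2}, IsSectionalN ε N → IsSectionalM ε M → ∀ a b,
      Tendsto (fun z => Φ N M z a b / z) (atInf ε) (𝓝 0) := by
    intro ε N M hN hM a b
    have h1 := ((Continuous.matrix_adjugate continuous_id).tendsto (1 : Mat2)).comp hM.normalized
    have h2 := ((hN.vanishing.add_const 1).mul h1).sub_const 1
    simp only [zero_add, id_eq, Matrix.adjugate_one, mul_one, sub_self] at h2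
    have h3 := tendsto_pi_nhds.1 (tendsto_pi_nhds.1 h2 a) b
    refine h3.congr' ?_
    filter_upwards [eventually_ne_zero_atInf ε] with z hz
    rw [hΦeq, Matrix.smul_apply, smul_eq_mul, mul_div_cancel_left₀ _ hz]
    rfl
  have hglue : ∀ s : ℝ, Φ Np Mp s = Φ Nm Mm s := by
    intro s
    rw [hΦeq, hΦeq]
    rcases eq_or_ne s 0 with rfl | hs
    · simp
    have e1 : Np s + 1 = (Nm s + 1) * (1 + J s) := by
      rw [mul_add, mul_one, ← hN s hs]
      abel
    have e2 : Mp s = Mm s * (1 + J s) := by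
      rw [mul_add, mul_one, ← hM]
      abel
    rw [e1, e2, Matrix.adjugate_mul_distrib, ← mul_assoc, mul_assoc (Nm s + 1),
      Matrix.mul_adjugate, hJ, one_smul, mul_one]
  have hzero := fun a b => glue_const (hd hNp hMp a b) (hc hNp hMp a b) (hd hNm hMm a b)
    (hc hNm hMm a b) (fun s => by rw [hglue]) (ht hNp hMp a b) (ht hNm hMm a b)
  have h0 : ∀ a b, Φ Np Mp 0 a b = 0 := by simp [hΦeq]
  have hfin : ∀ {N M : ℂ → Mat2} {z : ℂ}, (M z).det = 1 → z ≠ 0 → Φ N M z = 0 →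
      N z = M z - 1 := by
    intro N M z hdet hz hΦ0
    rw [hΦeq, smul_eq_zero_iff_right hz, sub_eq_zero] at hΦ0
    have h1 : (N z + 1) * ((M z).adjugate * M z) = M z := by rw [← mul_assoc, hΦ0, one_mul]
    rw [Matrix.adjugate_mul, hdet, one_smul, mul_one] at h1
    rw [← h1, add_sub_cancel_right]
  refine ⟨fun z hz hz0 => hfin (hdp z hz) hz0 ?_, fun z hz hz0 => hfin (hdm z hz) hz0 ?_⟩
  · ext a b
    rw [(hzero a b).1 z hz, h0]
    rfl
  · ext a b
    rw [(hzero a b).2 z hz, h0]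
    rfl

/-! ### Passage between the `z`-plane and the `k`-plane -/

/-- The diagonal of `τ_j(k)`, for `k ≠ 0`. -/
def tauDiag : Fin 2 → ℂ → Fin 2 → ℂ
  | 0, k => ![1, 2 * k]
  | 1, k => ![(2 * k)⁻¹, 1]

/-- The diagonal of `τ_j(k)⁻¹`, for `k ≠ 0`. -/
def tauInvDiag : Fin 2 → ℂ → Fin 2 → ℂ
  | 0, k => ![1, (2 * k)⁻¹]
  | 1, k => ![2 * k, 1]

theorem tau_eq_diagonal (j : Fin 2) {k : ℂ} (hk : k ≠ 0) :
    tau j k = Matrix.diagonal (tauDiag j k) := by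
  have h2 : (2 * k)⁻¹ * (2 * k) = 1 := inv_mul_cancel₀ (by simpa using hk)
  ext a b
  fin_cases j <;> fin_cases a <;> fin_cases b <;> simp [tau, tauDiag]
  field_simp

theorem tauDiag_mul_tauInvDiag (j : Fin 2) {k : ℂ} (hk : k ≠ 0) (b : Fin 2) :
    tauDiag j k b * tauInvDiag j k b = 1 := by
  have h2 : (2 * k) ≠ 0 := by simpa using hk
  fin_cases j <;> fin_cases b <;> simp [tauDiag, tauInvDiag] <;> field_simp

theorem tau_inv_eq_diagonal (j : Fin 2) {k : ℂ} (hk : k ≠ 0) :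
    (tau j k)⁻¹ = Matrix.diagonal (tauInvDiag j k) := by
  refine Matrix.inv_eq_right_inv ?_
  rw [tau_eq_diagonal j hk, Matrix.diagonal_mul_diagonal]
  simp only [tauDiag_mul_tauInvDiag j hk, Matrix.diagonal_one]

theorem tau_mul_inv (j : Fin 2) {k : ℂ} (hk : k ≠ 0) : tau j k * (tau j k)⁻¹ = 1 := by
  rw [tau_inv_eq_diagonal j hk, tau_eq_diagonal j hk, Matrix.diagonal_mul_diagonal]
  simp only [tauDiag_mul_tauInvDiag j hk, Matrix.diagonal_one]

theorem tau_inv_mul (j : Fin 2) {k : ℂ} (hk : k ≠ 0) : (tau j k)⁻¹ * tau j k = 1 :=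
  mul_eq_one_comm.1 (tau_mul_inv j hk)

theorem differentiableOn_tauDiag (j b : Fin 2) :
    DifferentiableOn ℂ (fun k => tauDiag j k b) {0}ᶜ := by
  have h2 : DifferentiableOn ℂ (fun k : ℂ => (2 * k)⁻¹) {0}ᶜ :=
    DifferentiableOn.inv (by fun_prop) fun k hk => by simpa using hk
  fin_cases j <;> fin_cases b
  · exact differentiableOn_const _
  · exact (by fun_prop : DifferentiableOn ℂ (fun k : ℂ => 2 * k) ({0}ᶜ : Set ℂ))
  · exact h2
  · exact differentiableOn_const _

theorem differentiableOn_tauInvDiag (j b : Fin 2) :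
    DifferentiableOn ℂ (fun k => tauInvDiag j k b) {0}ᶜ := by
  have h2 : DifferentiableOn ℂ (fun k : ℂ => (2 * k)⁻¹) {0}ᶜ :=
    DifferentiableOn.inv (by fun_prop) fun k hk => by simpa using hk
  fin_cases j <;> fin_cases b
  · exact differentiableOn_const _
  · exact h2
  · exact (by fun_prop : DifferentiableOn ℂ (fun k : ℂ => 2 * k) ({0}ᶜ : Set ℂ))
  · exact differentiableOn_const _

theorem ofReal_re_sq {k : ℂ} (hk : k ∈ cross) : (((k ^ 2).re : ℝ) : ℂ) = k ^ 2 := by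
  refine Complex.ext (by simp) ?_
  rw [Complex.ofReal_im, pow_two, Complex.mul_im]
  rcases hk with h | h <;> rw [h] <;> ring

/-- The jump matrices in the two planes are conjugate by `τ_j`. -/
theorem tau_mul_jumpS {rp rm : ℝ → ℂ} (hrel : ∀ z : ℝ, rm z = 4 * z * rp z) (x : ℝ) (j : Fin 2)
    {k : ℂ} (hk : k ∈ cross) :
    tau j k * jumpS rp x k = jumpR rp rm x (k ^ 2).re * tau j k := by
  -- The sign in `S` is the one in `conj k = ± k`.
  have hS : jumpS rp x k = !![4 * k ^ 2 * (star (rp (k ^ 2).re) * rp (k ^ 2).re),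
      2 * k * star (rp (k ^ 2).re) * Complex.exp (-(2 * Complex.I * (k ^ 2 + 1) * x));
      2 * k * rp (k ^ 2).re * Complex.exp (2 * Complex.I * (k ^ 2 + 1) * x), 0] := by
    have hn : ((‖refl rp k‖ : ℝ) : ℂ) ^ 2 = star (refl rp k) * refl rp k := by
      have := Complex.conj_mul' (refl rp k)
      exact this.symm
    have hst : star (refl rp k) = 2 * (starRingEnd ℂ) k * star (rp (k ^ 2).re) := by
      simp only [refl]
      change (starRingEnd ℂ) _ = 2 * (starRingEnd ℂ) k * (starRingEnd ℂ) _
      rw [map_mul, map_mul, map_ofNat]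
    by_cases him : k.im = 0
    · have hck : (starRingEnd ℂ) k = k := Complex.conj_eq_iff_im.2 him
      rw [jumpS, if_pos him, hn, hst, hck]
      congr 1
      simp only [refl]
      ring_nf
    · have hre : k.re = 0 := hk.resolve_left him
      have hck : (starRingEnd ℂ) k = -k := by
        apply Complex.ext <;> simp [hre]
      rw [jumpS, if_neg him, hn, hst, hck]
      congr 1
      simp only [refl]
      ring_nf
  have hR : jumpR rp rm x (k ^ 2).re = !![4 * k ^ 2 * (star (rp (k ^ 2).re) * rp (k ^ 2).re),
      star (rp (k ^ 2).re) * Complex.exp (-(2 * Complex.I * (k ^ 2 + 1) * x));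
      4 * k ^ 2 * rp (k ^ 2).re * Complex.exp (2 * Complex.I * (k ^ 2 + 1) * x), 0] := by
    rw [jumpR, hrel, ofReal_re_sq hk]
    congr 1
    ring_nf
  rw [hS, hR]
  have h0 : tau 0 k * !![4 * k ^ 2 * (star (rp (k ^ 2).re) * rp (k ^ 2).re),
      2 * k * star (rp (k ^ 2).re) * Complex.exp (-(2 * Complex.I * (k ^ 2 + 1) * x));
      2 * k * rp (k ^ 2).re * Complex.exp (2 * Complex.I * (k ^ 2 + 1) * x), 0] =
      !![4 * k ^ 2 * (star (rp (k ^ 2).re) * rp (k ^ 2).re),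
      star (rp (k ^ 2).re) * Complex.exp (-(2 * Complex.I * (k ^ 2 + 1) * x));
      4 * k ^ 2 * rp (k ^ 2).re * Complex.exp (2 * Complex.I * (k ^ 2 + 1) * x), 0] * tau 0 k := by
    simp only [tau, Matrix.mul_fin_two]
    congr 1
    ring_nf
  have h1 : tau 1 k = (2 * k)⁻¹ • tau 0 k := rfl
  fin_cases j
  · exact h0
  · change tau 1 k * _ = _ * tau 1 k
    rw [h1, Matrix.smul_mul, h0, Matrix.mul_smul]

theorem ne_zero_of_mem_quadrants {ε : ℝ} {k : ℂ} (hk : k ∈ quadrants ε) : k ≠ 0 := by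
  rintro rfl
  simp [quadrants, halfPlane] at hk

theorem tendsto_sq_atInf (ε : ℝ) :
    Tendsto (fun k : ℂ => k ^ 2) (cocompact ℂ ⊓ 𝓟 (closedQuadrants ε)) (atInf ε) := by
  refine tendsto_inf.2 ⟨Tendsto.mono_left ?_ inf_le_left, ?_⟩
  · rw [← Metric.cobounded_eq_cocompact, ← tendsto_norm_atTop_iff_cobounded]
    simp only [norm_pow]
    exact (tendsto_pow_atTop two_ne_zero).comp tendsto_norm_cobounded_atTop
  · exact tendsto_principal.2 (eventually_inf_principal.2 (Eventually.of_forall fun k hk => hk.2))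

theorem xiOf_eq (j : Fin 2) (M : ℂ → Mat2) (k : ℂ) :
    xiOf j M k = (M (k ^ 2) - 1) * tau j k := by
  rw [xiOf, sub_mul, one_mul]

theorem xiOf_mul_inv (j : Fin 2) (M : ℂ → Mat2) {k : ℂ} (hk : k ≠ 0) :
    xiOf j M k * (tau j k)⁻¹ = M (k ^ 2) - 1 := by
  rw [xiOf_eq, mul_assoc, tau_mul_inv j hk, mul_one]

theorem xiOf_apply (j : Fin 2) (M : ℂ → Mat2) {k : ℂ} (hk : k ≠ 0) (a b : Fin 2) :
    xiOf j M k a b = (M (k ^ 2) - 1) a b * tauDiag j k b := by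
  rw [xiOf_eq, tau_eq_diagonal j hk, Matrix.mul_diagonal]

/-- The decay of the second column of `M - 1` compensates the growth of `τ₁`. -/
theorem IsSectionalM.tendsto_xiOf {ε : ℝ} {M : ℂ → Mat2} (hM : IsSectionalM ε M) {K : ℝ}
    (hK : ∀ a, ∀ z ∈ closedHalfPlane ε, ‖z * (M z - 1) a 1‖ ≤ K) (j a b : Fin 2) :
    Tendsto (fun k => (M (k ^ 2) - 1) a b * tauDiag j k b)
      (cocompact ℂ ⊓ 𝓟 (closedQuadrants ε)) (𝓝 0) := by
  have h0 : Tendsto (fun k : ℂ => (M (k ^ 2) - 1) a b)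
      (cocompact ℂ ⊓ 𝓟 (closedQuadrants ε)) (𝓝 0) := by
    have h := (hM.normalized.sub_const 1).comp (tendsto_sq_atInf ε)
    rw [sub_self] at h
    exact tendsto_pi_nhds.1 (tendsto_pi_nhds.1 h a) b
  have hinv : Tendsto (fun k : ℂ => k⁻¹) (cocompact ℂ ⊓ 𝓟 (closedQuadrants ε)) (𝓝 0) :=
    tendsto_inv_cocompact.mono_left inf_le_left
  have hone : Tendsto (fun k : ℂ => (M (k ^ 2) - 1) a b * 1)
      (cocompact ℂ ⊓ 𝓟 (closedQuadrants ε)) (𝓝 0) := by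
    simpa only [mul_one] using h0
  fin_cases j <;> fin_cases b
  · exact hone
  · refine squeeze_zero_norm' (a := fun k : ℂ => K * ‖2 * k⁻¹‖) ?_ ?_
    · refine eventually_inf_principal.2 (Eventually.of_forall fun k hk => ?_)
      have e : (M (k ^ 2) - 1) a 1 * (2 * k) = k ^ 2 * (M (k ^ 2) - 1) a 1 * (2 * k⁻¹) := by
        have := hk.1
        field_simp
      change ‖(M (k ^ 2) - 1) a 1 * (2 * k)‖ ≤ _
      rw [e, norm_mul]
      exact mul_le_mul_of_nonneg_right (hK a _ hk.2) (norm_nonneg _)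
    · simpa using ((hinv.const_mul 2).norm).const_mul K
  · have h := h0.mul (hinv.const_mul 2⁻¹)
    rw [mul_zero, mul_zero] at h
    refine h.congr fun k => ?_
    change _ = _ * (2 * k)⁻¹
    rw [mul_inv]
  · exact hone

theorem IsSectionalM.isSectionalXi {ε : ℝ} {M : ℂ → Mat2} (hM : IsSectionalM ε M) {K : ℝ}
    (hK : ∀ a, ∀ z ∈ closedHalfPlane ε, ‖z * (M z - 1) a 1‖ ≤ K) (j : Fin 2) :
    IsSectionalXi ε j (xiOf j M) := by
  have hsq : ContinuousOn (fun k : ℂ => M (k ^ 2) - 1) (closedQuadrants ε) :=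
    (hM.continuous.comp (by fun_prop) fun k hk => hk.2).sub continuousOn_const
  refine ⟨fun a b => ?_, ?_, ?_, fun k hk => ?_, ?_, ?_⟩
  · have h1 : DifferentiableOn ℂ (fun k : ℂ => M (k ^ 2) a b) (quadrants ε) :=
      (hM.analytic a b).comp (by fun_prop) fun k hk => hk
    refine ((h1.sub_const ((1 : Mat2) a b)).mul ((differentiableOn_tauDiag j b).mono ?_)).congr
      fun k hk => xiOf_apply j M (ne_zero_of_mem_quadrants hk) a b
    exact fun k hk => ne_zero_of_mem_quadrants hk
  · refine continuousOn_pi.2 fun a => continuousOn_pi.2 fun b => ?_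
    refine ((continuousOn_pi.1 (continuousOn_pi.1 hsq a) b).mul
      ((differentiableOn_tauDiag j b).continuousOn.mono ?_)).congr
      fun k hk => xiOf_apply j M hk.1 a b
    exact fun k hk => hk.1
  · refine tendsto_pi_nhds.2 fun a => tendsto_pi_nhds.2 fun b => ?_
    refine (hM.tendsto_xiOf hK j a b).congr' ?_
    exact eventually_inf_principal.2
      (Eventually.of_forall fun k hk => (xiOf_apply j M hk.1 a b).symm)
  · rw [xiOf_mul_inv j M (neg_ne_zero.2 hk.1), xiOf_mul_inv j M hk.1, neg_sq]
  · have hc : ContinuousOn (fun z => ∑ a, ∑ b, ‖(M z - 1) a b‖)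
        (closedHalfPlane ε ∩ Metric.closedBall 0 1) := by
      refine continuousOn_finsetSum _ fun a _ => continuousOn_finsetSum _ fun b _ => ?_
      have h1 := (hM.continuous.sub (continuousOn_const (c := (1 : Mat2)))).mono
        (inter_subset_left (t := Metric.closedBall 0 1))
      exact (continuousOn_pi.1 (continuousOn_pi.1 h1 a) b).norm
    obtain ⟨C, hC⟩ := ((isCompact_closedBall (0 : ℂ) 1).inter_left
      (isClosed_closedHalfPlane ε)).exists_bound_of_continuousOn hc
    refine ⟨C, 1, one_pos, fun k hk hk1 a b => ?_⟩
    rw [xiOf_mul_inv j M hk.1]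
    have hmem : k ^ 2 ∈ closedHalfPlane ε ∩ Metric.closedBall 0 1 := by
      refine ⟨hk.2, ?_⟩
      rw [mem_closedBall_zero_iff, norm_pow]
      exact pow_le_one₀ (norm_nonneg _) hk1.le
    refine le_trans ?_ ((le_abs_self _).trans (hC _ hmem))
    refine le_trans ?_ (Finset.single_le_sum (f := fun a => ∑ b, ‖(M (k ^ 2) - 1) a b‖)
      (fun _ _ => Finset.sum_nonneg fun _ _ => norm_nonneg _) (Finset.mem_univ a))
    exact Finset.single_le_sum (f := fun b => ‖(M (k ^ 2) - 1) a b‖)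
      (fun _ _ => norm_nonneg _) (Finset.mem_univ b)
  · have h := (hM.normalized.sub_const 1).comp (tendsto_sq_atInf ε)
    rw [sub_self] at h
    refine h.congr' ?_
    exact eventually_inf_principal.2
      (Eventually.of_forall fun k hk => (xiOf_mul_inv j M hk.1).symm)

theorem mem_cross_of_sq_eq {k : ℂ} {s : ℝ} (hk : k ^ 2 = s) : k ∈ cross := by
  have h := congrArg Complex.im hk
  rw [pow_two, Complex.mul_im, Complex.ofReal_im] at h
  have h2 : k.im * k.re = 0 := by linarith
  exact mul_eq_zero.1 h2

theorem ne_zero_of_sq_eq {k : ℂ} {s : ℝ} (hk : k ^ 2 = s) (hs : s ≠ 0) : k ≠ 0 := by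
  rintro rfl
  apply hs
  simpa using hk.symm

theorem mem_closedQuadrants_of_sq_eq (ε : ℝ) {k : ℂ} {s : ℝ} (hk : k ^ 2 = s) (hs : s ≠ 0) :
    k ∈ closedQuadrants ε :=
  ⟨ne_zero_of_sq_eq hk hs, by rw [hk]; exact ofReal_mem_closedHalfPlane ε s⟩

theorem IsSolutionM.jump_xiOf {rp rm : ℝ → ℂ} {x : ℝ} {Mp Mm : ℂ → Mat2}
    (h : IsSolutionM rp rm x Mp Mm) (hrel : ∀ z : ℝ, rm z = 4 * z * rp z) (j : Fin 2) {k : ℂ}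
    (hk : k ∈ cross) :
    xiOf j Mp k - xiOf j Mm k = xiOf j Mm k * jumpS rp x k + jumpF rp x j k := by
  have hj := h.jump (k ^ 2).re
  rw [ofReal_re_sq hk] at hj
  have e1 : xiOf j Mp k - xiOf j Mm k = (Mp (k ^ 2) - Mm (k ^ 2)) * tau j k := by
    rw [xiOf, xiOf, sub_mul]
    abel
  rw [e1, hj, mul_assoc, ← tau_mul_jumpS hrel x j hk, xiOf, jumpF, sub_mul, mul_assoc,
    sub_add_cancel]

/-- A square root `k` of `z` which is continuous on the closed half plane: `-εiz` has nonnegative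
real part there, so the principal branch applies to it. -/
def sqrtHalf (ε : ℝ) (z : ℂ) : ℂ :=
  (ε * Complex.I) ^ (((2 : ℕ) : ℂ)⁻¹) * (-(ε * Complex.I) * z) ^ (((2 : ℕ) : ℂ)⁻¹)

section sqrtHalf

variable {ε : ℝ} (hε : ε = 1 ∨ ε = -1)
include hε

theorem sqrtHalf_sq (z : ℂ) : sqrtHalf ε z ^ 2 = z := by
  rw [sqrtHalf, mul_pow, Complex.cpow_nat_inv_pow _ two_ne_zero,
    Complex.cpow_nat_inv_pow _ two_ne_zero]
  have h2 : (ε : ℂ) ^ 2 = 1 := by rcases hε with rfl | rfl <;> simp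
  linear_combination (-(ε : ℂ) ^ 2 * z) * Complex.I_sq + z * h2

theorem sqrtHalf_mem_closedQuadrants {z : ℂ} (hz : z ∈ closedHalfPlane ε) (hz0 : z ≠ 0) :
    sqrtHalf ε z ∈ closedQuadrants ε := by
  refine ⟨fun h0 => hz0 ?_, ?_⟩
  · rw [← sqrtHalf_sq hε z, h0, zero_pow two_ne_zero]
  · rwa [sqrtHalf_sq hε z]

theorem norm_sqrtHalf (z : ℂ) : ‖sqrtHalf ε z‖ = √‖z‖ := by
  rw [← Real.sqrt_sq (norm_nonneg (sqrtHalf ε z)), ← norm_pow, sqrtHalf_sq hε]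

theorem differentiableAt_sqrtHalf {z : ℂ} (hz : z ∈ closedHalfPlane ε) (hz0 : z ≠ 0) :
    DifferentiableAt ℂ (sqrtHalf ε) z := by
  have hs : -(ε * Complex.I) * z ∈ Complex.slitPlane := by
    rw [Complex.mem_slitPlane_iff]
    have hre : (-(ε * Complex.I) * z).re = ε * z.im := by simp
    have him : (-(ε * Complex.I) * z).im = -(ε * z.re) := by simp
    rw [hre, him]
    have hz' : 0 ≤ ε * z.im := hz
    by_contra! hc
    apply hz0
    have h1 : ε * z.im = 0 := le_antisymm hc.1 hz'
    have hε0 : ε ≠ 0 := by rcases hε with rfl | rfl <;> norm_num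
    refine Complex.ext ?_ ((mul_eq_zero.1 h1).resolve_left hε0)
    exact (mul_eq_zero.1 (neg_eq_zero.1 hc.2)).resolve_left hε0
  have h1 : DifferentiableAt ℂ (fun z : ℂ => -(ε * Complex.I) * z) z := by fun_prop
  exact (h1.cpow_const (c := ((2 : ℕ) : ℂ)⁻¹) hs).const_mul _

theorem tendsto_sqrtHalf :
    Tendsto (sqrtHalf ε) (atInf ε) (cocompact ℂ ⊓ 𝓟 (closedQuadrants ε)) := by
  refine tendsto_inf.2 ⟨Tendsto.mono_left ?_ inf_le_left, tendsto_principal.2 ?_⟩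
  · rw [← Metric.cobounded_eq_cocompact, ← tendsto_norm_atTop_iff_cobounded]
    simp only [norm_sqrtHalf hε]
    exact Real.tendsto_sqrt_atTop.comp tendsto_norm_cobounded_atTop
  · have hm : ∀ᶠ z in atInf ε, z ∈ closedHalfPlane ε := mem_inf_of_right (mem_principal_self _)
    filter_upwards [hm, eventually_ne_zero_atInf ε] with z hz hz0
    exact sqrtHalf_mem_closedQuadrants hε hz hz0

/-- `Ξ τ_j⁻¹` as a function of `z = k²`. -/
theorem IsSectionalXi.isSectionalN {j : Fin 2} {Xi : ℂ → Mat2} (h : IsSectionalXi ε j Xi) :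
    IsSectionalN ε (fun z => Xi (sqrtHalf ε z) * (tau j (sqrtHalf ε z))⁻¹) := by
  have hd : DifferentiableOn ℂ (sqrtHalf ε) (closedHalfPlane ε \ {0}) := fun z hz =>
    (differentiableAt_sqrtHalf hε hz.1 hz.2).differentiableWithinAt
  have hne : ∀ {z : ℂ}, z ∈ halfPlane ε → z ≠ 0 := by
    rintro z hz rfl
    simp [halfPlane] at hz
  have hsub : halfPlane ε ⊆ closedHalfPlane ε \ {0} := fun z hz =>
    ⟨halfPlane_subset_closedHalfPlane ε hz, hne hz⟩
  have hmem : MapsTo (sqrtHalf ε) (closedHalfPlane ε \ {0}) (closedQuadrants ε) := fun z hz =>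
    sqrtHalf_mem_closedQuadrants hε hz.1 hz.2
  have hentry : ∀ z ∈ closedHalfPlane ε \ {0}, ∀ a b,
      (Xi (sqrtHalf ε z) * (tau j (sqrtHalf ε z))⁻¹) a b =
        Xi (sqrtHalf ε z) a b * tauInvDiag j (sqrtHalf ε z) b := by
    intro z hz a b
    rw [tau_inv_eq_diagonal j (hmem hz).1, Matrix.mul_diagonal]
  refine ⟨fun a b => ?_, ?_, ?_, h.normalized.comp (tendsto_sqrtHalf hε)⟩
  · have h1 : DifferentiableOn ℂ (fun z => Xi (sqrtHalf ε z) a b) (halfPlane ε) :=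
      (h.analytic a b).comp (hd.mono hsub) fun z hz => by
        change sqrtHalf ε z ^ 2 ∈ halfPlane ε
        rwa [sqrtHalf_sq hε]
    have h2 : DifferentiableOn ℂ (fun z => tauInvDiag j (sqrtHalf ε z) b) (halfPlane ε) :=
      (differentiableOn_tauInvDiag j b).comp (hd.mono hsub) fun z hz => (hmem (hsub hz)).1
    exact (h1.mul h2).congr fun z hz => hentry z (hsub hz) a b
  · refine continuousOn_pi.2 fun a => continuousOn_pi.2 fun b => ?_
    have h1 := continuousOn_pi.1 (continuousOn_pi.1 (h.continuous.comp hd.continuousOn hmem) a) b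
    have h2 := (differentiableOn_tauInvDiag j b).continuousOn.comp hd.continuousOn
      fun z hz => (hmem hz).1
    exact (h1.mul h2).congr fun z hz => hentry z hz a b
  · obtain ⟨C, ρ, hρ, hC⟩ := h.bounded
    refine ⟨C, ρ ^ 2, by positivity, fun z hz hz0 hzρ a b => hC _ (hmem ⟨hz, hz0⟩) ?_ a b⟩
    rw [norm_sqrtHalf hε]
    exact (Real.sqrt_lt' hρ).2 hzρ

theorem IsSectionalXi.mul_inv_eq {j : Fin 2} {Xi : ℂ → Mat2} (h : IsSectionalXi ε j Xi) {k : ℂ}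
    (hk : k ∈ closedQuadrants ε) :
    Xi (sqrtHalf ε (k ^ 2)) * (tau j (sqrtHalf ε (k ^ 2)))⁻¹ = Xi k * (tau j k)⁻¹ := by
  rcases sq_eq_sq_iff_eq_or_eq_neg.1 (sqrtHalf_sq hε (k ^ 2)) with e | e
  · rw [e]
  · rw [e, h.even k hk]

end sqrtHalf

section Solution

variable {rp rm : ℝ → ℂ} {x : ℝ} {Mp Mm : ℂ → Mat2}

theorem IsSolutionM.eqOn_xiOf (h : IsSolutionM rp rm x Mp Mm)
    (hrel : ∀ z : ℝ, rm z = 4 * z * rp z) (hdet : ∀ s, (1 + jumpR rp rm x s).det = 1)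
    {j : Fin 2} {Xip Xim : ℂ → Mat2} (hX : IsSolutionXi rp x j Xip Xim) :
    EqOn Xip (xiOf j Mp) (closedQuadrants 1) ∧ EqOn Xim (xiOf j Mm) (closedQuadrants (-1)) := by
  have h1 : (1 : ℝ) = 1 ∨ (1 : ℝ) = -1 := Or.inl rfl
  have h2 : (-1 : ℝ) = 1 ∨ (-1 : ℝ) = -1 := Or.inr rfl
  obtain ⟨hp, hm⟩ := eq_of_isSectionalN h.plus h.minus (hX.plus.isSectionalN h1)
    (hX.minus.isSectionalN h2) hdet h.jump (fun s hs => by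
      set k := sqrtHalf 1 s
      have hk : k ^ 2 = s := sqrtHalf_sq h1 _
      have hk0 := ne_zero_of_sq_eq hk hs
      have hkc := mem_cross_of_sq_eq hk
      have em := hX.minus.mul_inv_eq h2 (mem_closedQuadrants_of_sq_eq (-1) hk hs)
      rw [hk] at em
      have hS := tau_mul_jumpS hrel x j hkc
      rw [hk, Complex.ofReal_re] at hS
      have hR : jumpR rp rm x s = tau j k * jumpS rp x k * (tau j k)⁻¹ := by
        rw [hS, mul_assoc, tau_mul_inv j hk0, mul_one]
      simp only [em]
      rw [← sub_mul, hX.jump k hkc hk0, hR, add_mul, add_mul, one_mul, jumpF]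
      congr 1
      rw [mul_assoc (Xim k) (tau j k)⁻¹, mul_assoc (tau j k), ← mul_assoc (tau j k)⁻¹,
        tau_inv_mul j hk0, one_mul, mul_assoc])
  have hfin : ∀ {ε : ℝ} {Xi M : ℂ → Mat2} (_ : ε = 1 ∨ ε = -1) (_ : IsSectionalXi ε j Xi)
      (_ : ∀ z ∈ closedHalfPlane ε, z ≠ 0 →
        Xi (sqrtHalf ε z) * (tau j (sqrtHalf ε z))⁻¹ = M z - 1),
      EqOn Xi (xiOf j M) (closedQuadrants ε) := by
    intro ε Xi M hε hXi hN k hk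
    have e := hN (k ^ 2) hk.2 (pow_ne_zero 2 hk.1)
    rw [hXi.mul_inv_eq hε hk] at e
    rw [xiOf_eq, ← e, mul_assoc, tau_inv_mul j hk.1, mul_one]
  exact ⟨hfin h1 hX.plus hp, hfin h2 hX.minus hm⟩

/-- In the variable `s = k²` the jump of `Ξ τ_j⁻¹` is that of `M`, off the origin. -/
theorem cauchy_jump_xiOf (hrel : ∀ z : ℝ, rm z = 4 * z * rp z) (j : Fin 2) {κ : ℝ → ℂ}
    (hκ : ∀ s : ℝ, κ s ^ 2 = s) (M : ℂ → Mat2) (z : ℂ) :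
    cauchy (fun s : ℝ => (xiOf j M (κ s) * jumpS rp x (κ s) + jumpF rp x j (κ s)) *
      (tau j (κ s))⁻¹) z = cauchy (fun s : ℝ => M s * jumpR rp rm x s) z := by
  ext a b
  simp only [cauchy]
  congr 1
  refine integral_congr_ae ?_
  filter_upwards [compl_mem_ae_iff.2 (measure_singleton (0 : ℝ))] with s hs
  have hk0 := ne_zero_of_sq_eq (hκ s) hs
  have hS := tau_mul_jumpS hrel x j (mem_cross_of_sq_eq (hκ s))
  rw [hκ, Complex.ofReal_re] at hS
  rw [xiOf, jumpF, ← add_mul, sub_add_cancel, mul_assoc (M _), hS, hκ, ← mul_assoc,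
    mul_assoc (M s * _), tau_mul_inv j hk0, mul_one]

end Solution

end NLSGI

end

theorem corollary1 (rp rm : ℝ → ℂ)
    (hp : NLSGI.MemH1 rp) (hp' : NLSGI.MemL21 rp)
    (hm : NLSGI.MemH1 rm) (hm' : NLSGI.MemL21 rm)
    (hrel : ∀ z : ℝ, rm z = 4 * z * rp z)
    (hconstr : ∃ C₀ : ℝ, 0 < C₀ ∧
      ∀ k : ℂ, k.re = 0 → C₀ ^ 2 ≤ 1 - ‖NLSGI.refl rp k‖ ^ 2)
    (x : ℝ) :
    ∃ Mp Mm : ℂ → NLSGI.Mat2,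
      NLSGI.IsSolutionM rp rm x Mp Mm ∧
      (∀ a b, MemLp (fun s : ℝ => (Mp s - 1) a b) 2 volume ∧
        MemLp (fun s : ℝ => (Mm s - 1) a b) 2 volume ∧
        MemLp (fun s : ℝ => (Mm s * NLSGI.jumpR rp rm x s) a b) 2 volume) ∧
      (∀ z ∈ NLSGI.halfPlane 1,
        Mp z = 1 + NLSGI.cauchy (fun s : ℝ => Mm s * NLSGI.jumpR rp rm x s) z) ∧
      (∀ z ∈ NLSGI.halfPlane (-1),
        Mm z = 1 + NLSGI.cauchy (fun s : ℝ => Mm s * NLSGI.jumpR rp rm x s) z) ∧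
      ∀ j : Fin 2,
        NLSGI.IsSolutionXi rp x j (NLSGI.xiOf j Mp) (NLSGI.xiOf j Mm) ∧
        (∀ Xip Xim : ℂ → NLSGI.Mat2, NLSGI.IsSolutionXi rp x j Xip Xim →
          Set.EqOn Xip (NLSGI.xiOf j Mp) (NLSGI.closedQuadrants 1) ∧
          Set.EqOn Xim (NLSGI.xiOf j Mm) (NLSGI.closedQuadrants (-1))) ∧
        (∀ κ : ℝ → ℂ, (∀ s : ℝ, κ s ^ 2 = s) →
          (∀ k ∈ NLSGI.quadrants 1, NLSGI.xiOf j Mp k =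
            NLSGI.cauchy (fun s : ℝ =>
              (NLSGI.xiOf j Mm (κ s) * NLSGI.jumpS rp x (κ s) + NLSGI.jumpF rp x j (κ s)) *
                (NLSGI.tau j (κ s))⁻¹) (k ^ 2) * NLSGI.tau j k) ∧
          (∀ k ∈ NLSGI.quadrants (-1), NLSGI.xiOf j Mm k =
            NLSGI.cauchy (fun s : ℝ =>
              (NLSGI.xiOf j Mm (κ s) * NLSGI.jumpS rp x (κ s) + NLSGI.jumpF rp x j (κ s)) *
                (NLSGI.tau j (κ s))⁻¹) (k ^ 2) * NLSGI.tau j k)) := by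
  have hprp := NLSGI.isL1H1_of_memH1 hp (NLSGI.integrable_of_memL21 hp.1.aestronglyMeasurable hp')
  have hprm := NLSGI.isL1H1_of_memH1 hm (NLSGI.integrable_of_memL21 hm.1.aestronglyMeasurable hm')
  have hu := NLSGI.isL1H1_upperEntry hprp x
  have hv : NLSGI.IsL1H1 (NLSGI.lowerEntry rm x) := NLSGI.isL1H1_mul_phase hprm x
  have hw := (hv.const_mul 4⁻¹).conj
  have huv := NLSGI.lowerEntry_eq hrel x
  have hwu : ∀ s : ℝ, star ((4 : ℂ)⁻¹ * NLSGI.lowerEntry rm x s) =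
      s * NLSGI.upperEntry rp x s := by
    intro s
    have h4 : (4 : ℂ) ≠ 0 := by norm_num
    have hs : star (s : ℂ) = s := Complex.conj_ofReal s
    rw [huv, mul_assoc, inv_mul_cancel_left₀ h4, star_mul', star_star, hs]
  obtain ⟨c, hc⟩ := NLSGI.exists_isMatrixData hu hv huv
  have h1 : (1 : ℝ) = 1 ∨ (1 : ℝ) = -1 := Or.inl rfl
  have h2 : (-1 : ℝ) = 1 ∨ (-1 : ℝ) = -1 := Or.inr rfl
  have hsol : NLSGI.IsSolutionM rp rm x (NLSGI.matM c 1) (NLSGI.matM c (-1)) :=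
    ⟨hc.isSectionalM h1, hc.isSectionalM h2, fun s => by
      rw [NLSGI.jumpR_eq]
      exact hc.jump s⟩
  have hdet : ∀ s, (1 + NLSGI.jumpR rp rm x s).det = 1 := fun s => by
    rw [NLSGI.jumpR_eq, NLSGI.det_one_add_jump]
  have hL2 := fun {ε : ℝ} (hε : ε = 1 ∨ ε = -1) => hc.memLp hu.memLp hv.memLp hε
  have hC : ∀ {ε : ℝ}, ε = 1 ∨ ε = -1 → ∀ z ∈ NLSGI.halfPlane ε, NLSGI.matM c ε z = 1 +
      NLSGI.cauchy (fun s : ℝ => NLSGI.matM c (-1) s * NLSGI.jumpR rp rm x s) z := by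
    intro ε hε z hz
    simp only [NLSGI.jumpR_eq]
    exact hc.cauchy hu.integrable hv.integrable hε hz
  obtain ⟨K, hK⟩ := hc.exists_bound_mul hw hwu h1
  obtain ⟨K', hK'⟩ := hc.exists_bound_mul hw hwu h2
  have hXC : ∀ {ε : ℝ}, ε = 1 ∨ ε = -1 → ∀ (j : Fin 2) (κ : ℝ → ℂ), (∀ s : ℝ, κ s ^ 2 = s) →
      ∀ k ∈ NLSGI.quadrants ε, NLSGI.xiOf j (NLSGI.matM c ε) k =
        NLSGI.cauchy (fun s : ℝ => (NLSGI.xiOf j (NLSGI.matM c (-1)) (κ s) *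
          NLSGI.jumpS rp x (κ s) + NLSGI.jumpF rp x j (κ s)) *
            (NLSGI.tau j (κ s))⁻¹) (k ^ 2) * NLSGI.tau j k := by
    intro ε hε j κ hκ k hk
    rw [NLSGI.cauchy_jump_xiOf hrel j hκ, NLSGI.xiOf_eq, hC hε _ hk, add_sub_cancel_left]
  refine ⟨NLSGI.matM c 1, NLSGI.matM c (-1), hsol,
    fun a b => ⟨hL2 h1 a b, hL2 h2 a b, ?_⟩, hC h1, hC h2, fun j => ⟨?_, ?_, ?_⟩⟩
  · refine ((hL2 h1 a b).sub (hL2 h2 a b)).ae_eq (ae_of_all _ fun s => ?_)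
    have h := congrFun (congrFun (hsol.jump s) a) b
    rw [← sub_sub_sub_cancel_right _ _ (1 : NLSGI.Mat2)] at h
    exact h
  · exact ⟨hsol.plus.isSectionalXi hK j, hsol.minus.isSectionalXi hK' j,
      fun k hk _ => hsol.jump_xiOf hrel j hk⟩
  · exact fun Xip Xim hX => hsol.eqOn_xiOf hrel hdet hX
  · exact fun κ hκ => ⟨hXC h1 j κ hκ, hXC h2 j κ hκ⟩
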